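/- **Setting.** Let $d\ge 1$, $\hat f(\xi)=\mathcal F f(\xi)=\int_{\mathbb R^d}e^{-2\pi i x\cdot\xi}f(x)\,dx$ (extended to $L^2$ and to tempered distributions), $H^{s}=\{u\in\mathcal S':\ \|u\|_{H^s}:=\|(1+|\xi|^2)^{s/2}\hat u\|_{L^2}<\infty\}$, and let $\langle\cdot,\cdot\rangle_{H^{-1},H^1}$ be the duality pairing extending the $L^2$ inner product. Let $V\in L^\infty_{\rm loc}(\mathbb R^d)$, $V\ge 0$ a.e., and $$V(x)\ \ge\ \mathcal C+V_0(x)\ \text{ for a.e. }x,\qquad V_0(x)=\tfrac12 (x-\mu)\cdot\Sigma^{-1}(x-\mu),$$ with $\mathcal C\in\mathbb R$, $\mu\in\mathbb R^d$ and $\Sigma\in\mathbb R^{d\times d}$ symmetric positive definite. Put $\rho_\infty=\frac1Z e^{-V}$, $Z=\int e^{-V}dx$. Let $k:\mathbb R^d\to\mathbb R$, $k\in L^1+L^2$, satisfy, with a constant $\mathcal D\ge 1$, $$\frac1{\mathcal D}\,\frac1{1+|\xi|^2}\le\hat k(\xi)\le\mathcal D\,\frac1{1+|\xi|^2}\ \text{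 for a.e. }\xi,\qquad \hat k\in W^{1,\infty}(\mathbb R^d).$$ (The associated kernel is $K(x,y)=e^{V(x)-V_0(x)/2}\,k(x-y)\,e^{V(y)-V_0(y)/2}$.) A function $\rho:\mathbb R^d\to\mathbb R$ satisfies (H) if $$\rho\in L^1,\qquad \rho\,e^{V-V_0/2}\in L^2,\qquad \rho\,e^{V-V_0/2}\,\nabla V_0\in H^{-1}.$$ For such $\rho$, the distribution $u=\nabla(\rho e^{V})\,e^{-V_0/2}$ belongs to $H^{-1}$, and $k*u\in H^1$, where $k*\cdot$ is the continuous extension to $H^{-1}\to H^1$ of the convolution with Schwartz functions; put $$\mathbb D_k^2(\rho\|\rho_\infty):=\big\langle \nabla(\rho e^{V})e^{-V_0/2},\ k*\big(\nabla(\rho e^{V})e^{-V_0/2}\big)\big\rangle_{H^{-1},H^1}.$$ For a bounded open set $\Omega=-\Omega\subset\mathbb R^d$ and $a\in\mathbb R^d$ put $$\tau_{\Omega,a}(\rho)=\int_{\Omega}e^{2\pi i a\cdot\xi}\,\mathcal F\big(\rho e^{V-V_0/2}\big)(\xi)\,d\xi\ \Big/\int_{\Omega}e^{2\pi i a\cdot\xi}\,\mathcal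 F\big(e^{-V_0/2}\big)(\xi)\,d\xi\ \in\mathbb R$$ whenever the denominator is nonzero. **Theorem.** There is $\varepsilon>0$ depending only on $d$ such that the following holds. (i) There is $\lambda>0$ depending only on $V,\Sigma,\mathcal C,\mathcal D$ (and $d$) such that, for all $\mu$, $k$ as above and all $\rho$ satisfying (H), the number $\tau=\tau_{\Omega,\mu}(\rho)$ with $\Omega=\{\xi:\ \xi\cdot\Sigma\xi<\varepsilon^2\}$ is well defined and $$\lambda\int_{\mathbb R^d}\big|\rho\,e^{V-V_0/2}-\tau\,e^{-V_0/2}\big|^2dx\ \le\ \mathbb D_k^2(\rho\|\rho_\infty),$$ and, if in addition $\rho$ is a probability density, $$\lambda\,\mathrm{KL}(\rho\|\rho_\infty)\ \le\ \mathbb D_k^2(\rho\|\rho_\infty).$$ (ii) For every $\mu$ as above and every $\delta>0$ with $\int_{B_\delta}\mathcal F(e^{-V_0/2})\,d\xi\ne0$, there is $\lambda>0$ depending only on $V,\Sigma,\mathcal C,\mathcal D,\mu,\delta$ (and $d$) such that, for all $k$ as above and all $\rho$ satisfying (H), the first inequality in (i) also holds with $\tau=\tau_{B_\delta,0}(\rho)$.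 (iii) For all $\mu$, $k$ as above there is $C>0$ (depending on $k$, $V$, $\Sigma$, $\mu$) such that for all $\rho$ satisfying (H) $$\big\|\rho\,e^{V-V_0/2}\big\|_{L^2}^2+\big\|\rho\,e^{V-V_0/2}\,\nabla V_0\big\|_{H^{-1}}^2\ \le\ C\big(\|\rho\|_{L^1}^2+\mathbb D_k^2(\rho\|\rho_\infty)\big).$$ -/

import Mathlib

open MeasureTheory FourierTransform LineDeriv TemperedDistribution
open scoped SchwartzMap ENNReal Matrix Topology

noncomputable section

namespace SteinLogSobolev

/-- Euclidean space `ℝᵈ`. -/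
abbrev E (d : ℕ) : Type := EuclideanSpace ℝ (Fin d)

/-- The `i`-th standard basis vector of `ℝᵈ`. -/
def basisVec {d : ℕ} (i : Fin d) : E d := EuclideanSpace.single i (1 : ℝ)

/-! ### Tempered distributions given by functions, and the spaces `Hˢ` -/

/-- The tempered distribution `T` is (given by) the function `h`: `⟨T, φ⟩ = ∫ φ h` for every Schwartz
function `φ`, the integral being absolutely convergent. -/
def IsGivenBy {d : ℕ} (T : 𝓢'(E d, ℂ)) (h : E d → ℂ) : Prop :=
  ∀ φ : 𝓢(E d, ℂ), Integrable (fun x => φ x * h x) ∧ T φ = ∫ x, φ x * h x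

open Classical in
/-- A function regarded as a tempered distribution (`0` if it does not define one). -/
def toTempered {d : ℕ} (h : E d → ℂ) : 𝓢'(E d, ℂ) :=
  if H : ∃ T : 𝓢'(E d, ℂ), IsGivenBy T h then H.choose else 0

open Classical in
/-- For `u ∈ Hˢ`, the `L²` function `𝓕⁻¹ ((1 + |ξ|²) ^ (s / 2) 𝓕 u)` (and `0` if `u ∉ Hˢ`). -/
def besselRep {d : ℕ} (s : ℝ) (u : 𝓢'(E d, ℂ)) : Lp ℂ 2 (volume : Measure (E d)) :=
  if H : MemSobolev s 2 u then H.choose else 0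

open Classical in
/-- The norm `‖u‖_{Hˢ} = ‖(1 + |ξ|²) ^ (s / 2) û‖_{L²}`, with the value `∞` if `u ∉ Hˢ`. -/
def sobolevNorm {d : ℕ} (s : ℝ) (u : 𝓢'(E d, ℂ)) : ℝ≥0∞ :=
  if MemSobolev s 2 u then ‖besselRep s u‖ₑ else ∞

/-- The duality pairing `⟨u, v⟩` of `u ∈ H⁻ˢ` and `v ∈ Hˢ`, which extends the complex `L²` inner product
`∫ u v̄`. It equals `⟨(1 - Δ/4π²) ^ (-s / 2) u, (1 - Δ/4π²) ^ (s / 2) v⟩_{L²}`. (The inner product of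
Mathlib is conjugate linear in its first argument.) -/
def dualityPairing {d : ℕ} (s : ℝ) (u v : 𝓢'(E d, ℂ)) : ℂ :=
  inner ℂ (besselRep s v) (besselRep (-s) u)

/-! ### The kernel -/

/-- `k ∈ L¹ + L²`, `D⁻¹ (1 + |ξ|²)⁻¹ ≤ k̂(ξ) ≤ D (1 + |ξ|²)⁻¹` for a.e. `ξ`, and `k̂ ∈ W^{1,∞}`. The Fourier
transform `k̂` is that of tempered distributions; `T` is `k` as a distribution and `m` is the function `k̂`. -/
structure IsAdmissibleKernel {d : ℕ} (k : E d → ℝ) (D : ℝ) : Prop where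
  mem_L1_add_L2 : ∃ k₁ k₂ : E d → ℝ, MemLp k₁ 1 volume ∧ MemLp k₂ 2 volume ∧ k = k₁ + k₂
  fourier : ∃ (T : 𝓢'(E d, ℂ)) (m : E d → ℝ),
    IsGivenBy T (fun x => (k x : ℂ)) ∧
    IsGivenBy (𝓕 T) (fun ξ => (m ξ : ℂ)) ∧
    (∀ᵐ ξ : E d, 1 / D * (1 / (1 + ‖ξ‖ ^ 2)) ≤ m ξ ∧ m ξ ≤ D * (1 / (1 + ‖ξ‖ ^ 2))) ∧
    MemLp m ∞ volume ∧
    ∀ i : Fin d, ∃ g : E d → ℂ, MemLp g ∞ volume ∧ IsGivenBy (∂_{basisVec i} (𝓕 T)) g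

/-- `v = k ∗ u`, where `u ↦ k ∗ u` is the continuous extension to a map `H⁻¹ → H¹` of the convolution
`f ↦ ∫ k(· - y) f(y) dy` with Schwartz functions: there are Schwartz functions `f n → u` in `H⁻¹`
with `k ∗ f n → v` in `H¹`. -/
def IsKernelConv {d : ℕ} (k : E d → ℝ) (u v : 𝓢'(E d, ℂ)) : Prop :=
  ∃ (f : ℕ → 𝓢(E d, ℂ)) (w : ℕ → 𝓢'(E d, ℂ)),
    (∀ n, IsGivenBy (w n) (fun x => ∫ y, (k (x - y) : ℂ) * f n y)) ∧
    Filter.Tendsto (fun n => sobolevNorm (-1) ((f n : 𝓢'(E d, ℂ)) - u)) Filter.atTop (𝓝 0) ∧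
    Filter.Tendsto (fun n => sobolevNorm 1 (w n - v)) Filter.atTop (𝓝 0)

open Classical in
/-- The convolution `k ∗ u` for `u ∈ H⁻¹`. -/
def kernelConv {d : ℕ} (k : E d → ℝ) (u : 𝓢'(E d, ℂ)) : 𝓢'(E d, ℂ) :=
  if H : ∃ v, IsKernelConv k u v then H.choose else 0

/-! ### The potentials and the target -/

/-- The quadratic potential `V₀(x) = ½ (x - μ) · Σ⁻¹ (x - μ)`; here `S` is the matrix `Σ`. -/
def V₀ {d : ℕ} (S : Matrix (Fin d) (Fin d) ℝ) (μ : E d) (x : E d) : ℝ :=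
  1 / 2 * ((x - μ).ofLp ⬝ᵥ (S⁻¹ *ᵥ (x - μ).ofLp))

/-- `V ∈ L^∞_loc(ℝᵈ)`. -/
def LocallyBounded {d : ℕ} (V : E d → ℝ) : Prop :=
  ∀ K : Set (E d), IsCompact K → MemLp V ∞ (volume.restrict K)

/-- The target probability measure `ρ_∞ = Z⁻¹ e^{-V} dx`, `Z = ∫ e^{-V}`. -/
def target {d : ℕ} (V : E d → ℝ) : Measure (E d) :=
  volume.withDensity (fun x => ENNReal.ofReal (Real.exp (-V x) / ∫ y, Real.exp (-V y)))

/-- The function `ρ e^{V - V₀/2}`. -/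
def weighted {d : ℕ} (V : E d → ℝ) (S : Matrix (Fin d) (Fin d) ℝ) (μ : E d) (ρ : E d → ℝ)
    (x : E d) : ℝ :=
  ρ x * Real.exp (V x - V₀ S μ x / 2)

/-- The function `e^{-V₀/2}`. -/
def halfGaussian {d : ℕ} (S : Matrix (Fin d) (Fin d) ℝ) (μ : E d) (x : E d) : ℝ :=
  Real.exp (-V₀ S μ x / 2)

/-- The `i`-th component of the vector field `ρ e^{V - V₀/2} ∇V₀`. -/
def weightedDrift {d : ℕ} (V : E d → ℝ) (S : Matrix (Fin d) (Fin d) ℝ) (μ : E d) (ρ : E d → ℝ)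
    (i : Fin d) (x : E d) : ℂ :=
  ((weighted V S μ ρ x * gradient (V₀ S μ) x i : ℝ) : ℂ)

/-- The regularity conditions on `ρ`: `ρ ∈ L¹`, `ρ e^{V - V₀/2} ∈ L²` and
`ρ e^{V - V₀/2} ∇V₀ ∈ H⁻¹`. -/
structure IsRegular {d : ℕ} (V : E d → ℝ) (S : Matrix (Fin d) (Fin d) ℝ) (μ : E d)
    (ρ : E d → ℝ) : Prop where
  integrable : Integrable ρ volume
  memLp_weighted : MemLp (weighted V S μ ρ) 2 volume
  drift_mem : ∀ i : Fin d, ∃ T : 𝓢'(E d, ℂ),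
    IsGivenBy T (weightedDrift V S μ ρ i) ∧ MemSobolev (-1) 2 T

/-! ### The dissipation -/

/-- `u` is the `i`-th component of the distribution `∇(ρ e^V) e^{-V₀/2}`, the product of the
distributional gradient of `ρ e^V` and the smooth function `e^{-V₀/2}`. -/
def IsWeightedGradient {d : ℕ} (V : E d → ℝ) (S : Matrix (Fin d) (Fin d) ℝ) (μ : E d)
    (ρ : E d → ℝ) (i : Fin d) (u : 𝓢'(E d, ℂ)) : Prop :=
  ∀ φ : 𝓢(E d, ℂ),
    u φ = -∫ x, ((ρ x * Real.exp (V x) : ℝ) : ℂ) *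
      lineDeriv ℝ (fun y => (halfGaussian S μ y : ℂ) * φ y) x (basisVec i)

open Classical in
/-- The `i`-th component of the distribution `∇(ρ e^V) e^{-V₀/2}`. -/
def weightedGradient {d : ℕ} (V : E d → ℝ) (S : Matrix (Fin d) (Fin d) ℝ) (μ : E d)
    (ρ : E d → ℝ) (i : Fin d) : 𝓢'(E d, ℂ) :=
  if H : ∃ u, IsWeightedGradient V S μ ρ i u then H.choose else 0

/-- The dissipation `𝔻_k²(ρ ‖ ρ_∞) = ⟨∇(ρ e^V) e^{-V₀/2}, k ∗ (∇(ρ e^V) e^{-V₀/2})⟩_{H⁻¹, H¹}`, a real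
number. -/
def dissipation {d : ℕ} (k : E d → ℝ) (V : E d → ℝ) (S : Matrix (Fin d) (Fin d) ℝ) (μ : E d)
    (ρ : E d → ℝ) : ℝ :=
  (∑ i : Fin d, dualityPairing 1 (weightedGradient V S μ ρ i)
    (kernelConv k (weightedGradient V S μ ρ i))).re

/-! ### The constant `τ` -/

open Classical in
/-- The Fourier transform `L² → L²` (and `0` off `L²`). -/
def fourierL2 {d : ℕ} (f : E d → ℝ) : E d → ℂ :=
  if H : MemLp (fun x => (f x : ℂ)) 2 (volume : Measure (E d)) then
    ((𝓕 (H.toLp) : Lp ℂ 2 (volume : Measure (E d))) : E d → ℂ) else 0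

/-- `∫_Ω e^{2πi a·ξ} f̂(ξ) dξ`, the integral over `Ω` of the Fourier transform of `f(· + a)`. -/
def freqIntegral {d : ℕ} (Ω : Set (E d)) (a : E d) (f : E d → ℝ) : ℂ :=
  ∫ ξ in Ω, Complex.exp (((2 * Real.pi * inner ℝ a ξ : ℝ) : ℂ) * Complex.I) * fourierL2 f ξ

/-- The quotient of `∫_Ω e^{2πi a·ξ} 𝓕(ρ e^{V - V₀/2}) dξ` and `∫_Ω e^{2πi a·ξ} 𝓕(e^{-V₀/2}) dξ`. Both
integrals are real if `Ω = -Ω`. -/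
def tau {d : ℕ} (Ω : Set (E d)) (a : E d) (V : E d → ℝ) (S : Matrix (Fin d) (Fin d) ℝ) (μ : E d)
    (ρ : E d → ℝ) : ℝ :=
  (freqIntegral Ω a (weighted V S μ ρ) / freqIntegral Ω a (halfGaussian S μ)).re

/-- The ellipsoid `{ξ | ξ · Σ ξ < ε²}`, the image of the ball `B_ε` under `Σ^{-1/2}`. -/
def ellipsoid {d : ℕ} (S : Matrix (Fin d) (Fin d) ℝ) (ε : ℝ) : Set (E d) :=
  {ξ | ξ.ofLp ⬝ᵥ (S *ᵥ ξ.ofLp) < ε ^ 2}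

/-- The `L²` lower bound `lam ∫ |ρ e^{V - V₀/2} - t e^{-V₀/2}|² ≤ 𝔻_k²(ρ ‖ ρ_∞)`. -/
def L2LowerBound {d : ℕ} (lam : ℝ) (k : E d → ℝ) (V : E d → ℝ) (S : Matrix (Fin d) (Fin d) ℝ)
    (μ : E d) (ρ : E d → ℝ) (t : ℝ) : Prop :=
  lam * (∫ x, |weighted V S μ ρ x - t * halfGaussian S μ x| ^ 2) ≤ dissipation k V S μ ρ

end SteinLogSobolev

end

noncomputable section

namespace SteinLogSobolev

variable {d : ℕ}

/-! ### The Poincaré inequality on a ball -/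

/-! Put w = ρ e^{V - V₀/2}. The potential V then drops out of the gradient: u = ∇(ρ e^V) e^{-V₀/2}
equals ∇w + ½ w ∇V₀, and this operator annihilates the ground state e^{-V₀/2}. Two facts carry the
theorem. The dissipation dominates ‖u‖² / D in H⁻¹, because k̂ is comparable to (1 + |ξ|²)⁻¹
(`sum_norm_sq_le_dissipation`). And the operator has a spectral gap from L² to H⁻¹: the squared L²
distance of w to the span of e^{-V₀/2} is at most C ‖u‖² (`exists_norm_sub_le`).

The gap is proved in Fourier space, where H⁻¹ is a weighted L² space and multiplication by ∇V₀
becomes a derivative. Modulating by e^{2πi μ·ξ} removes μ, and multiplying by Σ turns the equation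
for h = e^{2πi μ·ξ} ŵ into ∇h + Aξ h = √(1 + |ξ|²) β with A = 8π²Σ and ‖β‖ in L² bounded by ‖u‖ in
H⁻¹. What remains is a weighted Poincaré inequality: some multiple tG of G = e^{-ξ·Aξ/2} satisfies
‖h - tG‖² ≤ C ‖β‖² (`weak_inequality`). At infinity the drift Aξ beats the growing weight:
integrating the divergence of h² ξ / (1 + |ξ|²) bounds ‖h‖ by ‖β‖ and the norm of h on a ball
(`tail_estimate`). On the ball, h/G has gradient G⁻¹ √(1 + |ξ|²) β, and the classical Poincaré
inequality applies. Since h - tG solves the same equation as h, the tail estimate then extends the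
local bound to the whole space (`smooth_inequality`). Mollification removes the smoothness of h.

The optimal multiple is replaced by τ at the cost of a constant factor: τ matches the averages over
Ω, and these are a bounded functional on L² that does not vanish on the ground state
(`integral_sub_re_mul_sq_le`). On the ellipsoid the modulation cancels μ, so the factor is uniform
in μ. The relative entropy is at most the χ² divergence, which V ≥ c + V₀ bounds by the weighted L²
distance to any multiple of the ground state (`klDiv_le`). Lastly, the multiple itself is controlled
by the mass of ρ on a ball, where V is bounded; this gives the bound in L² and H⁻¹
(`exists_regularity_bound`). -/

lemma sq_intervalIntegral_le {g : ℝ → ℝ} (hg : Continuous g) {a b : ℝ} (hab : a ≤ b) :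
    (∫ s in a..b, g s) ^ 2 ≤ (b - a) * ∫ s in a..b, g s ^ 2 := by
  rcases hab.eq_or_lt with rfl | hlt
  · simp
  have hpos : 0 < b - a := sub_pos.2 hlt
  set c := ∫ s in a..b, g s with hc
  -- Cauchy-Schwarz as nonnegativity of the variance of `g`.
  have h0 : 0 ≤ ∫ s in a..b, (g s - c / (b - a)) ^ 2 :=
    intervalIntegral.integral_nonneg hab fun _ _ => sq_nonneg _
  have h1 : ∫ s in a..b, (g s - c / (b - a)) ^ 2 =
      (∫ s in a..b, g s ^ 2) - c ^ 2 / (b - a) := by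
    have : ∀ s, (g s - c / (b - a)) ^ 2 =
        g s ^ 2 - (2 * (c / (b - a))) * g s + (c / (b - a)) ^ 2 := fun s => by ring
    simp_rw [this]
    rw [intervalIntegral.integral_add, intervalIntegral.integral_sub,
      intervalIntegral.integral_const_mul, intervalIntegral.integral_const, ← hc]
    · simp only [smul_eq_mul]; field_simp; ring
    all_goals exact Continuous.intervalIntegrable (by fun_prop) _ _
  rw [h1, sub_nonneg, div_le_iff₀ hpos] at h0
  linarith

/-- Only half of the segment is used: for s ≤ 1/2 the map x ↦ (1 - s) x + s y has Jacobian at least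
2⁻ᵈ, whereas it degenerates as s tends to 1. The constant is the length 1/2 times (2R)². -/
lemma sq_sub_midpoint_le {q : E d → ℝ} (hq : ContDiff ℝ 1 q) {R : ℝ} {x y : E d}
    (hxy : ‖y - x‖ ≤ 2 * R) :
    ENNReal.ofReal ((q x - q (x + (1 / 2 : ℝ) • (y - x))) ^ 2) ≤ ENNReal.ofReal (2 * R ^ 2) *
      ∫⁻ s in Set.Ioc (0 : ℝ) (1 / 2),
        ENNReal.ofReal (‖fderiv ℝ q ((1 - s) • x + s • y)‖ ^ 2) := by
  have hR : 0 ≤ R := by linarith [norm_nonneg (y - x)]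
  have hD : Continuous (fderiv ℝ q) := hq.continuous_fderiv (by norm_num)
  have hline : ∀ s : ℝ, (1 - s) • x + s • y = x + s • (y - x) := fun s => by
    rw [sub_smul, smul_sub, one_smul]; abel
  have hderiv : ∀ s : ℝ, HasDerivAt (fun s : ℝ => q (x + s • (y - x)))
      (fderiv ℝ q (x + s • (y - x)) (y - x)) s := fun s => by
    have h1 : HasDerivAt (fun s : ℝ => x + s • (y - x)) (y - x) s := by
      simpa using ((hasDerivAt_id s).smul_const (y - x)).const_add x
    exact ((hq.differentiable (by norm_num) _).hasFDerivAt).comp_hasDerivAt s h1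
  have hcont : Continuous fun s : ℝ => fderiv ℝ q (x + s • (y - x)) (y - x) := by fun_prop
  have hint := intervalIntegral.integral_eq_sub_of_hasDerivAt (a := 0) (b := 1 / 2)
    (fun s _ => hderiv s) (hcont.intervalIntegrable _ _)
  have hsq := sq_intervalIntegral_le hcont (a := 0) (b := 1 / 2) (by norm_num)
  rw [hint] at hsq
  have hmono : ∫ s in (0 : ℝ)..(1 / 2), (fderiv ℝ q (x + s • (y - x)) (y - x)) ^ 2 ≤
      ∫ s in (0 : ℝ)..(1 / 2), (4 * R ^ 2) * ‖fderiv ℝ q (x + s • (y - x))‖ ^ 2 := by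
    apply intervalIntegral.integral_mono_on (by norm_num)
    · exact Continuous.intervalIntegrable (by fun_prop) _ _
    · exact Continuous.intervalIntegrable (by fun_prop) _ _
    · intro s _
      have h := (fderiv ℝ q (x + s • (y - x))).le_opNorm (y - x)
      rw [← sq_abs, ← Real.norm_eq_abs]
      calc ‖fderiv ℝ q (x + s • (y - x)) (y - x)‖ ^ 2
          ≤ (‖fderiv ℝ q (x + s • (y - x))‖ * (2 * R)) ^ 2 := by
            gcongr; exact h.trans (by gcongr)
        _ = _ := by ring
  rw [intervalIntegral.integral_const_mul] at hmono
  have hfin : (q x - q (x + (1 / 2 : ℝ) • (y - x))) ^ 2 ≤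
      2 * R ^ 2 * ∫ s in (0 : ℝ)..(1 / 2), ‖fderiv ℝ q (x + s • (y - x))‖ ^ 2 := by
    have : (q x - q (x + (1 / 2 : ℝ) • (y - x))) ^ 2 =
      (q (x + (1 / 2 : ℝ) • (y - x)) - q (x + (0 : ℝ) • (y - x))) ^ 2 := by
      rw [zero_smul, add_zero]; ring
    rw [this]; linarith
  refine (ENNReal.ofReal_le_ofReal hfin).trans ?_
  rw [ENNReal.ofReal_mul (by positivity)]
  gcongr
  rw [intervalIntegral.integral_of_le (by norm_num), ofReal_integral_eq_lintegral_ofReal]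
  · simp_rw [hline]; exact le_rfl
  · exact (Continuous.integrableOn_Icc (by fun_prop)).mono_set Set.Ioc_subset_Icc_self
  · exact ae_of_all _ fun _ => sq_nonneg _

lemma lintegral_comp_smul_add (Φ : E d → ℝ≥0∞) (hΦ : Measurable Φ) {r : ℝ} (hr : 0 < r) (v : E d) :
    ∫⁻ x, Φ (r • x + v) = ENNReal.ofReal ((r ^ d)⁻¹) * ∫⁻ x, Φ x := by
  have h1 : ∫⁻ x, Φ (r • x + v) = ∫⁻ z, Φ (z + v) ∂(Measure.map (r • ·) volume) := by
    rw [lintegral_map (by fun_prop) (by fun_prop)]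
  rw [h1, Measure.map_addHaar_smul _ hr.ne', lintegral_smul_measure,
    lintegral_add_right_eq_self (μ := volume) Φ v, abs_of_pos (by positivity)]
  simp

/-- The ball is convex, so the contraction towards `y` maps it into itself; the factor is the
inverse Jacobian (1 - s)⁻ᵈ ≤ 2ᵈ. -/
lemma setLIntegral_segment_le (Φ : E d → ℝ≥0∞) (hΦ : Measurable Φ) {R : ℝ} {y : E d}
    (hy : y ∈ Metric.closedBall (0 : E d) R) {s : ℝ} (hs : s ∈ Set.Ioc (0 : ℝ) (1 / 2)) :
    ∫⁻ x in Metric.closedBall (0 : E d) R, Φ ((1 - s) • x + s • y) ≤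
      ENNReal.ofReal (2 ^ d) * ∫⁻ x in Metric.closedBall (0 : E d) R, Φ x := by
  have hB : MeasurableSet (Metric.closedBall (0 : E d) R) := Metric.isClosed_closedBall.measurableSet
  rw [← lintegral_indicator hB, ← lintegral_indicator hB]
  calc ∫⁻ x, (Metric.closedBall (0 : E d) R).indicator (fun x => Φ ((1 - s) • x + s • y)) x
      ≤ ∫⁻ x, (Metric.closedBall (0 : E d) R).indicator Φ ((1 - s) • x + s • y) := by
        apply lintegral_mono
        intro x
        by_cases hx : x ∈ Metric.closedBall (0 : E d) R
        · have : (1 - s) • x + s • y ∈ Metric.closedBall (0 : E d) R :=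
            convex_closedBall (0 : E d) R hx hy (by linarith [hs.2]) hs.1.le (by ring)
          simp only [Set.indicator_of_mem hx, Set.indicator_of_mem this, le_refl]
        · simp only [Set.indicator_of_notMem hx, zero_le]
    _ = ENNReal.ofReal (((1 - s) ^ d)⁻¹) *
          ∫⁻ x, (Metric.closedBall (0 : E d) R).indicator Φ x :=
        lintegral_comp_smul_add _ (hΦ.indicator hB) (by linarith [hs.2]) _
    _ ≤ _ := by
        gcongr
        rw [← inv_pow]
        gcongr
        · exact inv_nonneg.2 (by linarith [hs.2])
        · rw [inv_le_comm₀ (by linarith [hs.2]) (by norm_num)]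
          linarith [hs.2]

/-- The double integral form of the Poincaré inequality on a ball. -/
lemma lintegral_sq_sub_le (R : ℝ) {q : E d → ℝ} (hq : ContDiff ℝ 1 q) :
    ∫⁻ y in Metric.closedBall (0 : E d) R, ∫⁻ x in Metric.closedBall (0 : E d) R,
      ENNReal.ofReal ((q x - q y) ^ 2) ≤
    volume (Metric.closedBall (0 : E d) R) * (ENNReal.ofReal (4 * R ^ 2 * 2 ^ d) *
      ∫⁻ x in Metric.closedBall (0 : E d) R, ENNReal.ofReal (‖fderiv ℝ q x‖ ^ 2)) := by
  set B := Metric.closedBall (0 : E d) R with hBdef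
  have hB : MeasurableSet B := Metric.isClosed_closedBall.measurableSet
  have hqc : Continuous q := hq.continuous
  have hD : Continuous (fderiv ℝ q) := hq.continuous_fderiv (by norm_num)
  set Φ : E d → ℝ≥0∞ := fun x => ENNReal.ofReal (‖fderiv ℝ q x‖ ^ 2) with hΦ
  have hΦm : Measurable Φ := by
    exact (ENNReal.continuous_ofReal.comp (by fun_prop : Continuous fun x => ‖fderiv ℝ q x‖ ^ 2)).measurable
  set δ : E d → E d → ℝ≥0∞ :=
    fun y x => ENNReal.ofReal ((q x - q (x + (1 / 2 : ℝ) • (y - x))) ^ 2) with hδ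
  have hδc : Continuous (Function.uncurry δ) := by
    simp only [hδ, Function.uncurry_def]
    exact ENNReal.continuous_ofReal.comp (by fun_prop)
  -- Both points are joined to their common midpoint, so the two halves are the same function with
  -- `x` and `y` exchanged.
  have hsplit : ∀ x y, ENNReal.ofReal ((q x - q y) ^ 2) ≤ 2 * (δ y x + δ x y) := by
    intro x y
    have hm : y + (1 / 2 : ℝ) • (x - y) = x + (1 / 2 : ℝ) • (y - x) := by
      module
    simp only [hδ, hm]
    rw [← ENNReal.ofReal_add (sq_nonneg _) (sq_nonneg _), two_mul,
      ← ENNReal.ofReal_add (by positivity) (by positivity)]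
    apply ENNReal.ofReal_le_ofReal
    nlinarith [sq_nonneg (q x - q (x + (1 / 2 : ℝ) • (y - x)) +
      (q y - q (x + (1 / 2 : ℝ) • (y - x))))]
  have hhalf : ∀ y ∈ B, ∫⁻ x in B, δ y x ≤
      ENNReal.ofReal (R ^ 2 * 2 ^ d) * ∫⁻ x in B, Φ x := by
    intro y hy
    calc ∫⁻ x in B, δ y x
        ≤ ∫⁻ x in B, ENNReal.ofReal (2 * R ^ 2) *
            ∫⁻ s in Set.Ioc (0 : ℝ) (1 / 2), Φ ((1 - s) • x + s • y) := by
          apply setLIntegral_mono' hB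
          intro x hx
          apply sq_sub_midpoint_le hq
          have h1 : ‖x‖ ≤ R := by simpa [B] using hx
          have h2 : ‖y‖ ≤ R := by simpa [B] using hy
          linarith [norm_sub_le y x]
      _ = ENNReal.ofReal (2 * R ^ 2) * ∫⁻ s in Set.Ioc (0 : ℝ) (1 / 2),
            ∫⁻ x in B, Φ ((1 - s) • x + s • y) := by
          rw [lintegral_const_mul' _ _ ENNReal.ofReal_ne_top, lintegral_lintegral_swap]
          apply Measurable.aemeasurable
          apply hΦm.comp
          have : Continuous fun a : E d × ℝ => (1 - a.2) • a.1 + a.2 • y := by fun_prop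
          exact this.measurable
      _ ≤ ENNReal.ofReal (2 * R ^ 2) * ∫⁻ s in Set.Ioc (0 : ℝ) (1 / 2),
            ENNReal.ofReal (2 ^ d) * ∫⁻ x in B, Φ x := by
          gcongr 1
          exact setLIntegral_mono' measurableSet_Ioc fun s hs => setLIntegral_segment_le Φ hΦm hy hs
      _ = _ := by
          rw [setLIntegral_const, Real.volume_Ioc, mul_right_comm (ENNReal.ofReal (2 ^ d)),
            ← ENNReal.ofReal_mul (by positivity), ← mul_assoc, ← ENNReal.ofReal_mul (by positivity)]
          congr 2; ring
  have hone : ∫⁻ y in B, ∫⁻ x in B, δ y x ≤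
      volume B * (ENNReal.ofReal (R ^ 2 * 2 ^ d) * ∫⁻ x in B, Φ x) := by
    refine (setLIntegral_mono' hB hhalf).trans ?_
    rw [setLIntegral_const, mul_comm]
  have hswap : ∫⁻ y in B, ∫⁻ x in B, δ x y = ∫⁻ y in B, ∫⁻ x in B, δ y x := by
    rw [lintegral_lintegral_swap]
    exact (hδc.comp continuous_swap).measurable.aemeasurable
  calc ∫⁻ y in B, ∫⁻ x in B, ENNReal.ofReal ((q x - q y) ^ 2)
      ≤ ∫⁻ y in B, ∫⁻ x in B, 2 * (δ y x + δ x y) :=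
        lintegral_mono fun y => lintegral_mono fun x => hsplit x y
    _ = 2 * ((∫⁻ y in B, ∫⁻ x in B, δ y x) + ∫⁻ y in B, ∫⁻ x in B, δ x y) := by
        have h1 : ∀ y, Measurable fun x => δ y x := fun y =>
          (hδc.comp (by fun_prop : Continuous fun x => (y, x))).measurable
        have h2 : Measurable fun y => ∫⁻ x in B, δ y x := hδc.measurable.lintegral_prod_right'
        rw [← lintegral_add_left h2, ← lintegral_const_mul' _ _ ENNReal.ofNat_ne_top]
        congr 1 with y
        rw [← lintegral_add_left (h1 y), ← lintegral_const_mul' _ _ ENNReal.ofNat_ne_top]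
    _ ≤ 2 * (volume B * (ENNReal.ofReal (R ^ 2 * 2 ^ d) * ∫⁻ x in B, Φ x) +
          volume B * (ENNReal.ofReal (R ^ 2 * 2 ^ d) * ∫⁻ x in B, Φ x)) := by
        rw [hswap]; gcongr
    _ = _ := by
        rw [show (4 * R ^ 2 * 2 ^ d : ℝ) = 4 * (R ^ 2 * 2 ^ d) by ring,
          ENNReal.ofReal_mul (p := 4) (by norm_num), show ENNReal.ofReal 4 = 4 by simp]
        ring

/-- The Poincaré inequality on a ball, with the value at a suitable point in place of the mean. -/
theorem exists_lintegral_sq_sub_le {R : ℝ} (hR : 0 < R) {q : E d → ℝ} (hq : ContDiff ℝ 1 q) :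
    ∃ y, ∫⁻ x in Metric.closedBall (0 : E d) R, ENNReal.ofReal ((q x - q y) ^ 2) ≤
      ENNReal.ofReal (4 * R ^ 2 * 2 ^ d) *
        ∫⁻ x in Metric.closedBall (0 : E d) R, ENNReal.ofReal (‖fderiv ℝ q x‖ ^ 2) := by
  have h0 : volume (Metric.closedBall (0 : E d) R) ≠ 0 :=
    (Metric.measure_closedBall_pos volume _ hR).ne'
  have h1 : volume (Metric.closedBall (0 : E d) R) ≠ ∞ := measure_closedBall_lt_top.ne
  have hqc : Continuous q := hq.continuous
  have hm : Measurable fun y => ∫⁻ x in Metric.closedBall (0 : E d) R,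
      ENNReal.ofReal ((q x - q y) ^ 2) := by
    have : Continuous (Function.uncurry fun y x => ENNReal.ofReal ((q x - q y) ^ 2)) := by
      simp only [Function.uncurry_def]
      exact ENNReal.continuous_ofReal.comp (by fun_prop)
    exact this.measurable.lintegral_prod_right'
  -- Some `y` does no worse than the average over `y`; the value there replaces the mean of `q`.
  obtain ⟨y, -, hy⟩ := exists_le_setLAverage h0 h1 hm.aemeasurable
  refine ⟨y, hy.trans ?_⟩
  rw [setLAverage_eq]
  refine ENNReal.div_le_of_le_mul' (lintegral_sq_sub_le R hq)

/-! ### Quadratic forms and Gaussians -/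

/-- The linear map of a matrix on Euclidean space. -/
def matCLM (A : Matrix (Fin d) (Fin d) ℝ) : E d →L[ℝ] E d :=
  (Matrix.toEuclideanLin A).toContinuousLinearMap

lemma matCLM_apply (A : Matrix (Fin d) (Fin d) ℝ) (ξ : E d) (j : Fin d) :
    matCLM A ξ j = (A *ᵥ ξ.ofLp) j := rfl

/-- The quadratic form of a matrix. -/
def quadForm (A : Matrix (Fin d) (Fin d) ℝ) (ξ : E d) : ℝ := ξ.ofLp ⬝ᵥ (A *ᵥ ξ.ofLp)

lemma inner_eq_dotProduct (x y : E d) : inner ℝ x y = x.ofLp ⬝ᵥ y.ofLp := by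
  rw [EuclideanSpace.inner_eq_star_dotProduct, dotProduct_comm]; rfl

lemma inner_basisVec (x : E d) (j : Fin d) : inner ℝ x (basisVec j) = x j := by
  simp [basisVec, EuclideanSpace.inner_single_right]

lemma inner_basisVec_left (x : E d) (j : Fin d) : inner ℝ (basisVec j) x = x j := by
  rw [real_inner_comm, inner_basisVec]

lemma quadForm_eq_inner (A : Matrix (Fin d) (Fin d) ℝ) (ξ : E d) :
    quadForm A ξ = inner ℝ ξ (matCLM A ξ) := by
  rw [inner_eq_dotProduct]; rfl

lemma contDiff_quadForm (A : Matrix (Fin d) (Fin d) ℝ) {n : WithTop ℕ∞} :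
    ContDiff ℝ n (quadForm A) := by
  have : quadForm A = fun ξ => inner ℝ ξ (matCLM A ξ) := funext (quadForm_eq_inner A)
  rw [this]
  exact contDiff_id.inner ℝ (matCLM A).contDiff

lemma inner_matCLM_comm {A : Matrix (Fin d) (Fin d) ℝ} (hA : A.IsHermitian) (x y : E d) :
    inner ℝ x (matCLM A y) = inner ℝ (matCLM A x) y := by
  rw [inner_eq_dotProduct, inner_eq_dotProduct]
  change x.ofLp ⬝ᵥ (A *ᵥ y.ofLp) = (A *ᵥ x.ofLp) ⬝ᵥ y.ofLp
  rw [Matrix.dotProduct_mulVec, ← Matrix.mulVec_transpose]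
  have : Aᵀ = A := by simpa [Matrix.IsHermitian, Matrix.conjTranspose_eq_transpose_of_trivial] using hA
  rw [this]

lemma hasFDerivAt_quadForm {A : Matrix (Fin d) (Fin d) ℝ} (hA : A.IsHermitian) (ξ : E d) :
    HasFDerivAt (quadForm A) ((2 : ℝ) • innerSL ℝ (matCLM A ξ)) ξ := by
  have : quadForm A = fun ξ => inner ℝ ξ (matCLM A ξ) := funext (quadForm_eq_inner A)
  rw [this]
  refine ((hasFDerivAt_id ξ).inner ℝ (matCLM A).hasFDerivAt).congr_fderiv ?_
  ext v
  simp only [ContinuousLinearMap.comp_apply, ContinuousLinearMap.prod_apply, fderivInnerCLM_apply,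
    _root_.smul_apply, innerSL_apply_apply, smul_eq_mul, id, ContinuousLinearMap.id_apply]
  rw [inner_matCLM_comm hA, real_inner_comm v]
  ring

lemma exists_quadForm_ge {A : Matrix (Fin d) (Fin d) ℝ} (hA : A.PosDef) :
    ∃ a : ℝ, 0 < a ∧ ∀ ξ : E d, a * ‖ξ‖ ^ 2 ≤ quadForm A ξ := by
  have hpos : ∀ ξ : E d, ξ ≠ 0 → 0 < quadForm A ξ := fun ξ hξ => by
    have := hA.dotProduct_mulVec_pos (x := ξ.ofLp) (by simpa using hξ)
    simpa [quadForm] using this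
  -- The sphere is empty in dimension zero, where any constant works; otherwise the minimum on the
  -- sphere extends by homogeneity.
  rcases (Metric.sphere (0 : E d) 1).eq_empty_or_nonempty with he | hne
  · refine ⟨1, one_pos, fun ξ => ?_⟩
    have : ξ = 0 := by
      by_contra h
      have : (‖ξ‖⁻¹ • ξ) ∈ Metric.sphere (0 : E d) 1 := by simp [norm_smul, h]
      simp [he] at this
    simp [this, quadForm]
  · obtain ⟨z, hz, hmin⟩ := (isCompact_sphere (0 : E d) 1).exists_isMinOn hne
      (contDiff_quadForm (n := 0) A).continuous.continuousOn
    have hz0 : z ≠ 0 := by rintro rfl; simp at hz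
    refine ⟨quadForm A z, hpos z hz0, fun ξ => ?_⟩
    rcases eq_or_ne ξ 0 with rfl | h
    · simp [quadForm]
    · have h1 : quadForm A z ≤ quadForm A (‖ξ‖⁻¹ • ξ) := hmin (by simp [norm_smul, h])
      have h2 : quadForm A (‖ξ‖⁻¹ • ξ) = (‖ξ‖ ^ 2)⁻¹ * quadForm A ξ := by
        rw [quadForm_eq_inner, quadForm_eq_inner, map_smul, inner_smul_left, inner_smul_right]
        simp; ring
      rw [h2, inv_mul_eq_div, le_div_iff₀ (by positivity)] at h1
      exact h1

/-- The Gaussian `exp (-ξ · A ξ / 2)`. -/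
def gaussian (A : Matrix (Fin d) (Fin d) ℝ) (ξ : E d) : ℝ := Real.exp (-(quadForm A ξ) / 2)

lemma gaussian_pos (A : Matrix (Fin d) (Fin d) ℝ) (ξ : E d) : 0 < gaussian A ξ := Real.exp_pos _

lemma contDiff_gaussian (A : Matrix (Fin d) (Fin d) ℝ) {n : WithTop ℕ∞} :
    ContDiff ℝ n (gaussian A) := by
  have := contDiff_quadForm A (n := n)
  unfold gaussian
  fun_prop

lemma hasFDerivAt_gaussian {A : Matrix (Fin d) (Fin d) ℝ} (hA : A.IsHermitian) (ξ : E d) :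
    HasFDerivAt (gaussian A) (-(gaussian A ξ • innerSL ℝ (matCLM A ξ))) ξ := by
  have h := (((hasFDerivAt_quadForm hA ξ).neg).mul_const (1 / 2 : ℝ)).exp
  have e : gaussian A = fun x => Real.exp (-(quadForm A x) * (1 / 2)) := by
    funext x; unfold gaussian; congr 1; ring
  rw [e]
  refine h.congr_fderiv ?_
  ext v
  simp

lemma gaussian_le_one {A : Matrix (Fin d) (Fin d) ℝ} (hA : A.PosDef) (ξ : E d) :
    gaussian A ξ ≤ 1 := by
  obtain ⟨a, ha, h⟩ := exists_quadForm_ge hA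
  have := h ξ
  refine Real.exp_le_one_iff.2 ?_
  nlinarith [sq_nonneg ‖ξ‖, mul_nonneg ha.le (sq_nonneg ‖ξ‖)]

lemma integrable_exp_neg_mul_norm_sq {b : ℝ} (hb : 0 < b) :
    Integrable fun ξ : E d => Real.exp (-b * ‖ξ‖ ^ 2) := by
  have h := (GaussianFourier.integrable_cexp_neg_mul_sq_norm_add (V := E d) (b := (b : ℂ))
    (by simpa using hb) 0 0).re
  refine h.congr (ae_of_all _ fun ξ => ?_)
  have : Complex.exp (-(b : ℂ) * (‖ξ‖ : ℂ) ^ 2 + 0 * (inner ℝ (0 : E d) ξ : ℂ)) =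
      ((Real.exp (-b * ‖ξ‖ ^ 2) : ℝ) : ℂ) := by
    push_cast; simp
  simp only [this]
  exact Complex.ofReal_re _

lemma integrable_exp_neg_quadForm {A : Matrix (Fin d) (Fin d) ℝ} (hA : A.PosDef) {c : ℝ}
    (hc : 0 < c) : Integrable fun ξ : E d => Real.exp (-c * quadForm A ξ) := by
  obtain ⟨a, ha, h⟩ := exists_quadForm_ge hA
  refine (integrable_exp_neg_mul_norm_sq (d := d) (mul_pos hc ha)).mono' ?_
    (ae_of_all _ fun ξ => ?_)
  · have := (contDiff_quadForm (n := 0) A).continuous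
    exact Continuous.aestronglyMeasurable (by fun_prop)
  · rw [Real.norm_eq_abs, Real.abs_exp]
    apply Real.exp_le_exp.2
    nlinarith [h ξ]

lemma memLp_gaussian {A : Matrix (Fin d) (Fin d) ℝ} (hA : A.PosDef) : MemLp (gaussian A) 2 := by
  rw [memLp_two_iff_integrable_sq (contDiff_gaussian (n := 0) A).continuous.aestronglyMeasurable]
  refine (integrable_exp_neg_quadForm hA one_pos).congr (ae_of_all _ fun ξ => ?_)
  simp only [gaussian, ← Real.exp_nat_mul]
  congr 1; push_cast; ring

/-! ### The weighted Poincaré inequality for smooth functions -/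

lemma abs_apply_le_norm (ξ : E d) (j : Fin d) : |ξ j| ≤ ‖ξ‖ := by
  simpa using PiLp.norm_apply_le ξ j

/-- These are the components of the multiplier ξ / (1 + |ξ|²) of the tail estimate. Paired with the
drift Aξ it stays bounded below at infinity, and its decay absorbs the weight √(1 + |ξ|²) in front
of β. -/
lemma hasFDerivAt_coord_div (ξ : E d) (j : Fin d) :
    HasFDerivAt (fun ξ : E d => ξ j / (1 + ‖ξ‖ ^ 2))
      ((1 + ‖ξ‖ ^ 2)⁻¹ • (EuclideanSpace.proj j : E d →L[ℝ] ℝ) -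
        (ξ j * ((1 + ‖ξ‖ ^ 2) ^ 2)⁻¹) • ((2 : ℝ) • innerSL ℝ ξ)) ξ := by
  have h0 : (1 + ‖ξ‖ ^ 2) ≠ 0 := by positivity
  have h1 : HasFDerivAt (fun ξ : E d => ξ j) (EuclideanSpace.proj j : E d →L[ℝ] ℝ) ξ :=
    (EuclideanSpace.proj j : E d →L[ℝ] ℝ).hasFDerivAt
  have h2 : HasFDerivAt (fun ξ : E d => 1 + ‖ξ‖ ^ 2) ((2 : ℝ) • innerSL ℝ ξ) ξ := by
    have := (hasStrictFDerivAt_norm_sq ξ).hasFDerivAt.const_add 1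
    refine this.congr_fderiv ?_
    ext; simp
  have h3 := h1.mul ((hasDerivAt_inv h0).comp_hasFDerivAt ξ h2)
  simp only [div_eq_mul_inv]
  refine h3.congr_fderiv ?_
  ext v
  simp
  ring

/-- The inequality under the integral sign in `tail_estimate`. -/
lemma divergence_pointwise_le {a : ℝ} (ha : 0 < a) {ξ : E d} {A : Matrix (Fin d) (Fin d) ℝ}
    (hξ : a * ‖ξ‖ ^ 2 ≤ quadForm A ξ) (f : ℝ) (β : Fin d → ℝ) :
    ∑ j, (((1 + ‖ξ‖ ^ 2)⁻¹ - 2 * (ξ j) ^ 2 * ((1 + ‖ξ‖ ^ 2) ^ 2)⁻¹) * f ^ 2 +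
      ξ j / (1 + ‖ξ‖ ^ 2) * (2 * f * (-(matCLM A ξ j) * f + √(1 + ‖ξ‖ ^ 2) * β j))) ≤
    ((d + 2 * a) / (1 + ‖ξ‖ ^ 2) - a) * f ^ 2 + (d + 1) / a * ∑ j, β j ^ 2 := by
  set r := 1 + ‖ξ‖ ^ 2 with hr
  have hr1 : 1 ≤ r := by rw [hr]; nlinarith [sq_nonneg ‖ξ‖]
  have hr0 : 0 < r := by linarith
  have hsr : √r ^ 2 = r := Real.sq_sqrt hr0.le
  have hquad : ∑ j, ξ j * matCLM A ξ j = quadForm A ξ := rfl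
  -- Young's inequality with weight a / (d + 1), so that the `d` terms together cost at most a f²,
  -- half of the 2a f² that the drift provides.
  have hcross : ∀ j, 2 * f * (ξ j / r * (√r * β j)) ≤
      a / (d + 1) * f ^ 2 + (d + 1) / a * β j ^ 2 := by
    intro j
    have hcoef : |ξ j / r * √r| ≤ 1 := by
      rw [abs_mul, abs_div, abs_of_pos hr0, abs_of_nonneg (Real.sqrt_nonneg r), div_mul_eq_mul_div,
        div_le_one hr0]
      have h1 : |ξ j| ≤ √r := by
        refine (abs_apply_le_norm ξ j).trans ?_
        apply Real.le_sqrt_of_sq_le; rw [hr]; linarith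
      calc |ξ j| * √r ≤ √r * √r := by gcongr
        _ = r := Real.mul_self_sqrt hr0.le
    have h2 : 2 * f * (ξ j / r * (√r * β j)) ≤ 2 * (|f| * |β j|) := by
      calc 2 * f * (ξ j / r * (√r * β j)) = 2 * ((ξ j / r * √r) * (f * β j)) := by ring
        _ ≤ 2 * |(ξ j / r * √r) * (f * β j)| := by gcongr; exact le_abs_self _
        _ ≤ 2 * (1 * (|f| * |β j|)) := by rw [abs_mul, abs_mul f]; gcongr
        _ = _ := by ring
    refine h2.trans ?_
    have hd : (0 : ℝ) < d + 1 := by positivity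
    have key : a / (d + 1) * f ^ 2 + (d + 1) / a * β j ^ 2 - 2 * (|f| * |β j|) =
        (a * (d + 1)) ⁻¹ * (a * |f| - (d + 1) * |β j|) ^ 2 := by
      rw [← sq_abs f, ← sq_abs (β j)]; field_simp; ring
    have : 0 ≤ (a * (d + 1 : ℝ)) ⁻¹ * (a * |f| - (d + 1) * |β j|) ^ 2 := by positivity
    linarith
  have hsum : ∑ j, ((r⁻¹ - 2 * (ξ j) ^ 2 * (r ^ 2)⁻¹) * f ^ 2 +
      ξ j / r * (2 * f * (-(matCLM A ξ j) * f + √r * β j))) ≤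
      ∑ j, (r⁻¹ * f ^ 2 - 2 * r⁻¹ * f ^ 2 * (ξ j * matCLM A ξ j) +
        (a / (d + 1) * f ^ 2 + (d + 1) / a * β j ^ 2)) := by
    apply Finset.sum_le_sum
    intro j _
    have h1 := hcross j
    have h2 : 0 ≤ 2 * (ξ j) ^ 2 * (r ^ 2)⁻¹ * f ^ 2 := by positivity
    have e : (r⁻¹ - 2 * (ξ j) ^ 2 * (r ^ 2)⁻¹) * f ^ 2 +
        ξ j / r * (2 * f * (-(matCLM A ξ j) * f + √r * β j)) =
        r⁻¹ * f ^ 2 - 2 * (ξ j) ^ 2 * (r ^ 2)⁻¹ * f ^ 2 - 2 * r⁻¹ * f ^ 2 * (ξ j * matCLM A ξ j) +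
        2 * f * (ξ j / r * (√r * β j)) := by ring
    linarith
  refine hsum.trans ?_
  simp only [Finset.sum_add_distrib, Finset.sum_sub_distrib, ← Finset.mul_sum, hquad,
    Finset.sum_const, Finset.card_univ, Fintype.card_fin, nsmul_eq_mul]
  -- The gain of the drift: ξ·Aξ ≥ a|ξ|² = a(r - 1).
  have h3 : 2 * r⁻¹ * f ^ 2 * (a * (r - 1)) ≤ 2 * r⁻¹ * f ^ 2 * quadForm A ξ := by
    have : a * (r - 1) = a * ‖ξ‖ ^ 2 := by rw [hr]; ring
    rw [this]; gcongr
  have h4 : 2 * r⁻¹ * f ^ 2 * (a * (r - 1)) = 2 * a * f ^ 2 - 2 * a / r * f ^ 2 := by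
    field_simp
  have h5 : (d : ℝ) * (a / (d + 1) * f ^ 2) ≤ a * f ^ 2 := by
    have hd : (0 : ℝ) < d + 1 := by positivity
    rw [← mul_assoc]
    gcongr
    rw [mul_div_assoc', div_le_iff₀ hd]; nlinarith
  have h6 : ((d + 2 * a) / r - a) * f ^ 2 = d * (r⁻¹ * f ^ 2) + 2 * a / r * f ^ 2 - a * f ^ 2 := by
    field_simp
  rw [h6]
  linarith

/-- `f` and `β` satisfy `∇f + A ξ f = √(1 + |ξ|²) β`, all functions being in `L²`. -/
structure IsSmoothPair (A : Matrix (Fin d) (Fin d) ℝ) (f : E d → ℝ) (β : Fin d → E d → ℝ) :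
    Prop where
  contDiff : ContDiff ℝ 1 f
  memLp : MemLp f 2
  memLp_right : ∀ j, MemLp (β j) 2
  fderiv_eq : ∀ ξ j, fderiv ℝ f ξ (basisVec j) = -(matCLM A ξ j) * f ξ + √(1 + ‖ξ‖ ^ 2) * β j ξ

lemma norm_sub_bound (ξ : E d) (j : Fin d) :
    |(1 + ‖ξ‖ ^ 2)⁻¹ - 2 * (ξ j) ^ 2 * ((1 + ‖ξ‖ ^ 2) ^ 2)⁻¹| ≤ 3 := by
  have h1 : (1 + ‖ξ‖ ^ 2)⁻¹ ≤ 1 := inv_le_one_of_one_le₀ (by nlinarith [sq_nonneg ‖ξ‖])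
  have h1' : 0 ≤ (1 + ‖ξ‖ ^ 2)⁻¹ := by positivity
  have h2 : (ξ j) ^ 2 * ((1 + ‖ξ‖ ^ 2) ^ 2)⁻¹ ≤ 1 := by
    rw [← div_eq_mul_inv, div_le_one (by positivity), ← sq_abs]
    have : |ξ j| ≤ 1 + ‖ξ‖ ^ 2 := by nlinarith [abs_apply_le_norm ξ j, sq_nonneg (‖ξ‖ - 1)]
    gcongr
  have h2' : 0 ≤ (ξ j) ^ 2 * ((1 + ‖ξ‖ ^ 2) ^ 2)⁻¹ := by positivity
  rw [abs_le]; constructor <;> linarith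

/-- Every coefficient of `f ^ 2` or `f * β j` is bounded. This integrability is what lets the
divergence integrate to zero without boundary terms. -/
lemma IsSmoothPair.integrable_terms {A : Matrix (Fin d) (Fin d) ℝ} {f : E d → ℝ}
    {β : Fin d → E d → ℝ} (h : IsSmoothPair A f β) (j : Fin d) :
    Integrable (fun ξ : E d => (ξ j / (1 + ‖ξ‖ ^ 2)) * f ξ ^ 2) ∧
    Integrable (fun ξ : E d =>
      ((1 + ‖ξ‖ ^ 2)⁻¹ - 2 * (ξ j) ^ 2 * ((1 + ‖ξ‖ ^ 2) ^ 2)⁻¹) * f ξ ^ 2) ∧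
    Integrable (fun ξ : E d => ξ j / (1 + ‖ξ‖ ^ 2) *
      (2 * f ξ * (-(matCLM A ξ j) * f ξ + √(1 + ‖ξ‖ ^ 2) * β j ξ))) := by
  have hne : ∀ ξ : E d, (1 + ‖ξ‖ ^ 2) ≠ 0 := fun ξ => by positivity
  have hf2 := h.memLp.integrable_sq
  have hfβ : Integrable fun ξ => f ξ * β j ξ := h.memLp.integrable_mul (h.memLp_right j)
  have hco : ∀ ξ : E d, |ξ j| ≤ ‖ξ‖ := fun ξ => abs_apply_le_norm ξ j
  refine ⟨?_, ?_, ?_⟩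
  · refine hf2.bdd_mul (c := 1) ?_ (ae_of_all _ fun ξ => ?_)
    · exact Continuous.aestronglyMeasurable (by fun_prop (disch := exact hne _))
    · rw [Real.norm_eq_abs, abs_div, abs_of_pos (by positivity : 0 < 1 + ‖ξ‖ ^ 2),
        div_le_one (by positivity)]
      nlinarith [hco ξ, sq_nonneg (‖ξ‖ - 1)]
  · refine hf2.bdd_mul (c := 3) ?_ (ae_of_all _ fun ξ => norm_sub_bound ξ j)
    have hc : Continuous fun ξ : E d => (1 + ‖ξ‖ ^ 2) := by fun_prop
    have hc1 := hc.inv₀ hne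
    have hc2 := (hc.pow 2).inv₀ fun ξ => pow_ne_zero 2 (hne ξ)
    have hc3 : Continuous fun ξ : E d => 2 * (ξ j) ^ 2 := by fun_prop
    exact (hc1.sub (hc3.mul hc2)).aestronglyMeasurable
  · have e : (fun ξ : E d => ξ j / (1 + ‖ξ‖ ^ 2) *
        (2 * f ξ * (-(matCLM A ξ j) * f ξ + √(1 + ‖ξ‖ ^ 2) * β j ξ))) = fun ξ =>
        (ξ j / (1 + ‖ξ‖ ^ 2) * (-2 * matCLM A ξ j)) * f ξ ^ 2 +
        (ξ j / (1 + ‖ξ‖ ^ 2) * (2 * √(1 + ‖ξ‖ ^ 2))) * (f ξ * β j ξ) := by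
      funext ξ; ring
    rw [e]
    refine (hf2.bdd_mul (c := 2 * ‖matCLM A‖) ?_ (ae_of_all _ fun ξ => ?_)).add
      (hfβ.bdd_mul (c := 2) ?_ (ae_of_all _ fun ξ => ?_))
    · exact Continuous.aestronglyMeasurable (by fun_prop (disch := exact hne _))
    · have h1 : |matCLM A ξ j| ≤ ‖matCLM A‖ * ‖ξ‖ :=
        (abs_apply_le_norm _ j).trans ((matCLM A).le_opNorm ξ)
      rw [Real.norm_eq_abs, abs_mul, abs_div, abs_of_pos (by positivity : 0 < 1 + ‖ξ‖ ^ 2), abs_mul,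
        div_mul_eq_mul_div, div_le_iff₀ (by positivity)]
      have h2 : |ξ j| * |matCLM A ξ j| ≤ ‖ξ‖ * (‖matCLM A‖ * ‖ξ‖) :=
        mul_le_mul (hco ξ) h1 (abs_nonneg _) (norm_nonneg _)
      have h3 : |(-2 : ℝ)| = 2 := by norm_num
      rw [h3]
      nlinarith [norm_nonneg (matCLM A)]
    · exact Continuous.aestronglyMeasurable (by fun_prop (disch := exact hne _))
    · have h0 : 0 ≤ √(1 + ‖ξ‖ ^ 2) := Real.sqrt_nonneg _
      have h1 : |ξ j| ≤ √(1 + ‖ξ‖ ^ 2) := by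
        refine (hco ξ).trans (Real.le_sqrt_of_sq_le (by linarith))
      rw [Real.norm_eq_abs, abs_mul, abs_div, abs_of_pos (by positivity : 0 < 1 + ‖ξ‖ ^ 2), abs_mul,
        abs_of_nonneg h0, div_mul_eq_mul_div, div_le_iff₀ (by positivity)]
      have h2 : √(1 + ‖ξ‖ ^ 2) * √(1 + ‖ξ‖ ^ 2) = 1 + ‖ξ‖ ^ 2 :=
        Real.mul_self_sqrt (by positivity)
      have h3 : |(2 : ℝ)| = 2 := by norm_num
      rw [h3]
      nlinarith [mul_le_mul_of_nonneg_right h1 h0]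

/-- The integrand is ∂ⱼ(ξⱼ f² / (1 + |ξ|²)), with ∂ⱼf replaced through the equation of the pair. -/
lemma IsSmoothPair.integral_divergence {A : Matrix (Fin d) (Fin d) ℝ} {f : E d → ℝ}
    {β : Fin d → E d → ℝ} (h : IsSmoothPair A f β) (j : Fin d) :
    ∫ ξ : E d, (((1 + ‖ξ‖ ^ 2)⁻¹ - 2 * (ξ j) ^ 2 * ((1 + ‖ξ‖ ^ 2) ^ 2)⁻¹) * f ξ ^ 2 +
      ξ j / (1 + ‖ξ‖ ^ 2) *
        (2 * f ξ * (-(matCLM A ξ j) * f ξ + √(1 + ‖ξ‖ ^ 2) * β j ξ))) = 0 := by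
  obtain ⟨h1, h2, h3⟩ := h.integrable_terms j
  have hd : Differentiable ℝ f := h.contDiff.differentiable (by norm_num)
  have e1 : ∀ ξ : E d, fderiv ℝ (fun ξ : E d => ξ j / (1 + ‖ξ‖ ^ 2)) ξ (basisVec j) =
      (1 + ‖ξ‖ ^ 2)⁻¹ - 2 * (ξ j) ^ 2 * ((1 + ‖ξ‖ ^ 2) ^ 2)⁻¹ := fun ξ => by
    rw [(hasFDerivAt_coord_div ξ j).fderiv]
    simp [inner_basisVec]
    simp [basisVec]
    ring
  have e2 : ∀ ξ : E d, fderiv ℝ (fun ξ => f ξ ^ 2) ξ (basisVec j) =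
      2 * f ξ * (-(matCLM A ξ j) * f ξ + √(1 + ‖ξ‖ ^ 2) * β j ξ) := fun ξ => by
    rw [((hd ξ).hasFDerivAt.pow 2).fderiv, ← h.fderiv_eq]
    simp
  have := integral_mul_fderiv_eq_neg_fderiv_mul_of_integrable (μ := (volume : Measure (E d)))
    (f := fun ξ : E d => ξ j / (1 + ‖ξ‖ ^ 2)) (g := fun ξ => f ξ ^ 2) (v := basisVec j)
    (by simpa only [e1] using h2) (by simpa only [e2] using h3) h1
    (fun ξ _ => (hasFDerivAt_coord_div ξ j).differentiableAt)
    (fun ξ _ => ((hd ξ).pow 2))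
  simp only [e1, e2] at this
  rw [integral_add h2 h3, this]
  ring

/-- The `L²` norm of `f` is controlled by its `L²` norm on a ball and by `β`. -/
lemma tail_estimate {A : Matrix (Fin d) (Fin d) ℝ} (hA : A.PosDef) :
    ∃ R C : ℝ, 0 < R ∧ 0 < C ∧ ∀ f β, IsSmoothPair A f β →
      ∫ ξ, f ξ ^ 2 ≤ C * ((∫ ξ in Metric.closedBall (0 : E d) R, f ξ ^ 2) +
        ∑ j, ∫ ξ, β j ξ ^ 2) := by
  obtain ⟨a, ha, hquad⟩ := exists_quadForm_ge hA
  -- Outside this radius (d + 2a) / (1 + |ξ|²) ≤ a/2, so the negative term -a f² of the pointwise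
  -- bound prevails and leaves -(a/2) f².
  set R := √(2 * (d + 2 * a) / a) with hR
  have hRsq : R ^ 2 = 2 * (d + 2 * a) / a := Real.sq_sqrt (by positivity)
  have hR0 : 0 < R := Real.sqrt_pos.2 (by positivity)
  set B := Metric.closedBall (0 : E d) R with hB
  have hBm : MeasurableSet B := Metric.isClosed_closedBall.measurableSet
  refine ⟨R, 2 / a * ((d + 2 * a) + (d + 1) / a), hR0, by positivity, fun f β h => ?_⟩
  have hf2 := h.memLp.integrable_sq
  have hβ2 : ∀ j, Integrable fun ξ => β j ξ ^ 2 := fun j => (h.memLp_right j).integrable_sq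
  have hzero : ∫ ξ : E d, ∑ j, (((1 + ‖ξ‖ ^ 2)⁻¹ -
      2 * (ξ j) ^ 2 * ((1 + ‖ξ‖ ^ 2) ^ 2)⁻¹) * f ξ ^ 2 +
      ξ j / (1 + ‖ξ‖ ^ 2) *
        (2 * f ξ * (-(matCLM A ξ j) * f ξ + √(1 + ‖ξ‖ ^ 2) * β j ξ))) = 0 := by
    rw [integral_finsetSum]
    · exact Finset.sum_eq_zero fun j _ => h.integral_divergence j
    · intro j _
      obtain ⟨-, h2, h3⟩ := h.integrable_terms j
      exact h2.add h3
  have hle : (0 : ℝ) ≤ ∫ ξ : E d, ((d + 2 * a) * B.indicator (fun ξ => f ξ ^ 2) ξ -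
      a / 2 * f ξ ^ 2 + (d + 1) / a * ∑ j, β j ξ ^ 2) := by
    rw [← hzero]
    apply integral_mono
    · refine integrable_finsetSum _ fun j _ => ?_
      obtain ⟨-, h2, h3⟩ := h.integrable_terms j
      exact h2.add h3
    · exact (((hf2.indicator hBm).const_mul _).sub (hf2.const_mul _)).add
        ((integrable_finsetSum _ fun j _ => hβ2 j).const_mul _)
    · intro ξ
      refine (divergence_pointwise_le ha (hquad ξ) (f ξ) fun j => β j ξ).trans ?_
      have hr0 : (0 : ℝ) < 1 + ‖ξ‖ ^ 2 := by positivity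
      have hkey : (d + 2 * a) / (1 + ‖ξ‖ ^ 2) * f ξ ^ 2 ≤
          (d + 2 * a) * B.indicator (fun ξ => f ξ ^ 2) ξ + a / 2 * f ξ ^ 2 := by
        by_cases hξ : ξ ∈ B
        · rw [Set.indicator_of_mem hξ]
          have : (d + 2 * a) / (1 + ‖ξ‖ ^ 2) ≤ d + 2 * a :=
            div_le_self (by positivity) (by nlinarith [sq_nonneg ‖ξ‖])
          nlinarith [sq_nonneg (f ξ), mul_le_mul_of_nonneg_right this (sq_nonneg (f ξ))]
        · rw [Set.indicator_of_notMem hξ, mul_zero, zero_add]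
          refine mul_le_mul_of_nonneg_right ?_ (sq_nonneg _)
          rw [div_le_iff₀ hr0]
          have h1 : R ≤ ‖ξ‖ := by
            have : ¬ ‖ξ‖ ≤ R := by simpa [B] using hξ
            linarith
          have h2 : R ^ 2 ≤ ‖ξ‖ ^ 2 := by gcongr
          rw [hRsq, div_le_iff₀ ha] at h2
          nlinarith
      linarith
  rw [integral_add, integral_sub, integral_const_mul, integral_const_mul, integral_const_mul,
    integral_indicator hBm, integral_finsetSum _ fun j _ => hβ2 j] at hle
  · have hs : 0 ≤ ∑ j, ∫ ξ, β j ξ ^ 2 :=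
      Finset.sum_nonneg fun j _ => integral_nonneg fun _ => sq_nonneg _
    have hb : 0 ≤ ∫ ξ in B, f ξ ^ 2 := integral_nonneg fun _ => sq_nonneg _
    set X := ∫ ξ in B, f ξ ^ 2
    set Y := ∑ j, ∫ ξ, β j ξ ^ 2
    set Z := ∫ ξ, f ξ ^ 2
    have h1 : Z ≤ 2 / a * ((d + 2 * a) * X + (d + 1) / a * Y) := by
      rw [div_mul_eq_mul_div, le_div_iff₀ ha]; linarith
    refine h1.trans ?_
    rw [mul_assoc]
    gcongr
    have : 0 ≤ (d + 2 * a) * Y := by positivity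
    have : 0 ≤ (d + 1) / a * X := by positivity
    linarith
  · exact (hf2.indicator hBm).const_mul _
  · exact hf2.const_mul _
  · exact ((hf2.indicator hBm).const_mul _).sub (hf2.const_mul _)
  · exact (integrable_finsetSum _ fun j _ => hβ2 j).const_mul _

lemma norm_sq_dual_le (L : E d →L[ℝ] ℝ) : ‖L‖ ^ 2 ≤ ∑ j, L (basisVec j) ^ 2 := by
  set z : E d := WithLp.toLp 2 fun j => L (basisVec j) with hz
  have hL : ∀ v, L v = inner ℝ z v := fun v => by
    have hv : v = ∑ j, v j • (basisVec j : E d) := by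
      have := (EuclideanSpace.basisFun (Fin d) ℝ).sum_repr v
      simpa [basisVec] using this.symm
    conv_lhs => rw [hv]
    rw [map_sum, inner_eq_dotProduct]
    simp [dotProduct, hz, mul_comm]
  have h1 : ‖L‖ ≤ ‖z‖ := L.opNorm_le_bound (norm_nonneg _) fun v => by
    rw [hL]; exact norm_inner_le_norm z v
  calc ‖L‖ ^ 2 ≤ ‖z‖ ^ 2 := by gcongr
    _ = _ := by rw [EuclideanSpace.norm_sq_eq]; simp [hz]

/-- Division by the Gaussian becomes multiplication by `gaussian (-A)`, whose derivative is given by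
the same formula, valid for any Hermitian matrix. -/
lemma gaussian_neg_mul (A : Matrix (Fin d) (Fin d) ℝ) (ξ : E d) :
    gaussian A ξ * gaussian (-A) ξ = 1 := by
  rw [gaussian, gaussian, ← Real.exp_add, Real.exp_eq_one_iff]
  simp [quadForm, Matrix.neg_mulVec]
  ring

/-- The Gaussian solves the homogeneous equation, so `β` does not change. -/
lemma IsSmoothPair.sub_gaussian {A : Matrix (Fin d) (Fin d) ℝ} (hA : A.PosDef) {f : E d → ℝ}
    {β : Fin d → E d → ℝ} (h : IsSmoothPair A f β) (t : ℝ) :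
    IsSmoothPair A (fun ξ => f ξ - t * gaussian A ξ) β where
  contDiff := h.contDiff.sub (contDiff_const.mul (contDiff_gaussian A))
  memLp := h.memLp.sub ((memLp_gaussian hA).const_mul t)
  memLp_right := h.memLp_right
  fderiv_eq ξ j := by
    have h1 := (h.contDiff.differentiable (by norm_num) ξ).hasFDerivAt
    have h2 := h1.fun_sub ((hasFDerivAt_gaussian hA.isHermitian ξ).const_mul t)
    rw [HasFDerivAt.fderiv h2]
    simp only [_root_.sub_apply, h.fderiv_eq]
    simp [inner_basisVec]
    ring

/-- The inverse Gaussian is an integrating factor: its derivative cancels the drift. -/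
lemma IsSmoothPair.fderiv_mul {A : Matrix (Fin d) (Fin d) ℝ} (hA : A.PosDef) {f : E d → ℝ}
    {β : Fin d → E d → ℝ} (h : IsSmoothPair A f β) (ξ : E d) (j : Fin d) :
    fderiv ℝ (fun ξ => f ξ * gaussian (-A) ξ) ξ (basisVec j) =
      gaussian (-A) ξ * √(1 + ‖ξ‖ ^ 2) * β j ξ := by
  have h1 := (h.contDiff.differentiable (by norm_num) ξ).hasFDerivAt
  have h2 := h1.fun_mul (hasFDerivAt_gaussian hA.isHermitian.neg ξ)
  rw [HasFDerivAt.fderiv h2]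
  simp [h.fderiv_eq, inner_basisVec]
  have : (matCLM (-A) ξ) j = -(matCLM A ξ j) := by simp [matCLM_apply, Matrix.neg_mulVec]
  rw [this]
  ring

/-- The weighted Poincaré inequality for smooth functions. -/
theorem smooth_inequality {A : Matrix (Fin d) (Fin d) ℝ} (hA : A.PosDef) :
    ∃ C : ℝ, 0 < C ∧ ∀ f β, IsSmoothPair A f β →
      ∃ t : ℝ, ∫ ξ, (f ξ - t * gaussian A ξ) ^ 2 ≤ C * ∑ j, ∫ ξ, β j ξ ^ 2 := by
  obtain ⟨R, C₀, hR, hC₀, htail⟩ := tail_estimate hA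
  set B := Metric.closedBall (0 : E d) R with hB
  have hBm : MeasurableSet B := Metric.isClosed_closedBall.measurableSet
  have hBc : IsCompact B := isCompact_closedBall _ _
  -- `K` converts |∇(f/G)|² = G⁻² (1 + |ξ|²) |β|² into |β|² on the ball.
  obtain ⟨K, hK⟩ := hBc.exists_bound_of_continuousOn
    (f := fun ξ : E d => gaussian (-A) ξ ^ 2 * (1 + ‖ξ‖ ^ 2)) (by
      have := (contDiff_gaussian (n := 0) (-A)).continuous
      exact Continuous.continuousOn (by fun_prop))
  have hK0 : 0 ≤ K := (norm_nonneg _).trans (hK 0 (by simp [B, hR.le]))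
  set P : ℝ := 4 * R ^ 2 * 2 ^ d with hP
  refine ⟨C₀ * (P * K + 1), by positivity, fun f β h => ?_⟩
  set q : E d → ℝ := fun ξ => f ξ * gaussian (-A) ξ with hq
  have hqC : ContDiff ℝ 1 q := h.contDiff.mul (contDiff_gaussian _)
  have hqc := hqC.continuous
  have hDc : Continuous (fderiv ℝ q) := hqC.continuous_fderiv (by norm_num)
  have hβ2 : ∀ j, Integrable fun ξ => β j ξ ^ 2 := fun j => (h.memLp_right j).integrable_sq
  obtain ⟨y, hy⟩ := exists_lintegral_sq_sub_le hR hqC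
  set t := q y with ht
  refine ⟨t, ?_⟩
  have hpoinc : ∫ ξ in B, (q ξ - t) ^ 2 ≤ P * ∫ ξ in B, ‖fderiv ℝ q ξ‖ ^ 2 := by
    have i1 : IntegrableOn (fun ξ => (q ξ - t) ^ 2) B :=
      Continuous.continuousOn (by fun_prop) |>.integrableOn_compact hBc
    have i2 : IntegrableOn (fun ξ => ‖fderiv ℝ q ξ‖ ^ 2) B :=
      Continuous.continuousOn (by fun_prop) |>.integrableOn_compact hBc
    rw [← ofReal_integral_eq_lintegral_ofReal i1 (ae_of_all _ fun _ => sq_nonneg _),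
      ← ofReal_integral_eq_lintegral_ofReal i2 (ae_of_all _ fun _ => sq_nonneg _),
      ← ENNReal.ofReal_mul (by positivity)] at hy
    exact (ENNReal.ofReal_le_ofReal_iff
      (mul_nonneg (by positivity) (integral_nonneg fun _ => sq_nonneg _))).1 hy
  have hgrad : ∫ ξ in B, ‖fderiv ℝ q ξ‖ ^ 2 ≤ K * ∑ j, ∫ ξ, β j ξ ^ 2 := by
    calc ∫ ξ in B, ‖fderiv ℝ q ξ‖ ^ 2 ≤ ∫ ξ in B, K * ∑ j, β j ξ ^ 2 := by
          apply setIntegral_mono_on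
          · exact Continuous.continuousOn (by fun_prop) |>.integrableOn_compact hBc
          · exact ((integrable_finsetSum _ fun j _ => hβ2 j).const_mul _).integrableOn
          · exact hBm
          · intro ξ hξ
            refine (norm_sq_dual_le _).trans ?_
            rw [Finset.mul_sum]
            gcongr with j
            rw [hq, h.fderiv_mul hA, mul_pow, mul_pow, Real.sq_sqrt (by positivity)]
            gcongr
            exact (le_abs_self _).trans (hK ξ hξ)
      _ ≤ ∫ ξ, K * ∑ j, β j ξ ^ 2 := by
          apply setIntegral_le_integral ((integrable_finsetSum _ fun j _ => hβ2 j).const_mul _)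
          exact ae_of_all _ fun ξ => mul_nonneg hK0 (Finset.sum_nonneg fun _ _ => sq_nonneg _)
      _ = _ := by rw [integral_const_mul, integral_finsetSum _ fun j _ => hβ2 j]
  -- Since f - tG = G (q - t) and G ≤ 1.
  have hloc : ∫ ξ in B, (f ξ - t * gaussian A ξ) ^ 2 ≤ ∫ ξ in B, (q ξ - t) ^ 2 := by
    have hs := h.sub_gaussian hA t
    apply setIntegral_mono_on
    · exact hs.memLp.integrable_sq.integrableOn
    · exact Continuous.continuousOn (by fun_prop) |>.integrableOn_compact hBc
    · exact hBm
    · intro ξ _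
      have e : f ξ - t * gaussian A ξ = gaussian A ξ * (q ξ - t) := by
        have := gaussian_neg_mul A ξ
        simp only [hq]
        linear_combination (-f ξ) * this
      rw [e, mul_pow]
      have h1 := gaussian_le_one hA ξ
      have h0 := (gaussian_pos A ξ).le
      have : gaussian A ξ ^ 2 ≤ 1 := pow_le_one₀ h0 h1
      nlinarith [sq_nonneg (q ξ - t)]
  -- The tail estimate is applied to f - tG, whose local norm has just been bounded by `β`.
  refine (htail _ β (h.sub_gaussian hA t)).trans ?_
  rw [mul_assoc]
  gcongr
  rw [add_mul, one_mul]
  gcongr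
  calc _ ≤ _ := hloc
    _ ≤ _ := hpoinc
    _ ≤ P * (K * ∑ j, ∫ ξ, β j ξ ^ 2) := by gcongr
    _ = _ := by ring

/-! ### Mollification -/

/-- The mollification of `b` by a normalized bump function. -/
def mollify (ζ : ContDiffBump (0 : E d)) (b : E d → ℝ) : E d → ℝ :=
  convolution (ζ.normed volume) b (ContinuousLinearMap.lsmul ℝ ℝ) volume

lemma mollify_apply (ζ : ContDiffBump (0 : E d)) (b : E d → ℝ) (x : E d) :
    mollify ζ b x = ∫ y, ζ.normed volume (x - y) * b y := by
  rw [mollify, convolution_eq_swap]; rfl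

lemma continuous_normed (ζ : ContDiffBump (0 : E d)) : Continuous (ζ.normed volume) :=
  ζ.continuous_normed

lemma hasCompactSupport_normed_sub (ζ : ContDiffBump (0 : E d)) (x : E d) :
    HasCompactSupport fun y => ζ.normed volume (x - y) :=
  ζ.hasCompactSupport_normed.comp_homeomorph (Homeomorph.subLeft x)

lemma integrable_normed_mul (ζ : ContDiffBump (0 : E d)) {b : E d → ℝ} (hb : LocallyIntegrable b)
    (x : E d) : Integrable fun y => ζ.normed volume (x - y) * b y :=
  hb.integrable_smul_left_of_hasCompactSupport
    ((continuous_normed ζ).comp (by fun_prop)) (hasCompactSupport_normed_sub ζ x)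

lemma contDiff_mollify (ζ : ContDiffBump (0 : E d)) {b : E d → ℝ} (hb : LocallyIntegrable b) :
    ContDiff ℝ 1 (mollify ζ b) :=
  ζ.hasCompactSupport_normed.contDiff_convolution_left (n := 1) _ ζ.contDiff_normed hb

lemma integral_normed_sub (ζ : ContDiffBump (0 : E d)) (x : E d) :
    ∫ y, ζ.normed volume (x - y) = 1 := by
  rw [integral_sub_left_eq_self (fun y => ζ.normed volume y) volume x, ζ.integral_normed]

/-- Jensen's inequality: the normed bump is a probability density, and the variance of `b` about its
mean `c` is nonnegative. -/
lemma sq_mollify_le (ζ : ContDiffBump (0 : E d)) {b : E d → ℝ} (hb : MemLp b 2) (x : E d) :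
    mollify ζ b x ^ 2 ≤ mollify ζ (fun y => b y ^ 2) x := by
  have i1 := integrable_normed_mul ζ (hb.locallyIntegrable (by norm_num)) x
  have i2 := integrable_normed_mul ζ hb.integrable_sq.locallyIntegrable x
  have i3 : Integrable fun y => ζ.normed volume (x - y) :=
    ((continuous_normed ζ).comp (by fun_prop)).integrable_of_hasCompactSupport
      (hasCompactSupport_normed_sub ζ x)
  set c := mollify ζ b x with hc
  have h0 : 0 ≤ ∫ y, ζ.normed volume (x - y) * (b y - c) ^ 2 :=
    integral_nonneg fun y => mul_nonneg (ζ.nonneg_normed _) (sq_nonneg _)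
  have e : ∀ y, ζ.normed volume (x - y) * (b y - c) ^ 2 = ζ.normed volume (x - y) * b y ^ 2 -
      2 * c * (ζ.normed volume (x - y) * b y) + c ^ 2 * ζ.normed volume (x - y) := fun y => by ring
  simp_rw [e] at h0
  rw [integral_add, integral_sub, integral_const_mul, integral_const_mul, integral_normed_sub,
    ← mollify_apply ζ b, ← mollify_apply ζ fun y => b y ^ 2, ← hc] at h0
  · linarith
  · exact i2
  · exact i1.const_mul _
  · exact i2.sub (i1.const_mul _)
  · exact i3.const_mul _

lemma integrable_mollify (ζ : ContDiffBump (0 : E d)) {b : E d → ℝ} (hb : Integrable b) :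
    Integrable (mollify ζ b) :=
  ζ.integrable_normed.integrable_convolution _ hb

lemma integral_mollify (ζ : ContDiffBump (0 : E d)) {b : E d → ℝ} (hb : Integrable b) :
    ∫ x, mollify ζ b x = ∫ x, b x := by
  unfold mollify
  rw [integral_convolution _ ζ.integrable_normed hb, ζ.integral_normed]
  simp

lemma memLp_mollify (ζ : ContDiffBump (0 : E d)) {b : E d → ℝ} (hb : MemLp b 2) :
    MemLp (mollify ζ b) 2 := by
  have hc : AEStronglyMeasurable (mollify ζ b) volume :=
    (contDiff_mollify ζ (hb.locallyIntegrable (by norm_num))).continuous.aestronglyMeasurable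
  rw [memLp_two_iff_integrable_sq hc]
  refine (integrable_mollify ζ hb.integrable_sq).mono' (hc.pow 2) (ae_of_all _ fun x => ?_)
  rw [Real.norm_eq_abs, abs_of_nonneg (sq_nonneg _)]
  exact sq_mollify_le ζ hb x

/-- Mollification does not increase the `L²` norm. -/
lemma integral_sq_mollify_le (ζ : ContDiffBump (0 : E d)) {b : E d → ℝ} (hb : MemLp b 2) :
    ∫ x, mollify ζ b x ^ 2 ≤ ∫ x, b x ^ 2 := by
  rw [← integral_mollify ζ hb.integrable_sq]
  exact integral_mono (memLp_mollify ζ hb).integrable_sq (integrable_mollify ζ hb.integrable_sq)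
    (sq_mollify_le ζ hb)

lemma fderiv_mollify (ζ : ContDiffBump (0 : E d)) {b : E d → ℝ} (hb : LocallyIntegrable b)
    (x v : E d) : fderiv ℝ (mollify ζ b) x v = ∫ y, fderiv ℝ (ζ.normed volume) (x - y) v * b y := by
  have h := (ζ.hasCompactSupport_normed (μ := volume)).hasFDerivAt_convolution_left
    (μ := (volume : Measure (E d))) (ContinuousLinearMap.lsmul ℝ ℝ) (ζ.contDiff_normed (n := 1)) hb x
  unfold mollify
  have hfc : Continuous (fderiv ℝ (ζ.normed (volume : Measure (E d)))) :=
    (ζ.contDiff_normed (n := 1)).continuous_fderiv (by norm_num)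
  rw [h.fderiv, convolution_eq_swap, ContinuousLinearMap.integral_apply]
  · rfl
  · have h1 := (ζ.hasCompactSupport_normed (μ := volume)).fderiv (𝕜 := ℝ)
    have := (h1.convolutionExists_left
      (ContinuousLinearMap.precompL (E d) (ContinuousLinearMap.lsmul ℝ ℝ)) hfc hb) x
    exact this.integrable_swap

/-! ### The weighted Poincaré inequality in the weak formulation -/

/-- `h` and `β` satisfy `∇h + A ξ h = √(1 + |ξ|²) β` in the sense of distributions, all functions
being in `L²`. -/
structure IsWeakPair (A : Matrix (Fin d) (Fin d) ℝ) (h : E d → ℝ) (β : Fin d → E d → ℝ) :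
    Prop where
  memLp : MemLp h 2
  memLp_right : ∀ j, MemLp (β j) 2
  integral_eq : ∀ (j : Fin d) (φ : E d → ℝ), ContDiff ℝ (⊤ : ℕ∞) φ → HasCompactSupport φ →
    ∫ ξ, φ ξ * (√(1 + ‖ξ‖ ^ 2) * β j ξ) =
      ∫ ξ, h ξ * (matCLM A ξ j * φ ξ - fderiv ℝ φ ξ (basisVec j))

lemma locallyIntegrable_sqrt_mul {b : E d → ℝ} (hb : LocallyIntegrable b) :
    LocallyIntegrable fun ξ => √(1 + ‖ξ‖ ^ 2) * b ξ :=
  hb.continuous_mul (by fun_prop)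

/-- The commutator of mollification and multiplication with the linear function `A ξ`. -/
lemma IsWeakPair.fderiv_mollify_add {A : Matrix (Fin d) (Fin d) ℝ} {h : E d → ℝ}
    {β : Fin d → E d → ℝ} (H : IsWeakPair A h β) (ζ : ContDiffBump (0 : E d)) (x : E d) (j : Fin d) :
    fderiv ℝ (mollify ζ h) x (basisVec j) + matCLM A x j * mollify ζ h x =
      ∫ y, ζ.normed volume (x - y) * (√(1 + ‖y‖ ^ 2) * β j y + matCLM A (x - y) j * h y) := by
  have hloc : LocallyIntegrable h := H.memLp.locallyIntegrable (by norm_num)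
  have hβloc : LocallyIntegrable (β j) := (H.memLp_right j).locallyIntegrable (by norm_num)
  have hsmooth : ContDiff ℝ (⊤ : ℕ∞) fun y => ζ.normed volume (x - y) :=
    ζ.contDiff_normed.comp (by fun_prop)
  have hfd : ∀ y, fderiv ℝ (fun y => ζ.normed volume (x - y)) y (basisVec j) =
      -fderiv ℝ (ζ.normed volume) (x - y) (basisVec j) := fun y => by
    have h1 : HasFDerivAt (ζ.normed (volume : Measure (E d)))
        (fderiv ℝ (ζ.normed volume) (x - y)) (x - y) :=
      ((ζ.contDiff_normed (n := 1)).differentiable (by norm_num) _).hasFDerivAt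
    have h2 := h1.comp y ((hasFDerivAt_id y).const_sub x)
    have h3 : fderiv ℝ (fun y => ζ.normed volume (x - y)) y = _ := h2.fderiv
    rw [h3]; simp
  have hw := H.integral_eq j _ hsmooth (hasCompactSupport_normed_sub ζ x)
  simp_rw [hfd] at hw
  have i1 : Integrable fun y => ζ.normed volume (x - y) * (√(1 + ‖y‖ ^ 2) * β j y) :=
    integrable_normed_mul ζ (locallyIntegrable_sqrt_mul hβloc) x
  have i2 : Integrable fun y => ζ.normed volume (x - y) * (matCLM A (x - y) j * h y) :=
    integrable_normed_mul ζ (hloc.continuous_mul (by fun_prop)) x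
  have i3 : Integrable fun y => ζ.normed volume (x - y) * (matCLM A y j * h y) :=
    integrable_normed_mul ζ (hloc.continuous_mul (by fun_prop)) x
  have i4 : Integrable fun y => fderiv ℝ (ζ.normed volume) (x - y) (basisVec j) * h y := by
    have hfc : Continuous (fderiv ℝ (ζ.normed (volume : Measure (E d)))) :=
      (ζ.contDiff_normed (n := 1)).continuous_fderiv (by norm_num)
    have hs : HasCompactSupport fun y => fderiv ℝ (ζ.normed volume) (x - y) (basisVec j) := by
      have h1 := ((ζ.hasCompactSupport_normed (μ := volume)).fderiv_apply (𝕜 := ℝ)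
        (basisVec j)).comp_homeomorph (Homeomorph.subLeft x)
      exact h1
    exact hloc.integrable_smul_left_of_hasCompactSupport (by fun_prop) hs
  have i5 := integrable_normed_mul ζ hloc x
  have e1 : ∀ y, h y * (matCLM A y j * ζ.normed volume (x - y) -
      -fderiv ℝ (ζ.normed volume) (x - y) (basisVec j)) =
      ζ.normed volume (x - y) * (matCLM A y j * h y) +
        fderiv ℝ (ζ.normed volume) (x - y) (basisVec j) * h y := fun y => by ring
  simp_rw [e1] at hw
  rw [integral_add i3 i4, ← fderiv_mollify ζ hloc] at hw
  simp_rw [mul_add]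
  rw [integral_add i1 i2, hw, mollify_apply, ← integral_const_mul]
  have e2 : ∫ y, matCLM A x j * (ζ.normed volume (x - y) * h y) =
      (∫ y, ζ.normed volume (x - y) * (matCLM A y j * h y)) +
        ∫ y, ζ.normed volume (x - y) * (matCLM A (x - y) j * h y) := by
    rw [← integral_add i3 i2]
    congr 1 with y
    rw [map_sub, PiLp.sub_apply]; ring
  rw [e2]; ring

/-- On the support of the bump |x - y| < `rOut` ≤ 1, so √(1 + |y|²) ≤ 2 √(1 + |x|²) and the
commutator A(x - y) is of size `rOut`. Hence mollification preserves the form of the equation, up to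
a factor 2 on β and an error of order `rOut`. -/
lemma IsWeakPair.abs_fderiv_mollify_add_le {A : Matrix (Fin d) (Fin d) ℝ} {h : E d → ℝ}
    {β : Fin d → E d → ℝ} (H : IsWeakPair A h β) (ζ : ContDiffBump (0 : E d)) (hζ : ζ.rOut ≤ 1)
    (x : E d) (j : Fin d) :
    |fderiv ℝ (mollify ζ h) x (basisVec j) + matCLM A x j * mollify ζ h x| ≤
      √(1 + ‖x‖ ^ 2) *
        mollify ζ (fun y => 2 * |β j y| + ‖matCLM A‖ * ζ.rOut * |h y|) x := by
  have hb : LocallyIntegrable fun y => 2 * |β j y| + ‖matCLM A‖ * ζ.rOut * |h y| :=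
    (((H.memLp_right j).norm.const_mul 2).add (H.memLp.norm.const_mul _)).locallyIntegrable
      (by norm_num)
  rw [H.fderiv_mollify_add, mollify_apply, ← integral_const_mul, ← Real.norm_eq_abs]
  refine norm_integral_le_of_norm_le ((integrable_normed_mul ζ hb x).const_mul _)
    (ae_of_all _ fun y => ?_)
  rw [norm_mul, Real.norm_eq_abs, abs_of_nonneg (ζ.nonneg_normed _), Real.norm_eq_abs]
  by_cases hy : ‖x - y‖ < ζ.rOut
  · rw [mul_left_comm]
    refine mul_le_mul_of_nonneg_left ?_ (ζ.nonneg_normed _)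
    have hs1 : 1 ≤ √(1 + ‖x‖ ^ 2) := Real.one_le_sqrt.2 (by nlinarith [sq_nonneg ‖x‖])
    have hs2 : √(1 + ‖y‖ ^ 2) ≤ √(1 + ‖x‖ ^ 2) * 2 := by
      rw [Real.sqrt_le_left (by positivity), mul_pow, Real.sq_sqrt (by positivity)]
      have h1 : ‖y‖ ≤ ‖x‖ + 1 := by
        have := norm_sub_norm_le y x
        rw [norm_sub_rev] at this
        linarith
      nlinarith [norm_nonneg x, norm_nonneg y, sq_nonneg (‖x‖ - 1)]
    have hA : |matCLM A (x - y) j| ≤ ‖matCLM A‖ * ζ.rOut :=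
      (abs_apply_le_norm _ j).trans (((matCLM A).le_opNorm _).trans (by gcongr))
    calc |√(1 + ‖y‖ ^ 2) * β j y + matCLM A (x - y) j * h y|
        ≤ √(1 + ‖y‖ ^ 2) * |β j y| + |matCLM A (x - y) j| * |h y| := by
          refine (abs_add_le _ _).trans ?_
          rw [abs_mul, abs_mul, abs_of_nonneg (Real.sqrt_nonneg _)]
      _ ≤ √(1 + ‖x‖ ^ 2) * 2 * |β j y| + √(1 + ‖x‖ ^ 2) * (‖matCLM A‖ * ζ.rOut) * |h y| := by
          gcongr
          have : 0 ≤ ‖matCLM A‖ * ζ.rOut := (abs_nonneg _).trans hA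
          nlinarith
      _ = _ := by ring
  · have : ζ.normed volume (x - y) = 0 := by
      rw [← Function.notMem_support, ζ.support_normed_eq]
      simpa using hy
    rw [this]; simp

/-- `β'` is obtained by solving the equation for it. The factor 8 = 2 · 2² only enlarges the final
constant, while the term with `h` carries `rOut ^ 2` and vanishes in the limit. -/
lemma IsWeakPair.isSmoothPair_mollify {A : Matrix (Fin d) (Fin d) ℝ} {h : E d → ℝ}
    {β : Fin d → E d → ℝ} (H : IsWeakPair A h β) (ζ : ContDiffBump (0 : E d)) (hζ : ζ.rOut ≤ 1) :
    ∃ β' : Fin d → E d → ℝ, IsSmoothPair A (mollify ζ h) β' ∧ ∀ j, ∫ ξ, β' j ξ ^ 2 ≤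
      8 * (∫ ξ, β j ξ ^ 2) + 2 * (‖matCLM A‖ * ζ.rOut) ^ 2 * ∫ ξ, h ξ ^ 2 := by
  have hloc : LocallyIntegrable h := H.memLp.locallyIntegrable (by norm_num)
  have hC := contDiff_mollify ζ hloc
  have hCc := hC.continuous
  have hDc : Continuous (fderiv ℝ (mollify ζ h)) := hC.continuous_fderiv (by norm_num)
  set β' : Fin d → E d → ℝ := fun j ξ =>
    (fderiv ℝ (mollify ζ h) ξ (basisVec j) + matCLM A ξ j * mollify ζ h ξ) / √(1 + ‖ξ‖ ^ 2)
    with hβ'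
  have hs : ∀ ξ : E d, 0 < √(1 + ‖ξ‖ ^ 2) := fun ξ => Real.sqrt_pos.2 (by positivity)
  set b : Fin d → E d → ℝ := fun j y => 2 * |β j y| + ‖matCLM A‖ * ζ.rOut * |h y| with hb
  have hbL : ∀ j, MemLp (b j) 2 := fun j =>
    ((H.memLp_right j).norm.const_mul 2).add (H.memLp.norm.const_mul _)
  have hle : ∀ j ξ, |β' j ξ| ≤ mollify ζ (b j) ξ := fun j ξ => by
    rw [hβ', abs_div, abs_of_pos (hs ξ), div_le_iff₀ (hs ξ), mul_comm _ (√(1 + ‖ξ‖ ^ 2))]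
    exact H.abs_fderiv_mollify_add_le ζ hζ ξ j
  have hβc : ∀ j, Continuous (β' j) := fun j => by
    have : ∀ ξ : E d, √(1 + ‖ξ‖ ^ 2) ≠ 0 := fun ξ => (hs ξ).ne'
    simp only [hβ']
    fun_prop (disch := exact this _)
  have hβL : ∀ j, MemLp (β' j) 2 := fun j =>
    (memLp_mollify ζ (hbL j)).of_le (hβc j).aestronglyMeasurable
      (ae_of_all _ fun ξ => (hle j ξ).trans (le_abs_self _))
  refine ⟨β', ⟨hC, memLp_mollify ζ H.memLp, hβL, fun ξ j => ?_⟩, fun j => ?_⟩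
  · simp only [hβ']
    rw [mul_div_cancel₀ _ (hs ξ).ne']
    ring
  · calc ∫ ξ, β' j ξ ^ 2 ≤ ∫ ξ, mollify ζ (b j) ξ ^ 2 := by
          refine integral_mono (hβL j).integrable_sq (memLp_mollify ζ (hbL j)).integrable_sq ?_
          intro ξ
          change β' j ξ ^ 2 ≤ mollify ζ (b j) ξ ^ 2
          rw [← sq_abs]
          have := hle j ξ
          gcongr
      _ ≤ ∫ ξ, b j ξ ^ 2 := integral_sq_mollify_le ζ (hbL j)
      _ ≤ ∫ ξ, (8 * β j ξ ^ 2 + 2 * (‖matCLM A‖ * ζ.rOut) ^ 2 * h ξ ^ 2) := by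
          refine integral_mono (hbL j).integrable_sq
            (((H.memLp_right j).integrable_sq.const_mul _).add
              (H.memLp.integrable_sq.const_mul _)) ?_
          intro ξ
          simp only [hb]
          rw [← sq_abs (β j ξ), ← sq_abs (h ξ)]
          nlinarith [sq_nonneg (2 * |β j ξ| - ‖matCLM A‖ * ζ.rOut * |h ξ|)]
      _ = _ := by
          rw [integral_add ((H.memLp_right j).integrable_sq.const_mul _)
              (H.memLp.integrable_sq.const_mul _), integral_const_mul, integral_const_mul]

/-- A sequence of bump functions shrinking to the origin. -/
def bumpSeq (d : ℕ) (n : ℕ) : ContDiffBump (0 : E d) where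
  rIn := 1 / (2 * (n + 1))
  rOut := 1 / (n + 1)
  rIn_pos := by positivity
  rIn_lt_rOut := by
    have : (0 : ℝ) < n + 1 := by positivity
    rw [div_lt_div_iff_of_pos_left one_pos (by positivity) this]
    linarith

lemma bumpSeq_rOut_le (n : ℕ) : (bumpSeq d n).rOut ≤ 1 := by
  change 1 / ((n : ℝ) + 1) ≤ 1
  rw [div_le_one (by positivity)]
  linarith [Nat.cast_nonneg (α := ℝ) n]

lemma tendsto_bumpSeq_rOut : Filter.Tendsto (fun n => (bumpSeq d n).rOut) Filter.atTop (𝓝 0) :=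
  tendsto_one_div_add_atTop_nhds_zero_nat

lemma ae_tendsto_mollify {b : E d → ℝ} (hb : LocallyIntegrable b) :
    ∀ᵐ x, Filter.Tendsto (fun n => mollify (bumpSeq d n) b x) Filter.atTop (𝓝 (b x)) := by
  refine ContDiffBump.ae_convolution_tendsto_right_of_locallyIntegrable (K := 2)
    tendsto_bumpSeq_rOut (Filter.Eventually.of_forall fun n => ?_) hb
  change 1 / ((n : ℝ) + 1) ≤ 2 * (1 / (2 * (n + 1)))
  apply le_of_eq; field_simp

/-- The coefficients are bounded because both the mollifications and their distances to t n G are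
bounded in L². A subsequence of them converges, and Fatou's lemma passes to the limit along it. -/
lemma exists_limit_of_smooth {A : Matrix (Fin d) (Fin d) ℝ} (hA : A.PosDef) {h : E d → ℝ}
    (hh : MemLp h 2) {t e : ℕ → ℝ} {e₀ : ℝ}
    (ht : ∀ n, ∫ ξ, (mollify (bumpSeq d n) h ξ - t n * gaussian A ξ) ^ 2 ≤ e n)
    (he : Filter.Tendsto e Filter.atTop (𝓝 e₀)) :
    ∃ t₀ : ℝ, ∫ ξ, (h ξ - t₀ * gaussian A ξ) ^ 2 ≤ e₀ := by
  have hG := memLp_gaussian hA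
  have hGpos : 0 < ∫ ξ, gaussian A ξ ^ 2 := by
    refine integral_pos_of_integrable_nonneg_nonzero (x := 0)
      ((contDiff_gaussian (n := 0) A).continuous.pow 2) hG.integrable_sq
      (fun _ => sq_nonneg _) (pow_ne_zero 2 (gaussian_pos A 0).ne')
  have hm : ∀ n, MemLp (mollify (bumpSeq d n) h) 2 := fun n => memLp_mollify _ hh
  have hdiff : ∀ n, MemLp (fun ξ => mollify (bumpSeq d n) h ξ - t n * gaussian A ξ) 2 := fun n =>
    (hm n).sub (hG.const_mul _)
  obtain ⟨M, hM⟩ := he.bddAbove_range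
  have hbound : ∀ n, t n ^ 2 * ∫ ξ, gaussian A ξ ^ 2 ≤ 2 * M + 2 * ∫ ξ, h ξ ^ 2 := by
    intro n
    rw [← integral_const_mul]
    calc ∫ ξ, t n ^ 2 * gaussian A ξ ^ 2 ≤
        ∫ ξ, (2 * (mollify (bumpSeq d n) h ξ - t n * gaussian A ξ) ^ 2 +
          2 * mollify (bumpSeq d n) h ξ ^ 2) := by
          refine integral_mono (hG.integrable_sq.const_mul _)
            (((hdiff n).integrable_sq.const_mul _).add ((hm n).integrable_sq.const_mul _)) ?_
          intro ξ
          dsimp only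
          nlinarith [sq_nonneg (2 * mollify (bumpSeq d n) h ξ - t n * gaussian A ξ)]
      _ ≤ _ := by
          rw [integral_add ((hdiff n).integrable_sq.const_mul _) ((hm n).integrable_sq.const_mul _),
            integral_const_mul, integral_const_mul]
          have h1 := ht n
          have h2 := integral_sq_mollify_le (bumpSeq d n) hh
          have h3 : e n ≤ M := hM ⟨n, rfl⟩
          linarith
  set T := √((2 * M + 2 * ∫ ξ, h ξ ^ 2) / ∫ ξ, gaussian A ξ ^ 2) with hT
  have htT : ∀ n, t n ∈ Metric.closedBall (0 : ℝ) T := fun n => by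
    rw [mem_closedBall_zero_iff, Real.norm_eq_abs]
    apply Real.abs_le_sqrt
    rw [le_div_iff₀ hGpos]
    exact hbound n
  obtain ⟨t₀, -, φ, hφ, hlim⟩ := tendsto_subseq_of_bounded Metric.isBounded_closedBall htT
  refine ⟨t₀, ?_⟩
  have hc : ∀ n, Continuous (mollify (bumpSeq d n) h) := fun n =>
    (contDiff_mollify _ (hh.locallyIntegrable (by norm_num))).continuous
  have hGc := (contDiff_gaussian (n := 0) A).continuous
  have h0 : MemLp (fun ξ => h ξ - t₀ * gaussian A ξ) 2 := hh.sub (hG.const_mul _)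
  have hfatou : ∫⁻ ξ, ENNReal.ofReal ((h ξ - t₀ * gaussian A ξ) ^ 2) ≤ ENNReal.ofReal e₀ := by
    have hae : ∀ᵐ ξ, ENNReal.ofReal ((h ξ - t₀ * gaussian A ξ) ^ 2) =
        Filter.liminf (fun n => ENNReal.ofReal
          ((mollify (bumpSeq d (φ n)) h ξ - t (φ n) * gaussian A ξ) ^ 2)) Filter.atTop := by
      filter_upwards [ae_tendsto_mollify (hh.locallyIntegrable (by norm_num))] with ξ hξ
      have h1 := hξ.comp hφ.tendsto_atTop
      have h2 := ((h1.sub (hlim.mul_const (gaussian A ξ))).pow 2)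
      exact ((ENNReal.continuous_ofReal.tendsto _).comp h2).liminf_eq.symm
    rw [lintegral_congr_ae hae]
    refine (lintegral_liminf_le fun n => ?_).trans ?_
    · have := hc (φ n)
      exact (ENNReal.continuous_ofReal.comp (by fun_prop : Continuous fun ξ =>
        (mollify (bumpSeq d (φ n)) h ξ - t (φ n) * gaussian A ξ) ^ 2)).measurable
    · have hlim2 : Filter.Tendsto (fun n => ENNReal.ofReal (e (φ n))) Filter.atTop
          (𝓝 (ENNReal.ofReal e₀)) :=
        (ENNReal.continuous_ofReal.tendsto _).comp (he.comp hφ.tendsto_atTop)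
      rw [← hlim2.liminf_eq]
      refine Filter.liminf_le_liminf (Filter.Eventually.of_forall fun n => ?_)
      rw [← ofReal_integral_eq_lintegral_ofReal (hdiff (φ n)).integrable_sq
        (ae_of_all _ fun _ => sq_nonneg _)]
      exact ENNReal.ofReal_le_ofReal (ht (φ n))
  rw [← ofReal_integral_eq_lintegral_ofReal h0.integrable_sq (ae_of_all _ fun _ => sq_nonneg _)]
    at hfatou
  have he0 : 0 ≤ e₀ := ge_of_tendsto' he fun n =>
    (integral_nonneg fun _ => sq_nonneg _).trans (ht n)
  exact (ENNReal.ofReal_le_ofReal_iff he0).1 hfatou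

/-- The weighted Poincaré inequality in the weak formulation. -/
theorem weak_inequality {A : Matrix (Fin d) (Fin d) ℝ} (hA : A.PosDef) :
    ∃ C : ℝ, 0 < C ∧ ∀ h β, IsWeakPair A h β →
      ∃ t : ℝ, ∫ ξ, (h ξ - t * gaussian A ξ) ^ 2 ≤ C * ∑ j, ∫ ξ, β j ξ ^ 2 := by
  obtain ⟨C, hC, hsm⟩ := smooth_inequality hA
  refine ⟨C * 8, by positivity, fun h β H => ?_⟩
  have key : ∀ n, ∃ t : ℝ, ∫ ξ, (mollify (bumpSeq d n) h ξ - t * gaussian A ξ) ^ 2 ≤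
      C * ∑ j, (8 * (∫ ξ, β j ξ ^ 2) +
        2 * (‖matCLM A‖ * (bumpSeq d n).rOut) ^ 2 * ∫ ξ, h ξ ^ 2) := by
    intro n
    obtain ⟨β', hpair, hβ'⟩ := H.isSmoothPair_mollify (bumpSeq d n) (bumpSeq_rOut_le n)
    obtain ⟨t, ht⟩ := hsm _ _ hpair
    refine ⟨t, ht.trans ?_⟩
    gcongr with j
    exact hβ' j
  choose t ht using key
  refine exists_limit_of_smooth hA H.memLp ht ?_
  have hlim : ∀ j : Fin d, Filter.Tendsto (fun n => 8 * (∫ ξ, β j ξ ^ 2) +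
      2 * (‖matCLM A‖ * (bumpSeq d n).rOut) ^ 2 * ∫ ξ, h ξ ^ 2) Filter.atTop
      (𝓝 (8 * (∫ ξ, β j ξ ^ 2) + 2 * (‖matCLM A‖ * 0) ^ 2 * ∫ ξ, h ξ ^ 2)) := fun j =>
    ((((tendsto_bumpSeq_rOut.const_mul _).pow 2).const_mul 2).mul_const _).const_add _
  have := (tendsto_finsetSum Finset.univ fun j _ => hlim j).const_mul C
  refine this.congr' (by rfl) |>.trans_eq ?_
  congr 1
  simp only [mul_zero, ne_eq, OfNat.ofNat_ne_zero, not_false_eq_true, zero_pow, zero_mul, add_zero]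
  rw [← Finset.mul_sum]; ring

/-! ### Square integrable functions -/

/-- The space `L²(ℝᵈ; ℂ)`. -/
abbrev L2 (d : ℕ) : Type := Lp ℂ 2 (volume : Measure (E d))

lemma norm_sq_eq_integral (f : L2 d) : ‖f‖ ^ 2 = ∫ x, ‖f x‖ ^ 2 := by
  have h := @inner_self_eq_norm_sq ℂ (L2 d) _ _ _ f
  rw [← h, L2.inner_def, ← integral_re (L2.integrable_inner f f)]
  congr 1 with x
  simp only [inner_self_eq_norm_sq_to_K, Complex.coe_algebraMap, RCLike.re_to_complex]
  rw [← Complex.ofReal_pow, Complex.ofReal_re]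

lemma integral_congr_norm_sq {f : E d → ℂ} (hf : MemLp f 2) :
    ∫ x, ‖f x‖ ^ 2 = ‖hf.toLp‖ ^ 2 := by
  rw [norm_sq_eq_integral]
  refine integral_congr_ae ?_
  filter_upwards [hf.coeFn_toLp] with x hx
  rw [hx]

lemma integrable_mul_L2 (φ : 𝓢(E d, ℂ)) (f : L2 d) : Integrable fun x => φ x * f x :=
  (φ.memLp 2).integrable_mul (Lp.memLp f)

/-! ### The representatives of elements of Sobolev spaces -/

lemma besselRep_spec {s : ℝ} {u : 𝓢'(E d, ℂ)} (hu : MemSobolev s 2 u) :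
    besselPotential (E d) ℂ s u = (besselRep s u : 𝓢'(E d, ℂ)) := by
  rw [besselRep, dif_pos hu]; exact hu.choose_spec

lemma toTemperedDistribution_injective {f g : L2 d} (h : (f : 𝓢'(E d, ℂ)) = (g : 𝓢'(E d, ℂ))) :
    f = g := by
  have hk := Lp.ker_toTemperedDistributionCLM_eq_bot (F := ℂ) (p := 2)
    (μ := (volume : Measure (E d)))
  have : f - g ∈ (Lp.toTemperedDistributionCLM ℂ (volume : Measure (E d)) 2).ker := by
    rw [LinearMap.mem_ker]
    change Lp.toTemperedDistributionCLM ℂ (volume : Measure (E d)) 2 (f - g) = 0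
    rw [map_sub, sub_eq_zero]
    exact h
  rw [hk, Submodule.mem_bot, sub_eq_zero] at this
  exact this

lemma besselRep_eq {s : ℝ} {u : 𝓢'(E d, ℂ)} {f : L2 d}
    (h : besselPotential (E d) ℂ s u = (f : 𝓢'(E d, ℂ))) :
    MemSobolev s 2 u ∧ besselRep s u = f := by
  have hu : MemSobolev s 2 u := ⟨f, h⟩
  exact ⟨hu, toTemperedDistribution_injective ((besselRep_spec hu).symm.trans h)⟩

lemma besselRep_add {s : ℝ} {u v : 𝓢'(E d, ℂ)} (hu : MemSobolev s 2 u) (hv : MemSobolev s 2 v) :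
    besselRep s (u + v) = besselRep s u + besselRep s v := by
  refine (besselRep_eq ?_).2
  rw [map_add, besselRep_spec hu, besselRep_spec hv]
  exact (map_add (Lp.toTemperedDistributionCLM ℂ (volume : Measure (E d)) 2) _ _).symm

lemma besselRep_sub {s : ℝ} {u v : 𝓢'(E d, ℂ)} (hu : MemSobolev s 2 u) (hv : MemSobolev s 2 v) :
    besselRep s (u - v) = besselRep s u - besselRep s v := by
  refine (besselRep_eq ?_).2
  rw [map_sub, besselRep_spec hu, besselRep_spec hv]
  exact (map_sub (Lp.toTemperedDistributionCLM ℂ (volume : Measure (E d)) 2) _ _).symm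

lemma besselRep_smul {s : ℝ} (c : ℂ) {u : 𝓢'(E d, ℂ)} (hu : MemSobolev s 2 u) :
    besselRep s (c • u) = c • besselRep s u := by
  refine (besselRep_eq ?_).2
  rw [map_smul, besselRep_spec hu]
  exact (map_smul (Lp.toTemperedDistributionCLM ℂ (volume : Measure (E d)) 2) _ _).symm

lemma sobolevNorm_of_mem {s : ℝ} {u : 𝓢'(E d, ℂ)} (hu : MemSobolev s 2 u) :
    sobolevNorm s u = ‖besselRep s u‖ₑ := by
  rw [sobolevNorm, if_pos hu]

/-- The Fourier transform of the representative, `(1 + |ξ|²) ^ (s / 2) û`. -/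
def fourierRep (s : ℝ) (u : 𝓢'(E d, ℂ)) : L2 d := 𝓕 (besselRep s u)

lemma norm_fourierRep (s : ℝ) (u : 𝓢'(E d, ℂ)) : ‖fourierRep s u‖ = ‖besselRep s u‖ :=
  Lp.norm_fourier_eq _

lemma fourier_besselPotential_apply (s : ℝ) (f : L2 d) (φ : 𝓢(E d, ℂ)) :
    𝓕 (besselPotential (E d) ℂ s (f : 𝓢'(E d, ℂ))) φ =
      ∫ ξ, φ ξ * ((((1 + ‖ξ‖ ^ 2) ^ (s / 2) : ℝ) : ℂ) * (𝓕 f : L2 d) ξ) := by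
  rw [fourier_besselPotential_eq_smulLeftCLM_fourier_apply, smulLeftCLM_apply_apply,
    Lp.fourier_toTemperedDistribution_eq, Lp.toTemperedDistribution_apply]
  congr 1 with ξ
  rw [SchwartzMap.smulLeftCLM_apply_apply (by fun_prop)]
  simp only [smul_eq_mul]
  ring

lemma fourier_apply_eq_integral {s : ℝ} {u : 𝓢'(E d, ℂ)} (hu : MemSobolev s 2 u)
    (φ : 𝓢(E d, ℂ)) :
    𝓕 u φ = ∫ ξ, φ ξ * ((((1 + ‖ξ‖ ^ 2) ^ (-s / 2) : ℝ) : ℂ) * fourierRep s u ξ) := by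
  have h : u = besselPotential (E d) ℂ (-s) (besselRep s u : 𝓢'(E d, ℂ)) :=
    ((besselPotential_neg_apply_eq_iff s _ u).2 (besselRep_spec hu)).symm
  conv_lhs => rw [h]
  rw [fourier_besselPotential_apply]
  rfl

/-- An element of `Hˢ` with prescribed Fourier transform. -/
lemma exists_fourierRep_eq (s : ℝ) (f : L2 d) :
    ∃ u : 𝓢'(E d, ℂ), MemSobolev s 2 u ∧ fourierRep s u = f := by
  refine ⟨besselPotential (E d) ℂ (-s) ((𝓕⁻ f : L2 d) : 𝓢'(E d, ℂ)), ?_⟩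
  obtain ⟨h1, h2⟩ := besselRep_eq (s := s)
    (u := besselPotential (E d) ℂ (-s) ((𝓕⁻ f : L2 d) : 𝓢'(E d, ℂ))) (f := 𝓕⁻ f) (by simp)
  refine ⟨h1, ?_⟩
  rw [fourierRep, h2, fourier_fourierInv_eq]

lemma eq_of_fourier_apply_eq {u v : 𝓢'(E d, ℂ)} (h : ∀ φ, 𝓕 u φ = 𝓕 v φ) : u = v := by
  have : 𝓕 u = 𝓕 v := by ext φ; exact h φ
  have h2 := congrArg (fun T : 𝓢'(E d, ℂ) => (𝓕⁻ T : 𝓢'(E d, ℂ))) this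
  simpa using h2

/-! ### The weighted gradient in Fourier space -/

/-- `u = ∇w + ½ w S⁻¹ (x - μ)` in the sense of distributions. -/
def IsGroundStateGradient (S : Matrix (Fin d) (Fin d) ℝ) (μ : E d) (w : L2 d)
    (u : Fin d → 𝓢'(E d, ℂ)) : Prop :=
  ∀ i (φ : 𝓢(E d, ℂ)), u i φ =
    -∫ x, w x * (∂_{(basisVec i : E d)} φ x - ((matCLM S⁻¹ (x - μ) i / 2 : ℝ) : ℂ) * φ x)

lemma integral_mul_fourier (w : L2 d) (χ : 𝓢(E d, ℂ)) :
    ∫ x, w x * (𝓕 χ : 𝓢(E d, ℂ)) x = ∫ ξ, (𝓕 w : L2 d) ξ * χ ξ := by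
  have h : 𝓕 (w : 𝓢'(E d, ℂ)) χ = ((𝓕 w : L2 d) : 𝓢'(E d, ℂ)) χ := by
    rw [Lp.fourier_toTemperedDistribution_eq]
  rw [TemperedDistribution.fourier_apply, Lp.toTemperedDistribution_apply,
    Lp.toTemperedDistribution_apply] at h
  simpa only [smul_eq_mul, mul_comm] using h

lemma smulLeft_inner_apply (φ : 𝓢(E d, ℂ)) (j : Fin d) (ξ : E d) :
    SchwartzMap.smulLeftCLM ℂ (fun x : E d => inner ℝ x (basisVec j)) φ ξ = (ξ j : ℂ) * φ ξ := by
  rw [SchwartzMap.smulLeftCLM_apply_apply (by fun_prop), inner_basisVec]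
  simp

lemma lineDeriv_fourier_apply (φ : 𝓢(E d, ℂ)) (i : Fin d) :
    ∂_{(basisVec i : E d)} (𝓕 φ : 𝓢(E d, ℂ)) = 𝓕 (-(2 * Real.pi * Complex.I) •
      SchwartzMap.smulLeftCLM ℂ (fun x : E d => inner ℝ x (basisVec i)) φ) :=
  SchwartzMap.lineDerivOp_fourier_eq φ _

lemma coord_mul_fourier (φ : 𝓢(E d, ℂ)) (j : Fin d) (x : E d) :
    (x j : ℂ) * (𝓕 φ : 𝓢(E d, ℂ)) x =
      (𝓕 ((2 * Real.pi * Complex.I)⁻¹ • ∂_{(basisVec j : E d)} φ) : 𝓢(E d, ℂ)) x := by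
  have h := SchwartzMap.fourier_lineDerivOp_eq φ (basisVec j : E d)
  rw [fourier_smul, h, smul_smul, inv_mul_cancel₀, one_smul, smulLeft_inner_apply]
  simp [Real.pi_ne_zero]

/-- The weak form of û_i = 2πi ξ_i ŵ - ½ Σⱼ S⁻¹ᵢⱼ ((2πi)⁻¹ ∂ⱼŵ + μⱼ ŵ). The derivative stays on the
test function because ŵ is only known to be square integrable. -/
lemma IsGroundStateGradient.fourier_eq {S : Matrix (Fin d) (Fin d) ℝ} {μ : E d} {w : L2 d}
    {u : Fin d → 𝓢'(E d, ℂ)} (H : IsGroundStateGradient S μ w u) (i : Fin d) (φ : 𝓢(E d, ℂ)) :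
    𝓕 (u i) φ = 2 * Real.pi * Complex.I * (∫ ξ, (𝓕 w : L2 d) ξ * ((ξ i : ℂ) * φ ξ)) +
      ∑ j, (S⁻¹ i j / 2 : ℂ) * ((2 * Real.pi * Complex.I)⁻¹ *
        (∫ ξ, (𝓕 w : L2 d) ξ * ∂_{(basisVec j : E d)} φ ξ) -
          (μ j : ℂ) * ∫ ξ, (𝓕 w : L2 d) ξ * φ ξ) := by
  have hI : ∀ ψ : 𝓢(E d, ℂ), Integrable fun x => w x * ψ x := fun ψ => by
    simpa only [mul_comm] using integrable_mul_L2 ψ w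
  have hpt : ∀ x, w x * (∂_{(basisVec i : E d)} (𝓕 φ : 𝓢(E d, ℂ)) x -
      ((matCLM S⁻¹ (x - μ) i / 2 : ℝ) : ℂ) * (𝓕 φ : 𝓢(E d, ℂ)) x) =
      w x * (∂_{(basisVec i : E d)} (𝓕 φ : 𝓢(E d, ℂ)) x) -
      ∑ j, (S⁻¹ i j / 2 : ℂ) * (w x * (𝓕 ((2 * Real.pi * Complex.I)⁻¹ •
        ∂_{(basisVec j : E d)} φ) : 𝓢(E d, ℂ)) x - (μ j : ℂ) * (w x * (𝓕 φ : 𝓢(E d, ℂ)) x)) := by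
    intro x
    simp_rw [← coord_mul_fourier]
    have : ((matCLM S⁻¹ (x - μ) i / 2 : ℝ) : ℂ) =
        ∑ j, (S⁻¹ i j / 2 : ℂ) * ((x j : ℂ) - (μ j : ℂ)) := by
      rw [matCLM_apply]
      simp only [Matrix.mulVec, dotProduct]
      push_cast
      rw [Finset.sum_div]
      refine Finset.sum_congr rfl fun j _ => ?_
      simp only [PiLp.sub_apply]
      push_cast
      ring
    rw [this, mul_sub, Finset.sum_mul, Finset.mul_sum]
    congr 1
    refine Finset.sum_congr rfl fun j _ => ?_
    ring
  rw [TemperedDistribution.fourier_apply, H i]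
  simp_rw [hpt]
  rw [integral_sub (hI _), integral_finsetSum]
  · simp_rw [integral_const_mul]
    have hs : ∀ j : Fin d, ∫ x, (w x * (𝓕 ((2 * Real.pi * Complex.I)⁻¹ •
        ∂_{(basisVec j : E d)} φ) : 𝓢(E d, ℂ)) x - (μ j : ℂ) * (w x * (𝓕 φ : 𝓢(E d, ℂ)) x)) =
        (2 * Real.pi * Complex.I)⁻¹ * (∫ ξ, (𝓕 w : L2 d) ξ * ∂_{(basisVec j : E d)} φ ξ) -
          (μ j : ℂ) * ∫ ξ, (𝓕 w : L2 d) ξ * φ ξ := fun j => by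
      have he : ∀ ξ, (𝓕 w : L2 d) ξ * ((2 * Real.pi * Complex.I)⁻¹ •
          ∂_{(basisVec j : E d)} φ) ξ =
          (2 * Real.pi * Complex.I)⁻¹ * ((𝓕 w : L2 d) ξ * ∂_{(basisVec j : E d)} φ ξ) := fun ξ => by
        simp only [_root_.smul_apply, smul_eq_mul]
        ring
      rw [integral_sub (hI _) ((hI _).const_mul _), integral_const_mul, integral_mul_fourier,
        integral_mul_fourier]
      simp_rw [he, integral_const_mul]
    simp_rw [hs]
    rw [lineDeriv_fourier_apply, integral_mul_fourier, ← integral_const_mul]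
    have he : ∀ ξ, (𝓕 w : L2 d) ξ * ((-(2 * Real.pi * Complex.I) •
        SchwartzMap.smulLeftCLM ℂ (fun x : E d => inner ℝ x (basisVec i)) φ) ξ) =
        -(2 * Real.pi * Complex.I * ((𝓕 w : L2 d) ξ * ((ξ i : ℂ) * φ ξ))) := fun ξ => by
      rw [_root_.smul_apply, smulLeft_inner_apply]
      simp only [smul_eq_mul]
      ring
    simp_rw [he]
    rw [integral_neg]
    ring
  · intro j _
    exact ((hI _).sub ((hI _).const_mul _)).const_mul _
  · exact integrable_finsetSum _ fun j _ => ((hI _).sub ((hI _).const_mul _)).const_mul _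

/-! ### Modulation -/

/-- The character `e^{2πi μ·ξ}`. -/
def phase (μ ξ : E d) : ℂ := Complex.exp (((2 * Real.pi * inner ℝ μ ξ : ℝ) : ℂ) * Complex.I)

lemma norm_phase (μ ξ : E d) : ‖phase μ ξ‖ = 1 := Complex.norm_exp_ofReal_mul_I _

lemma contDiff_phase (μ : E d) {n : WithTop ℕ∞} : ContDiff ℝ n (phase μ) := by
  have h1 : ContDiff ℝ n fun ξ : E d => 2 * Real.pi * inner ℝ μ ξ :=
    contDiff_const.mul (contDiff_const.inner ℝ contDiff_id)
  exact ((Complex.ofRealCLM.contDiff.comp h1).mul contDiff_const).cexp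

lemma fderiv_phase_mul (μ : E d) {χ : E d → ℝ} (hχ : Differentiable ℝ χ) (ξ : E d) (j : Fin d) :
    fderiv ℝ (fun ξ => phase μ ξ * (χ ξ : ℂ)) ξ (basisVec j) =
      phase μ ξ * ((fderiv ℝ χ ξ (basisVec j) : ℂ) +
        2 * Real.pi * Complex.I * (μ j : ℂ) * (χ ξ : ℂ)) := by
  have h1 : HasFDerivAt (fun ξ : E d => 2 * Real.pi * inner ℝ μ ξ)
      ((2 * Real.pi) • innerSL ℝ μ) ξ := (innerSL ℝ μ).hasFDerivAt.const_mul _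
  have h2 : HasFDerivAt (phase μ) _ ξ :=
    ((Complex.ofRealCLM.hasFDerivAt.comp ξ h1).mul_const Complex.I).cexp
  have h3 := h2.fun_mul (Complex.ofRealCLM.hasFDerivAt.comp ξ (hχ ξ).hasFDerivAt)
  have h4 : fderiv ℝ (fun ξ => phase μ ξ * (χ ξ : ℂ)) ξ = _ := h3.fderiv
  rw [h4]
  have h5 : Complex.exp (↑(2 * Real.pi * inner ℝ μ ξ) * Complex.I) = phase μ ξ := rfl
  simp [inner_basisVec]
  simp only [phase]
  push_cast
  ring

lemma integrable_mul_L2_of_compact {ψ : E d → ℂ} (hψ : Continuous ψ) (hs : HasCompactSupport ψ)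
    {f : E d → ℂ} (hf : MemLp f 2) : Integrable fun ξ => ψ ξ * f ξ :=
  (hψ.memLp_of_hasCompactSupport (p := 2) hs).integrable_mul hf

/-- The Fourier transform of `w` in the coordinates centred at `μ`. -/
def modulated (μ : E d) (f : L2 d) (ξ : E d) : ℂ := phase μ ξ * f ξ

lemma memLp_modulated (μ : E d) (f : L2 d) : MemLp (modulated μ f) 2 := by
  refine (Lp.memLp f).of_le ?_ (ae_of_all _ fun ξ => ?_)
  · exact (contDiff_phase (n := 0) μ).continuous.aestronglyMeasurable.mul
      (Lp.aestronglyMeasurable f)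
  · rw [modulated, norm_mul, norm_phase, one_mul]

/-- The right hand side of the equation satisfied by the modulated Fourier transform. -/
def modulatedSource (S : Matrix (Fin d) (Fin d) ℝ) (μ : E d) (β : Fin d → L2 d) (k : Fin d)
    (ξ : E d) : ℂ :=
  -(4 * Real.pi * Complex.I) * ∑ i, (S k i : ℂ) * modulated μ (β i) ξ

lemma memLp_modulatedSource (S : Matrix (Fin d) (Fin d) ℝ) (μ : E d) (β : Fin d → L2 d)
    (k : Fin d) : MemLp (modulatedSource S μ β k) 2 :=
  (memLp_finsetSum _ fun i _ => (memLp_modulated μ (β i)).const_mul (S k i : ℂ)).const_mul _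

/-- Testing with e^{2πi μ·ξ} χ instead of χ, the derivative of the phase produces exactly the term
that cancels μⱼ ŵ. From here on μ enters only through the modulation, which preserves norms. -/
lemma IsGroundStateGradient.modulated_eq {S : Matrix (Fin d) (Fin d) ℝ} {μ : E d} {w : L2 d}
    {u : Fin d → 𝓢'(E d, ℂ)} (H : IsGroundStateGradient S μ w u)
    (hu : ∀ i, MemSobolev (-1) 2 (u i)) (i : Fin d) {χ : E d → ℝ}
    (hχ : ContDiff ℝ (⊤ : ℕ∞) χ) (hs : HasCompactSupport χ) :
    ∫ ξ, (χ ξ : ℂ) * ((√(1 + ‖ξ‖ ^ 2) : ℂ) * modulated μ (fourierRep (-1) (u i)) ξ) =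
      2 * Real.pi * Complex.I * (∫ ξ, modulated μ (𝓕 w) ξ * ((ξ i : ℂ) * χ ξ)) +
      ∑ j, (S⁻¹ i j / 2 : ℂ) * ((2 * Real.pi * Complex.I)⁻¹ *
        ∫ ξ, modulated μ (𝓕 w) ξ * (fderiv ℝ χ ξ (basisVec j) : ℂ)) := by
  have hφs : HasCompactSupport fun ξ => phase μ ξ * (χ ξ : ℂ) :=
    HasCompactSupport.mul_left (hs.comp_left (g := ((↑) : ℝ → ℂ)) Complex.ofReal_zero)
  have hφc : ContDiff ℝ (⊤ : ℕ∞) fun ξ => phase μ ξ * (χ ξ : ℂ) :=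
    (contDiff_phase μ).mul (Complex.ofRealCLM.contDiff.comp hχ)
  set φ : 𝓢(E d, ℂ) := hφs.toSchwartzMap hφc with hφ
  have hφv : ∀ ξ, φ ξ = phase μ ξ * (χ ξ : ℂ) := fun ξ => rfl
  have hφd : ∀ j ξ, ∂_{(basisVec j : E d)} φ ξ = phase μ ξ * ((fderiv ℝ χ ξ (basisVec j) : ℂ) +
        2 * Real.pi * Complex.I * (μ j : ℂ) * (χ ξ : ℂ)) := fun j ξ => by
    rw [SchwartzMap.lineDerivOp_apply_eq_fderiv]
    exact fderiv_phase_mul μ (hχ.differentiable (by simp)) ξ j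
  have h := H.fourier_eq i φ
  rw [fourier_apply_eq_integral (hu i)] at h
  have e1 : ∀ ξ : E d, φ ξ * ((((1 + ‖ξ‖ ^ 2) ^ (-(-1 : ℝ) / 2) : ℝ) : ℂ) *
      fourierRep (-1) (u i) ξ) =
      (χ ξ : ℂ) * ((√(1 + ‖ξ‖ ^ 2) : ℂ) * modulated μ (fourierRep (-1) (u i)) ξ) := fun ξ => by
    rw [hφv, modulated, Real.sqrt_eq_rpow, neg_neg]
    ring
  have e2 : ∀ ξ : E d, (𝓕 w : L2 d) ξ * ((ξ i : ℂ) * φ ξ) =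
      modulated μ (𝓕 w) ξ * ((ξ i : ℂ) * χ ξ) := fun ξ => by
    rw [hφv, modulated]; ring
  simp_rw [e1, e2] at h
  rw [h]
  congr 1
  refine Finset.sum_congr rfl fun j _ => ?_
  congr 1
  have i1 : Integrable fun ξ => modulated μ (𝓕 w) ξ * (fderiv ℝ χ ξ (basisVec j) : ℂ) := by
    have hc : Continuous fun ξ => (fderiv ℝ χ ξ (basisVec j) : ℂ) := by
      have := hχ.continuous_fderiv (by simp)
      fun_prop
    have hs' : HasCompactSupport fun ξ => (fderiv ℝ χ ξ (basisVec j) : ℂ) :=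
      (hs.fderiv_apply (𝕜 := ℝ) (basisVec j)).comp_left (g := ((↑) : ℝ → ℂ)) Complex.ofReal_zero
    simpa only [mul_comm] using integrable_mul_L2_of_compact hc hs' (memLp_modulated μ (𝓕 w))
  have i2 : Integrable fun ξ => (𝓕 w : L2 d) ξ * φ ξ := by
    simpa only [mul_comm] using integrable_mul_L2 φ (𝓕 w)
  have e3 : ∀ ξ, (𝓕 w : L2 d) ξ * ∂_{(basisVec j : E d)} φ ξ =
      modulated μ (𝓕 w) ξ * (fderiv ℝ χ ξ (basisVec j) : ℂ) +
      2 * Real.pi * Complex.I * (μ j : ℂ) * ((𝓕 w : L2 d) ξ * φ ξ) := fun ξ => by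
    rw [hφd, hφv, modulated]; ring
  simp_rw [e3]
  rw [integral_add i1 (i2.const_mul _), integral_const_mul]
  have : (2 * Real.pi * Complex.I : ℂ) ≠ 0 := by simp [Real.pi_ne_zero]
  field_simp
  ring

/-- The factor -4πi S in the source inverts the coefficient ½ S⁻¹ (2πi)⁻¹ of the derivative, up to
sign. Applied to the term 2πi ξ it gives -4πi · 2πi S = 8π² S, the matrix of the drift. -/
lemma IsGroundStateGradient.modulatedSource_eq {S : Matrix (Fin d) (Fin d) ℝ} (hS : S.PosDef)
    {μ : E d} {w : L2 d} {u : Fin d → 𝓢'(E d, ℂ)} (H : IsGroundStateGradient S μ w u)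
    (hu : ∀ i, MemSobolev (-1) 2 (u i)) (k : Fin d) {χ : E d → ℝ}
    (hχ : ContDiff ℝ (⊤ : ℕ∞) χ) (hs : HasCompactSupport χ) :
    ∫ ξ, (χ ξ : ℂ) * ((√(1 + ‖ξ‖ ^ 2) : ℂ) *
        modulatedSource S μ (fun i => fourierRep (-1) (u i)) k ξ) =
      ∫ ξ, modulated μ (𝓕 w) ξ * ((matCLM ((8 * Real.pi ^ 2) • S) ξ k * χ ξ -
        fderiv ℝ χ ξ (basisVec k) : ℝ) : ℂ) := by
  have hsC : HasCompactSupport fun ξ => (χ ξ : ℂ) :=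
    hs.comp_left (g := ((↑) : ℝ → ℂ)) Complex.ofReal_zero
  have hχc : Continuous χ := hχ.continuous
  have hfc : Continuous (fderiv ℝ χ) := hχ.continuous_fderiv (by simp)
  have i1 : ∀ i, Integrable fun ξ => (χ ξ : ℂ) * ((√(1 + ‖ξ‖ ^ 2) : ℂ) *
      modulated μ (fourierRep (-1) (u i)) ξ) := fun i => by
    have hc : Continuous fun ξ => (χ ξ : ℂ) * (√(1 + ‖ξ‖ ^ 2) : ℂ) := by fun_prop
    have := integrable_mul_L2_of_compact hc hsC.mul_right
      (memLp_modulated μ (fourierRep (-1) (u i)))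
    simpa only [mul_assoc] using this
  have i2 : ∀ i : Fin d, Integrable fun ξ => modulated μ (𝓕 w) ξ * ((ξ i : ℂ) * χ ξ) := fun i => by
    have hc : Continuous fun ξ : E d => (ξ i : ℂ) * (χ ξ : ℂ) := by fun_prop
    simpa only [mul_comm] using
      integrable_mul_L2_of_compact hc hsC.mul_left (memLp_modulated μ (𝓕 w))
  have i3 : Integrable fun ξ => modulated μ (𝓕 w) ξ * (fderiv ℝ χ ξ (basisVec k) : ℂ) := by
    have hc : Continuous fun ξ => (fderiv ℝ χ ξ (basisVec k) : ℂ) := by fun_prop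
    have hs' : HasCompactSupport fun ξ => (fderiv ℝ χ ξ (basisVec k) : ℂ) :=
      (hs.fderiv_apply (𝕜 := ℝ) (basisVec k)).comp_left (g := ((↑) : ℝ → ℂ)) Complex.ofReal_zero
    simpa only [mul_comm] using integrable_mul_L2_of_compact hc hs' (memLp_modulated μ (𝓕 w))
  have e1 : ∀ ξ : E d, (χ ξ : ℂ) * ((√(1 + ‖ξ‖ ^ 2) : ℂ) *
      modulatedSource S μ (fun i => fourierRep (-1) (u i)) k ξ) =
      -(4 * Real.pi * Complex.I) * ∑ i, (S k i : ℂ) * ((χ ξ : ℂ) * ((√(1 + ‖ξ‖ ^ 2) : ℂ) *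
        modulated μ (fourierRep (-1) (u i)) ξ)) := fun ξ => by
    rw [modulatedSource, Finset.mul_sum, Finset.mul_sum, Finset.mul_sum, Finset.mul_sum]
    refine Finset.sum_congr rfl fun i _ => ?_
    ring
  have e2 : ∀ ξ : E d, modulated μ (𝓕 w) ξ * ((matCLM ((8 * Real.pi ^ 2) • S) ξ k * χ ξ -
        fderiv ℝ χ ξ (basisVec k) : ℝ) : ℂ) =
      8 * Real.pi ^ 2 * (∑ i, (S k i : ℂ) * (modulated μ (𝓕 w) ξ * ((ξ i : ℂ) * χ ξ))) -
        modulated μ (𝓕 w) ξ * (fderiv ℝ χ ξ (basisVec k) : ℂ) := fun ξ => by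
    have : matCLM ((8 * Real.pi ^ 2) • S) ξ k = 8 * Real.pi ^ 2 * ∑ i, S k i * ξ i := by
      rw [matCLM_apply, Matrix.smul_mulVec]
      rfl
    rw [this]
    push_cast
    rw [mul_sub, Finset.mul_sum, Finset.mul_sum, Finset.sum_mul, Finset.mul_sum]
    congr 1
    refine Finset.sum_congr rfl fun i _ => ?_
    ring
  simp_rw [e1, e2]
  rw [integral_const_mul, integral_finsetSum _ fun i _ => (i1 i).const_mul _, integral_sub
    ((integrable_finsetSum _ fun i _ => (i2 i).const_mul _).const_mul _) i3, integral_const_mul,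
    integral_finsetSum _ fun i _ => (i2 i).const_mul _]
  simp_rw [integral_const_mul, H.modulated_eq hu _ hχ hs]
  set X : Fin d → ℂ := fun i => ∫ ξ, modulated μ (𝓕 w) ξ * ((ξ i : ℂ) * χ ξ)
  set Y : Fin d → ℂ := fun j => ∫ ξ, modulated μ (𝓕 w) ξ * (fderiv ℝ χ ξ (basisVec j) : ℂ)
  have hinv : ∀ j, ∑ i, (S k i : ℂ) * (S⁻¹ i j : ℂ) = if k = j then 1 else 0 := fun j => by
    have h1 : S * S⁻¹ = 1 := Matrix.mul_nonsing_inv _ ((Matrix.isUnit_iff_isUnit_det S).1 hS.isUnit)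
    have h2 := congrFun (congrFun h1 k) j
    rw [Matrix.mul_apply, Matrix.one_apply] at h2
    have h3 := congrArg (fun r : ℝ => (r : ℂ)) h2
    push_cast at h3
    rw [h3]
    split_ifs <;> simp
  have hY : ∑ i, (S k i : ℂ) * ∑ j, (S⁻¹ i j / 2 : ℂ) * ((2 * Real.pi * Complex.I)⁻¹ * Y j) =
      (4 * Real.pi * Complex.I)⁻¹ * Y k := by
    simp_rw [Finset.mul_sum]
    rw [Finset.sum_comm]
    have : ∀ j, ∑ i, (S k i : ℂ) * ((S⁻¹ i j / 2 : ℂ) * ((2 * Real.pi * Complex.I)⁻¹ * Y j)) =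
        (if k = j then 1 else 0) * ((4 * Real.pi * Complex.I)⁻¹ * Y j) := fun j => by
      rw [← hinv j, Finset.sum_mul]
      refine Finset.sum_congr rfl fun i _ => ?_
      have : (4 * Real.pi * Complex.I : ℂ)⁻¹ = (2 * Real.pi * Complex.I)⁻¹ / 2 := by
        rw [show (4 * Real.pi * Complex.I : ℂ) = 2 * (2 * Real.pi * Complex.I) by ring, mul_inv]
        ring
      rw [this]; ring
    simp_rw [this]
    simp
  have hX : ∑ i, (S k i : ℂ) * (2 * Real.pi * Complex.I * X i) =
      2 * Real.pi * Complex.I * ∑ i, (S k i : ℂ) * X i := by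
    rw [Finset.mul_sum]
    refine Finset.sum_congr rfl fun i _ => ?_
    ring
  simp_rw [mul_add]
  rw [Finset.sum_add_distrib, hX, hY]
  have hI : (4 * Real.pi * Complex.I : ℂ) ≠ 0 := by simp [Real.pi_ne_zero]
  change _ = 8 * (Real.pi : ℂ) ^ 2 * (∑ i, (S k i : ℂ) * X i) - Y k
  linear_combination (-8 * (Real.pi : ℂ) ^ 2 * ∑ i, (S k i : ℂ) * X i) * Complex.I_sq -
    Y k * mul_inv_cancel₀ hI

/-- The equation has real coefficients, so real and imaginary parts solve it separately and the real
inequality applies to each. -/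
lemma IsGroundStateGradient.isWeakPair {S : Matrix (Fin d) (Fin d) ℝ} (hS : S.PosDef)
    {μ : E d} {w : L2 d} {u : Fin d → 𝓢'(E d, ℂ)} (H : IsGroundStateGradient S μ w u)
    (hu : ∀ i, MemSobolev (-1) 2 (u i)) :
    IsWeakPair ((8 * Real.pi ^ 2) • S) (fun ξ => (modulated μ (𝓕 w) ξ).re)
      (fun k ξ => (modulatedSource S μ (fun i => fourierRep (-1) (u i)) k ξ).re) ∧
    IsWeakPair ((8 * Real.pi ^ 2) • S) (fun ξ => (modulated μ (𝓕 w) ξ).im)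
      (fun k ξ => (modulatedSource S μ (fun i => fourierRep (-1) (u i)) k ξ).im) := by
  have hL := memLp_modulated μ (𝓕 w)
  have hR := memLp_modulatedSource S μ fun i => fourierRep (-1) (u i)
  have hint : ∀ k (χ : E d → ℝ), ContDiff ℝ (⊤ : ℕ∞) χ → HasCompactSupport χ →
      Integrable (fun ξ => (χ ξ : ℂ) * ((√(1 + ‖ξ‖ ^ 2) : ℂ) *
        modulatedSource S μ (fun i => fourierRep (-1) (u i)) k ξ)) ∧
      Integrable (fun ξ => modulated μ (𝓕 w) ξ * ((matCLM ((8 * Real.pi ^ 2) • S) ξ k * χ ξ -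
        fderiv ℝ χ ξ (basisVec k) : ℝ) : ℂ)) := by
    intro k χ hχ hs
    have hχc : Continuous χ := hχ.continuous
    have hfc : Continuous (fderiv ℝ χ) := hχ.continuous_fderiv (by simp)
    have hsC : HasCompactSupport fun ξ => (χ ξ : ℂ) :=
      hs.comp_left (g := ((↑) : ℝ → ℂ)) Complex.ofReal_zero
    constructor
    · have hc : Continuous fun ξ => (χ ξ : ℂ) * (√(1 + ‖ξ‖ ^ 2) : ℂ) := by fun_prop
      simpa only [mul_assoc] using integrable_mul_L2_of_compact hc hsC.mul_right (hR k)
    · have hc : Continuous fun ξ => ((matCLM ((8 * Real.pi ^ 2) • S) ξ k * χ ξ -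
        fderiv ℝ χ ξ (basisVec k) : ℝ) : ℂ) := by fun_prop
      have hs1 : HasCompactSupport fun ξ => matCLM ((8 * Real.pi ^ 2) • S) ξ k * χ ξ -
          fderiv ℝ χ ξ (basisVec k) :=
        hs.mul_left.sub (hs.fderiv_apply (𝕜 := ℝ) (basisVec k))
      have hs2 : HasCompactSupport fun ξ => ((matCLM ((8 * Real.pi ^ 2) • S) ξ k * χ ξ -
        fderiv ℝ χ ξ (basisVec k) : ℝ) : ℂ) :=
        hs1.comp_left (g := ((↑) : ℝ → ℂ)) Complex.ofReal_zero
      simpa only [mul_comm] using integrable_mul_L2_of_compact hc hs2 hL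
  refine ⟨⟨hL.re, fun k => (hR k).re, fun k χ hχ hs => ?_⟩,
    ⟨hL.im, fun k => (hR k).im, fun k χ hχ hs => ?_⟩⟩
  · obtain ⟨i1, i2⟩ := hint k χ hχ hs
    have h := congrArg Complex.re (H.modulatedSource_eq hS hu k hχ hs)
    have e1 := integral_re i1
    have e2 := integral_re i2
    simp only [RCLike.re_to_complex] at e1 e2
    rw [← e1, ← e2] at h
    simpa only [← Complex.ofReal_mul, Complex.re_ofReal_mul, Complex.re_mul_ofReal] using h
  · obtain ⟨i1, i2⟩ := hint k χ hχ hs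
    have h := congrArg Complex.im (H.modulatedSource_eq hS hu k hχ hs)
    have e1 := integral_im i1
    have e2 := integral_im i2
    simp only [RCLike.im_to_complex] at e1 e2
    rw [← e1, ← e2] at h
    simpa only [← Complex.ofReal_mul, Complex.im_ofReal_mul, Complex.im_mul_ofReal] using h

lemma norm_modulated (μ : E d) (f : L2 d) (ξ : E d) : ‖modulated μ f ξ‖ = ‖f ξ‖ := by
  rw [modulated, norm_mul, norm_phase, one_mul]

lemma sum_integral_modulatedSource_le (S : Matrix (Fin d) (Fin d) ℝ) (μ : E d)
    (β : Fin d → L2 d) :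
    ∑ k, ∫ ξ, ‖modulatedSource S μ β k ξ‖ ^ 2 ≤
      (16 * Real.pi ^ 2 * ∑ k, ∑ i, S k i ^ 2) * ∑ i, ‖β i‖ ^ 2 := by
  have hi : ∀ i, Integrable fun ξ => ‖β i ξ‖ ^ 2 := fun i => (Lp.memLp (β i)).norm.integrable_sq
  have hk : ∀ k, ∫ ξ, ‖modulatedSource S μ β k ξ‖ ^ 2 ≤
      16 * Real.pi ^ 2 * (∑ i, S k i ^ 2) * ∑ i, ‖β i‖ ^ 2 := by
    intro k
    simp_rw [norm_sq_eq_integral]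
    rw [← integral_finsetSum _ fun i _ => hi i, ← integral_const_mul]
    refine integral_mono (memLp_modulatedSource S μ β k).norm.integrable_sq
      ((integrable_finsetSum _ fun i _ => hi i).const_mul _) fun ξ => ?_
    change ‖modulatedSource S μ β k ξ‖ ^ 2 ≤ 16 * Real.pi ^ 2 * (∑ i, S k i ^ 2) * ∑ i, ‖β i ξ‖ ^ 2
    have h1 : ‖modulatedSource S μ β k ξ‖ ≤ 4 * Real.pi * ∑ i, |S k i| * ‖β i ξ‖ := by
      rw [modulatedSource, norm_mul]
      have : ‖(-(4 * Real.pi * Complex.I) : ℂ)‖ = 4 * Real.pi := by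
        simp [abs_of_pos Real.pi_pos]
      rw [this]
      gcongr
      refine (norm_sum_le _ _).trans (le_of_eq ?_)
      refine Finset.sum_congr rfl fun i _ => ?_
      rw [norm_mul, norm_modulated, Complex.norm_real, Real.norm_eq_abs]
    calc ‖modulatedSource S μ β k ξ‖ ^ 2 ≤ (4 * Real.pi * ∑ i, |S k i| * ‖β i ξ‖) ^ 2 := by
          gcongr
      _ = 16 * Real.pi ^ 2 * (∑ i, |S k i| * ‖β i ξ‖) ^ 2 := by ring
      _ ≤ 16 * Real.pi ^ 2 * ((∑ i, |S k i| ^ 2) * ∑ i, ‖β i ξ‖ ^ 2) := by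
          gcongr
          exact Finset.sum_mul_sq_le_sq_mul_sq _ _ _
      _ = _ := by simp_rw [sq_abs]; ring
  calc _ ≤ ∑ k, 16 * Real.pi ^ 2 * (∑ i, S k i ^ 2) * ∑ i, ‖β i‖ ^ 2 :=
        Finset.sum_le_sum fun k _ => hk k
    _ = _ := by rw [← Finset.sum_mul, ← Finset.mul_sum]

lemma posDef_smul_pi {S : Matrix (Fin d) (Fin d) ℝ} (hS : S.PosDef) :
    ((8 * Real.pi ^ 2) • S).PosDef :=
  hS.smul (by positivity)

/-- The Gaussian `e^{-2πi μ·ξ} e^{-4π² ξ·Σξ}`, a multiple of the Fourier transform of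
`e^{-V₀/2}`. -/
def freqGaussian (S : Matrix (Fin d) (Fin d) ℝ) (μ ξ : E d) : ℂ :=
  phase (-μ) ξ * (gaussian ((8 * Real.pi ^ 2) • S) ξ : ℂ)

lemma phase_mul_phase_neg (μ ξ : E d) : phase μ ξ * phase (-μ) ξ = 1 := by
  rw [phase, phase, ← Complex.exp_add]
  simp

lemma phase_mul_freqGaussian (S : Matrix (Fin d) (Fin d) ℝ) (μ ξ : E d) :
    phase μ ξ * freqGaussian S μ ξ = (gaussian ((8 * Real.pi ^ 2) • S) ξ : ℂ) := by
  rw [freqGaussian, ← mul_assoc, phase_mul_phase_neg, one_mul]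

lemma memLp_freqGaussian {S : Matrix (Fin d) (Fin d) ℝ} (hS : S.PosDef) (μ : E d) :
    MemLp (freqGaussian S μ) 2 := by
  refine (memLp_gaussian (posDef_smul_pi hS)).of_le ?_ (ae_of_all _ fun ξ => ?_)
  · have h1 := (contDiff_phase (n := 0) (-μ)).continuous
    have h2 := (contDiff_gaussian (n := 0) ((8 * Real.pi ^ 2) • S)).continuous
    unfold freqGaussian
    exact Continuous.aestronglyMeasurable (by fun_prop)
  · rw [freqGaussian, norm_mul, norm_phase, one_mul, Complex.norm_real]

/-- The spectral gap inequality in Fourier space. -/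
theorem exists_norm_sub_le {S : Matrix (Fin d) (Fin d) ℝ} (hS : S.PosDef) :
    ∃ C : ℝ, 0 < C ∧ ∀ (μ : E d) (w : L2 d) (u : Fin d → 𝓢'(E d, ℂ)),
      IsGroundStateGradient S μ w u → (∀ i, MemSobolev (-1) 2 (u i)) →
      ∃ t : ℂ, ‖𝓕 w - t • (memLp_freqGaussian hS μ).toLp‖ ^ 2 ≤
        C * ∑ i, ‖besselRep (-1) (u i)‖ ^ 2 := by
  obtain ⟨C, hC, hweak⟩ := weak_inequality (posDef_smul_pi hS)
  -- The summand 1 keeps the constant positive even if the sum over the entries of `S` is empty.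
  refine ⟨C * (16 * Real.pi ^ 2 * ∑ k, ∑ i, S k i ^ 2) + 1, by positivity,
    fun μ w u H hu => ?_⟩
  obtain ⟨hre, him⟩ := H.isWeakPair hS hu
  obtain ⟨t₁, ht₁⟩ := hweak _ _ hre
  obtain ⟨t₂, ht₂⟩ := hweak _ _ him
  refine ⟨⟨t₁, t₂⟩, ?_⟩
  set G := gaussian ((8 * Real.pi ^ 2) • S) with hG
  have hGL : MemLp G 2 := memLp_gaussian (posDef_smul_pi hS)
  have hnorm : ‖𝓕 w - (⟨t₁, t₂⟩ : ℂ) • (memLp_freqGaussian hS μ).toLp‖ ^ 2 =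
      (∫ ξ, ((modulated μ (𝓕 w) ξ).re - t₁ * G ξ) ^ 2) +
        ∫ ξ, ((modulated μ (𝓕 w) ξ).im - t₂ * G ξ) ^ 2 := by
    have i1 : Integrable fun ξ => ((modulated μ (𝓕 w) ξ).re - t₁ * G ξ) ^ 2 :=
      (hre.memLp.sub (hGL.const_mul t₁)).integrable_sq
    have i2 : Integrable fun ξ => ((modulated μ (𝓕 w) ξ).im - t₂ * G ξ) ^ 2 :=
      (him.memLp.sub (hGL.const_mul t₂)).integrable_sq
    rw [norm_sq_eq_integral, ← integral_add i1 i2]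
    refine integral_congr_ae ?_
    filter_upwards [Lp.coeFn_sub (𝓕 w) ((⟨t₁, t₂⟩ : ℂ) • (memLp_freqGaussian hS μ).toLp),
      Lp.coeFn_smul (⟨t₁, t₂⟩ : ℂ) (memLp_freqGaussian hS μ).toLp,
      (memLp_freqGaussian hS μ).coeFn_toLp] with ξ h1 h2 h3
    rw [h1, Pi.sub_apply, h2, Pi.smul_apply, h3, smul_eq_mul]
    -- Multiplication by the unimodular phase changes no norm and leaves a real Gaussian independent
    -- of μ; this is why `C` does not depend on μ.
    have h4 : ‖(𝓕 w : L2 d) ξ - ⟨t₁, t₂⟩ * freqGaussian S μ ξ‖ =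
        ‖modulated μ (𝓕 w) ξ - ⟨t₁, t₂⟩ * (G ξ : ℂ)‖ := by
      have : modulated μ (𝓕 w) ξ - ⟨t₁, t₂⟩ * (G ξ : ℂ) =
          phase μ ξ * ((𝓕 w : L2 d) ξ - ⟨t₁, t₂⟩ * freqGaussian S μ ξ) := by
        rw [mul_sub, mul_left_comm, phase_mul_freqGaussian, modulated]
      rw [this, norm_mul, norm_phase, one_mul]
    rw [h4, Complex.sq_norm, Complex.normSq_apply]
    simp
    ring
  have hsource : (∑ k, ∫ ξ, (modulatedSource S μ (fun i => fourierRep (-1) (u i)) k ξ).re ^ 2) +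
      (∑ k, ∫ ξ, (modulatedSource S μ (fun i => fourierRep (-1) (u i)) k ξ).im ^ 2) =
      ∑ k, ∫ ξ, ‖modulatedSource S μ (fun i => fourierRep (-1) (u i)) k ξ‖ ^ 2 := by
    rw [← Finset.sum_add_distrib]
    refine Finset.sum_congr rfl fun k _ => ?_
    rw [← integral_add (hre.memLp_right k).integrable_sq (him.memLp_right k).integrable_sq]
    congr 1 with ξ
    rw [Complex.sq_norm, Complex.normSq_apply]
    ring
  have hbound := sum_integral_modulatedSource_le S μ fun i => fourierRep (-1) (u i)
  simp_rw [norm_fourierRep] at hbound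
  rw [hnorm]
  have hβ : 0 ≤ ∑ i, ‖besselRep (-1) (u i)‖ ^ 2 := Finset.sum_nonneg fun _ _ => sq_nonneg _
  calc _ ≤ C * ∑ k, ∫ ξ, ‖modulatedSource S μ (fun i => fourierRep (-1) (u i)) k ξ‖ ^ 2 := by
        rw [← hsource, mul_add]; exact add_le_add ht₁ ht₂
    _ ≤ C * ((16 * Real.pi ^ 2 * ∑ k, ∑ i, S k i ^ 2) * ∑ i, ‖besselRep (-1) (u i)‖ ^ 2) := by
        gcongr
    _ ≤ _ := by rw [add_mul, mul_assoc C]; linarith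

/-! ### The ground state -/

lemma posDef_half_inv {S : Matrix (Fin d) (Fin d) ℝ} (hS : S.PosDef) :
    ((1 / 2 : ℝ) • S⁻¹).PosDef :=
  hS.inv.smul (by norm_num)

lemma V₀_eq (S : Matrix (Fin d) (Fin d) ℝ) (μ x : E d) :
    V₀ S μ x = 1 / 2 * quadForm S⁻¹ (x - μ) := rfl

lemma halfGaussian_eq (S : Matrix (Fin d) (Fin d) ℝ) (μ x : E d) :
    halfGaussian S μ x = gaussian ((1 / 2 : ℝ) • S⁻¹) (x - μ) := by
  rw [halfGaussian, gaussian, V₀_eq, quadForm, quadForm, Matrix.smul_mulVec, dotProduct_smul,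
    smul_eq_mul]

lemma halfGaussian_pos (S : Matrix (Fin d) (Fin d) ℝ) (μ x : E d) : 0 < halfGaussian S μ x :=
  Real.exp_pos _

lemma contDiff_V₀ (S : Matrix (Fin d) (Fin d) ℝ) (μ : E d) {n : WithTop ℕ∞} :
    ContDiff ℝ n (V₀ S μ) :=
  contDiff_const.mul ((contDiff_quadForm S⁻¹).comp (contDiff_id.sub contDiff_const))

lemma contDiff_halfGaussian (S : Matrix (Fin d) (Fin d) ℝ) (μ : E d) {n : WithTop ℕ∞} :
    ContDiff ℝ n (halfGaussian S μ) :=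
  ((contDiff_V₀ S μ).neg.div_const 2).exp

lemma hasFDerivAt_V₀ {S : Matrix (Fin d) (Fin d) ℝ} (hS : S.PosDef) (μ x : E d) :
    HasFDerivAt (V₀ S μ) (innerSL ℝ (matCLM S⁻¹ (x - μ))) x := by
  have h := ((hasFDerivAt_quadForm hS.inv.isHermitian (x - μ)).comp x
    ((hasFDerivAt_id x).sub_const μ)).const_mul (1 / 2 : ℝ)
  refine h.congr_fderiv ?_
  ext v
  simp

lemma gradient_V₀ {S : Matrix (Fin d) (Fin d) ℝ} (hS : S.PosDef) (μ x : E d) :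
    gradient (V₀ S μ) x = matCLM S⁻¹ (x - μ) := by
  rw [gradient, (hasFDerivAt_V₀ hS μ x).fderiv]
  exact (InnerProductSpace.toDual ℝ (E d)).symm_apply_apply _

lemma hasFDerivAt_halfGaussian {S : Matrix (Fin d) (Fin d) ℝ} (hS : S.PosDef) (μ x : E d) :
    HasFDerivAt (halfGaussian S μ)
      (-(halfGaussian S μ x / 2) • innerSL ℝ (matCLM S⁻¹ (x - μ))) x := by
  have h := ((hasFDerivAt_V₀ hS μ x).neg.mul_const (1 / 2 : ℝ)).exp
  have e : halfGaussian S μ = fun x => Real.exp ((-V₀ S μ) x * (1 / 2)) := by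
    funext x; unfold halfGaussian; congr 1; simp; ring
  rw [e]
  refine h.congr_fderiv ?_
  ext v
  simp
  ring

lemma memLp_halfGaussian {S : Matrix (Fin d) (Fin d) ℝ} (hS : S.PosDef) (μ : E d) :
    MemLp (halfGaussian S μ) 2 := by
  have h := (memLp_gaussian (posDef_half_inv hS)).comp_measurePreserving
    (measurePreserving_sub_right volume μ)
  exact h.congr_norm (contDiff_halfGaussian (n := 0) S μ).continuous.aestronglyMeasurable
    (ae_of_all _ fun x => by rw [halfGaussian_eq]; rfl)

/-! ### Real functions as elements of the complex `L²` space -/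

lemma MemLp.complex {f : E d → ℝ} (hf : MemLp f 2) : MemLp (fun x => (f x : ℂ)) 2 :=
  hf.ofReal

/-- A real square integrable function as an element of `L²(ℝᵈ; ℂ)`. -/
def complexL2 {f : E d → ℝ} (hf : MemLp f 2) : L2 d := (MemLp.complex hf).toLp

lemma coeFn_complexL2 {f : E d → ℝ} (hf : MemLp f 2) :
    complexL2 hf =ᵐ[volume] fun x => (f x : ℂ) := (MemLp.complex hf).coeFn_toLp

lemma fourierL2_eq {f : E d → ℝ} (hf : MemLp f 2) :
    fourierL2 f = (𝓕 (complexL2 hf) : L2 d) := by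
  rw [fourierL2, dif_pos (MemLp.complex hf)]; rfl

lemma norm_sq_complexL2 {f : E d → ℝ} (hf : MemLp f 2) :
    ‖complexL2 hf‖ ^ 2 = ∫ x, f x ^ 2 := by
  rw [complexL2, ← integral_congr_norm_sq]
  simp

lemma freqIntegral_eq {f : E d → ℝ} (hf : MemLp f 2) (Ω : Set (E d)) (a : E d) :
    freqIntegral Ω a f = ∫ ξ in Ω, phase a ξ * (𝓕 (complexL2 hf) : L2 d) ξ := by
  rw [freqIntegral, fourierL2_eq hf]; rfl

/-! ### Products with affine functions -/

/-- The product of a Schwartz function with a component of `½ S⁻¹ (x - μ)`. -/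
lemma exists_schwartz_drift (S : Matrix (Fin d) (Fin d) ℝ) (μ : E d) (i : Fin d)
    (φ : 𝓢(E d, ℂ)) :
    ∃ ψ : 𝓢(E d, ℂ), ∀ x, ψ x = ((matCLM S⁻¹ (x - μ) i / 2 : ℝ) : ℂ) * φ x := by
  have e : (fun x : E d => ((matCLM S⁻¹ (x - μ) i / 2 : ℝ) : ℂ)) = fun x =>
      ((1 / 2 : ℝ) • Complex.ofRealCLM ∘L (innerSL ℝ (basisVec i) ∘L matCLM S⁻¹)) x -
        ((matCLM S⁻¹ μ i / 2 : ℝ) : ℂ) := by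
    funext x
    simp [inner_basisVec_left]
    ring
  have h : (fun x : E d => ((matCLM S⁻¹ (x - μ) i / 2 : ℝ) : ℂ)).HasTemperateGrowth := by
    rw [e]
    exact (ContinuousLinearMap.hasTemperateGrowth _).sub (Function.HasTemperateGrowth.const _)
  exact ⟨SchwartzMap.smulLeftCLM ℂ _ φ, fun x => by
    rw [SchwartzMap.smulLeftCLM_apply_apply h, smul_eq_mul]⟩

lemma hasFDerivAt_halfGaussian_complex {S : Matrix (Fin d) (Fin d) ℝ} (hS : S.PosDef) (μ x : E d) :
    HasFDerivAt (fun y => (halfGaussian S μ y : ℂ))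
      (Complex.ofRealCLM ∘L (-(halfGaussian S μ x / 2) • innerSL ℝ (matCLM S⁻¹ (x - μ)))) x :=
  Complex.ofRealCLM.hasFDerivAt.comp x (hasFDerivAt_halfGaussian hS μ x)

lemma lineDeriv_halfGaussian_mul {S : Matrix (Fin d) (Fin d) ℝ} (hS : S.PosDef) (μ : E d)
    (i : Fin d) (φ : 𝓢(E d, ℂ)) (x : E d) :
    lineDeriv ℝ (fun y => (halfGaussian S μ y : ℂ) * φ y) x (basisVec i) =
      halfGaussian S μ x * (∂_{(basisVec i : E d)} φ x -
        ((matCLM S⁻¹ (x - μ) i / 2 : ℝ) : ℂ) * φ x) := by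
  have h1 := hasFDerivAt_halfGaussian_complex hS μ x
  have h := (h1.fun_mul φ.differentiableAt.hasFDerivAt).hasLineDerivAt (basisVec i)
  rw [h.lineDeriv, SchwartzMap.lineDerivOp_apply_eq_fderiv]
  simp [inner_basisVec]
  ring

/-- The ground state is annihilated by the weighted gradient. -/
lemma integral_halfGaussian_mul {S : Matrix (Fin d) (Fin d) ℝ} (hS : S.PosDef) (μ : E d)
    (i : Fin d) (φ : 𝓢(E d, ℂ)) :
    ∫ x, (halfGaussian S μ x : ℂ) * (∂_{(basisVec i : E d)} φ x -
      ((matCLM S⁻¹ (x - μ) i / 2 : ℝ) : ℂ) * φ x) = 0 := by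
  have hI : ∀ ψ : 𝓢(E d, ℂ), Integrable fun x => (halfGaussian S μ x : ℂ) * ψ x := fun ψ =>
    (MemLp.complex (memLp_halfGaussian hS μ)).integrable_mul (ψ.memLp 2)
  obtain ⟨ψ, hψ⟩ := exists_schwartz_drift S μ i φ
  have hd : ∀ x, fderiv ℝ (fun y => (halfGaussian S μ y : ℂ)) x (basisVec i) * φ x =
      -((halfGaussian S μ x : ℂ) * ψ x) := fun x => by
    rw [(hasFDerivAt_halfGaussian_complex hS μ x).fderiv, hψ]
    simp [inner_basisVec]
    ring
  have key := integral_mul_fderiv_eq_neg_fderiv_mul_of_integrable (μ := (volume : Measure (E d)))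
    (f := fun y => (halfGaussian S μ y : ℂ)) (g := φ) (v := basisVec i) ?_ ?_ (hI φ)
    (fun x _ => (hasFDerivAt_halfGaussian_complex hS μ x).differentiableAt)
    fun x _ => φ.differentiableAt
  · simp_rw [hd] at key
    rw [integral_neg, neg_neg] at key
    simp_rw [mul_sub, ← hψ]
    rw [integral_sub (hI _) (hI _), ← key, sub_eq_zero]
    rfl
  · simp_rw [hd]; exact (hI ψ).neg
  · exact hI (∂_{(basisVec i : E d)} φ)

lemma besselRep_zero (s : ℝ) : besselRep s (0 : 𝓢'(E d, ℂ)) = 0 := by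
  refine (besselRep_eq ?_).2
  rw [map_zero]
  exact (map_zero (Lp.toTemperedDistributionCLM ℂ (volume : Measure (E d)) 2)).symm

/-- The Fourier transform of the ground state. -/
lemma exists_fourier_halfGaussian {S : Matrix (Fin d) (Fin d) ℝ} (hS : S.PosDef) (μ : E d) :
    ∃ t : ℂ, t ≠ 0 ∧ 𝓕 (complexL2 (memLp_halfGaussian hS μ)) =
      t • (memLp_freqGaussian hS μ).toLp := by
  obtain ⟨C, -, h⟩ := exists_norm_sub_le hS
  -- No Gaussian integral is computed: the ground state has zero weighted gradient, so the spectral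
  -- gap inequality puts its Fourier transform at distance zero from the multiples of
  -- `freqGaussian`. By Plancherel the multiple cannot be zero.
  obtain ⟨t, ht⟩ := h μ (complexL2 (memLp_halfGaussian hS μ)) 0 (fun i φ => by
    rw [Pi.zero_apply, eq_comm, neg_eq_iff_eq_neg]
    refine Eq.trans (integral_congr_ae ?_) ((integral_halfGaussian_mul hS μ i φ).trans ?_)
    · filter_upwards [coeFn_complexL2 (memLp_halfGaussian hS μ)] with x hx
      rw [hx]
    · simp) fun i => memSobolev_fun_zero _ _ _ _
  simp only [Pi.zero_apply, besselRep_zero, norm_zero] at ht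
  have h0 : 𝓕 (complexL2 (memLp_halfGaussian hS μ)) = t • (memLp_freqGaussian hS μ).toLp := by
    rw [← sub_eq_zero, ← norm_eq_zero, ← sq_eq_zero_iff]
    exact le_antisymm (by simpa using ht) (sq_nonneg _)
  refine ⟨t, ?_, h0⟩
  rintro rfl
  rw [zero_smul, ← norm_eq_zero, Lp.norm_fourier_eq, ← sq_eq_zero_iff, norm_sq_complexL2] at h0
  have : 0 < ∫ x, halfGaussian S μ x ^ 2 := by
    rw [integral_pos_iff_support_of_nonneg (fun x => sq_nonneg _)
      (memLp_halfGaussian hS μ).integrable_sq]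
    have : (Function.support fun x => halfGaussian S μ x ^ 2) = Set.univ := by
      ext x; simp [(halfGaussian_pos S μ x).ne']
    rw [this]
    exact Measure.measure_univ_pos.2 (NeZero.ne _)
  exact this.ne' h0

/-! ### The weighted gradient -/

lemma IsGivenBy.unique {T T' : 𝓢'(E d, ℂ)} {h : E d → ℂ} (H : IsGivenBy T h)
    (H' : IsGivenBy T' h) : T = T' := by
  ext φ
  rw [(H φ).2, (H' φ).2]

lemma IsGivenBy.toTempered_eq {T : 𝓢'(E d, ℂ)} {h : E d → ℂ} (H : IsGivenBy T h) :
    toTempered h = T := by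
  have hex : ∃ T : 𝓢'(E d, ℂ), IsGivenBy T h := ⟨T, H⟩
  rw [toTempered, dif_pos hex]
  exact hex.choose_spec.unique H

/-- The multiplier of a derivative, weighted for H⁻¹, is bounded by 2π because |ξᵢ| ≤ √(1 + |ξ|²).
-/
lemma memLp_freqDeriv (w : L2 d) (i : Fin d) :
    MemLp (fun ξ : E d => 2 * Real.pi * Complex.I * (ξ i : ℂ) *
      (((1 + ‖ξ‖ ^ 2) ^ (-(1 / 2) : ℝ) : ℝ) : ℂ) * (𝓕 w : L2 d) ξ) 2 ∧
    ∀ ξ : E d, ‖2 * Real.pi * Complex.I * (ξ i : ℂ) *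
      (((1 + ‖ξ‖ ^ 2) ^ (-(1 / 2) : ℝ) : ℝ) : ℂ) * (𝓕 w : L2 d) ξ‖ ≤
        2 * Real.pi * ‖(𝓕 w : L2 d) ξ‖ := by
  have hb : ∀ ξ : E d, ‖2 * Real.pi * Complex.I * (ξ i : ℂ) *
      (((1 + ‖ξ‖ ^ 2) ^ (-(1 / 2) : ℝ) : ℝ) : ℂ) * (𝓕 w : L2 d) ξ‖ ≤
        2 * Real.pi * ‖(𝓕 w : L2 d) ξ‖ := fun ξ => by
    have h1 : |ξ i| * (1 + ‖ξ‖ ^ 2) ^ (-(1 / 2) : ℝ) ≤ 1 := by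
      rw [Real.rpow_neg (by positivity), ← Real.sqrt_eq_rpow, ← div_eq_mul_inv,
        div_le_one (by positivity)]
      exact (abs_apply_le_norm ξ i).trans (Real.le_sqrt_of_sq_le (by linarith))
    have h2 : (0 : ℝ) ≤ (1 + ‖ξ‖ ^ 2) ^ (-(1 / 2) : ℝ) := by positivity
    simp only [norm_mul, Complex.norm_real, Complex.norm_I, Complex.norm_ofNat, mul_one,
      Real.norm_eq_abs, abs_of_pos Real.pi_pos, abs_of_nonneg h2]
    rw [mul_assoc (2 * Real.pi)]
    exact mul_le_mul_of_nonneg_right (mul_le_of_le_one_right (by positivity) h1) (norm_nonneg _)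
  refine ⟨((Lp.memLp (𝓕 w : L2 d)).norm.const_mul (2 * Real.pi)).of_le ?_
    (ae_of_all _ fun ξ => (hb ξ).trans (le_abs_self _)), hb⟩
  refine AEStronglyMeasurable.mul (Continuous.aestronglyMeasurable ?_) (Lp.aestronglyMeasurable _)
  have : Continuous fun ξ : E d => (1 + ‖ξ‖ ^ 2) ^ (-(1 / 2) : ℝ) :=
    Continuous.rpow_const (by fun_prop) fun ξ => Or.inl (by positivity)
  fun_prop

/-- The derivative is bounded from `L²` to `H⁻¹`. -/
lemma memSobolev_lineDeriv (w : L2 d) (i : Fin d) :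
    MemSobolev (-1) 2 (∂_{(basisVec i : E d)} (w : 𝓢'(E d, ℂ))) ∧
      ‖besselRep (-1) (∂_{(basisVec i : E d)} (w : 𝓢'(E d, ℂ)))‖ ≤ 2 * Real.pi * ‖w‖ := by
  obtain ⟨hF, hb⟩ := memLp_freqDeriv w i
  obtain ⟨u, hu, hu'⟩ := exists_fourierRep_eq (-1) hF.toLp
  have hI : ∀ ψ : 𝓢(E d, ℂ), Integrable fun x => (𝓕 w : L2 d) x * ψ x := fun ψ => by
    simpa only [mul_comm] using integrable_mul_L2 ψ (𝓕 w : L2 d)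
  have key : u = ∂_{(basisVec i : E d)} (w : 𝓢'(E d, ℂ)) := by
    refine eq_of_fourier_apply_eq fun φ => ?_
    rw [fourier_apply_eq_integral hu, hu', TemperedDistribution.fourier_apply,
      lineDerivOp_apply_apply, lineDeriv_fourier_apply, map_neg,
      Lp.toTemperedDistribution_apply]
    simp only [smul_eq_mul, mul_comm _ (w _)]
    rw [integral_mul_fourier, ← integral_neg]
    refine integral_congr_ae ?_
    filter_upwards [hF.coeFn_toLp] with ξ h1
    rw [h1, _root_.smul_apply, smulLeft_inner_apply, smul_eq_mul]
    have h2 : (((1 + ‖ξ‖ ^ 2) ^ (- -1 / 2 : ℝ) : ℝ) : ℂ) *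
        (((1 + ‖ξ‖ ^ 2) ^ (-(1 / 2) : ℝ) : ℝ) : ℂ) = 1 := by
      rw [← Complex.ofReal_mul, ← Real.rpow_add (by positivity)]
      norm_num
    linear_combination (2 * Real.pi * Complex.I * (ξ i : ℂ) * (𝓕 w : L2 d) ξ * φ ξ) * h2
  rw [← key]
  refine ⟨hu, ?_⟩
  rw [← norm_fourierRep, hu', ← Lp.norm_fourier_eq w, Lp.norm_toLp]
  refine ENNReal.toReal_le_of_le_ofReal (by positivity) ?_
  have h3 := eLpNorm_le_mul_eLpNorm_of_ae_le_mul (p := 2) (ae_of_all volume hb)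
  refine h3.trans ?_
  rw [ENNReal.ofReal_mul (p := 2 * Real.pi) (by positivity), Lp.norm_def,
    ENNReal.ofReal_toReal (Lp.eLpNorm_ne_top _)]

variable {V : E d → ℝ} {S : Matrix (Fin d) (Fin d) ℝ} {μ : E d} {ρ : E d → ℝ}

lemma IsRegular.toTempered_drift (h : IsRegular V S μ ρ) (i : Fin d) :
    IsGivenBy (toTempered (weightedDrift V S μ ρ i)) (weightedDrift V S μ ρ i) ∧
      MemSobolev (-1) 2 (toTempered (weightedDrift V S μ ρ i)) := by
  obtain ⟨T, hT, hT'⟩ := h.drift_mem i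
  rw [hT.toTempered_eq]
  exact ⟨hT, hT'⟩

/-- The smooth factor e^{-V₀/2} on the test function turns ρ e^V into w and creates the drift ½ ∇V₀;
the potential V is never differentiated. -/
lemma mul_lineDeriv_eq (hS : S.PosDef) (i : Fin d) (φ : 𝓢(E d, ℂ)) (x : E d) :
    ((ρ x * Real.exp (V x) : ℝ) : ℂ) *
      lineDeriv ℝ (fun y => (halfGaussian S μ y : ℂ) * φ y) x (basisVec i) =
      (weighted V S μ ρ x : ℂ) * (∂_{(basisVec i : E d)} φ x -
        ((matCLM S⁻¹ (x - μ) i / 2 : ℝ) : ℂ) * φ x) := by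
  rw [lineDeriv_halfGaussian_mul hS, ← mul_assoc, ← Complex.ofReal_mul, weighted, halfGaussian,
    mul_assoc (ρ x), ← Real.exp_add]
  congr 5
  ring

lemma IsRegular.sum_apply (hS : S.PosDef) (h : IsRegular V S μ ρ) (i : Fin d)
    (φ : 𝓢(E d, ℂ)) :
    (∂_{(basisVec i : E d)} (complexL2 h.memLp_weighted : 𝓢'(E d, ℂ)) +
      (1 / 2 : ℂ) • toTempered (weightedDrift V S μ ρ i)) φ =
    -∫ x, (weighted V S μ ρ x : ℂ) * (∂_{(basisVec i : E d)} φ x -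
        ((matCLM S⁻¹ (x - μ) i / 2 : ℝ) : ℂ) * φ x) := by
  obtain ⟨hT, -⟩ := h.toTempered_drift i
  have h1 : Integrable fun x => (weighted V S μ ρ x : ℂ) * ∂_{(basisVec i : E d)} φ x :=
    (MemLp.complex h.memLp_weighted).integrable_mul ((∂_{(basisVec i : E d)} φ).memLp 2)
  have h2 := (hT φ).1.const_mul (1 / 2 : ℂ)
  rw [add_apply, _root_.smul_apply, (hT φ).2, lineDerivOp_apply_apply, map_neg,
    Lp.toTemperedDistribution_apply, smul_eq_mul, ← integral_const_mul]
  have e1 : ∫ x, ∂_{(basisVec i : E d)} φ x • complexL2 h.memLp_weighted x =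
      ∫ x, (weighted V S μ ρ x : ℂ) * ∂_{(basisVec i : E d)} φ x := by
    refine integral_congr_ae ?_
    filter_upwards [coeFn_complexL2 h.memLp_weighted] with x hx
    rw [hx, smul_eq_mul, mul_comm]
  have e2 : ∀ x, (weighted V S μ ρ x : ℂ) * (∂_{(basisVec i : E d)} φ x -
        ((matCLM S⁻¹ (x - μ) i / 2 : ℝ) : ℂ) * φ x) =
      (weighted V S μ ρ x : ℂ) * ∂_{(basisVec i : E d)} φ x -
        1 / 2 * (φ x * weightedDrift V S μ ρ i x) := fun x => by
    rw [weightedDrift, gradient_V₀ hS]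
    push_cast
    ring
  simp_rw [e2]
  rw [integral_sub h1 h2, e1]
  ring

lemma IsRegular.isWeightedGradient (hS : S.PosDef) (h : IsRegular V S μ ρ) (i : Fin d) :
    IsWeightedGradient V S μ ρ i (∂_{(basisVec i : E d)} (complexL2 h.memLp_weighted : 𝓢'(E d, ℂ)) +
      (1 / 2 : ℂ) • toTempered (weightedDrift V S μ ρ i)) := fun φ => by
  rw [h.sum_apply hS]
  simp_rw [mul_lineDeriv_eq hS]

/-- The distribution is determined by its values on test functions, so the chosen one is ∇w + ½ w
∇V₀. The two summands are in H⁻¹ by the two regularity assumptions on w. -/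
lemma IsRegular.weightedGradient_eq (hS : S.PosDef) (h : IsRegular V S μ ρ) (i : Fin d) :
    weightedGradient V S μ ρ i =
      ∂_{(basisVec i : E d)} (complexL2 h.memLp_weighted : 𝓢'(E d, ℂ)) +
        (1 / 2 : ℂ) • toTempered (weightedDrift V S μ ρ i) := by
  have hex : ∃ u, IsWeightedGradient V S μ ρ i u := ⟨_, h.isWeightedGradient hS i⟩
  rw [weightedGradient, dif_pos hex]
  ext φ
  rw [hex.choose_spec φ, h.isWeightedGradient hS i φ]

lemma IsRegular.memSobolev (hS : S.PosDef) (h : IsRegular V S μ ρ) (i : Fin d) :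
    MemSobolev (-1) 2 (weightedGradient V S μ ρ i) := by
  rw [h.weightedGradient_eq hS]
  exact (memSobolev_lineDeriv _ i).1.add ((h.toTempered_drift i).2.smul _)

lemma IsRegular.isGroundStateGradient (hS : S.PosDef) (h : IsRegular V S μ ρ) :
    IsGroundStateGradient S μ (complexL2 h.memLp_weighted) (weightedGradient V S μ ρ) :=
  fun i φ => by
    rw [h.weightedGradient_eq hS, h.sum_apply hS]
    congr 1
    refine integral_congr_ae ?_
    filter_upwards [coeFn_complexL2 h.memLp_weighted] with x hx
    rw [hx]

/-- The drift is bounded in `H⁻¹` by the weighted gradient and the `L²` norm. -/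
lemma IsRegular.norm_drift_le (hS : S.PosDef) (h : IsRegular V S μ ρ) (i : Fin d) :
    ‖besselRep (-1) (toTempered (weightedDrift V S μ ρ i))‖ ≤
      2 * ‖besselRep (-1) (weightedGradient V S μ ρ i)‖ +
        4 * Real.pi * ‖complexL2 h.memLp_weighted‖ := by
  obtain ⟨hm, hn⟩ := memSobolev_lineDeriv (complexL2 h.memLp_weighted) i
  have hd := (h.toTempered_drift i).2
  have h1 : besselRep (-1) (weightedGradient V S μ ρ i) =
      besselRep (-1) (∂_{(basisVec i : E d)} (complexL2 h.memLp_weighted : 𝓢'(E d, ℂ))) +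
        (1 / 2 : ℂ) • besselRep (-1) (toTempered (weightedDrift V S μ ρ i)) := by
    rw [h.weightedGradient_eq hS, besselRep_add hm (hd.smul _), besselRep_smul _ hd]
  have h2 : besselRep (-1) (toTempered (weightedDrift V S μ ρ i)) =
      (2 : ℂ) • (besselRep (-1) (weightedGradient V S μ ρ i) -
        besselRep (-1) (∂_{(basisVec i : E d)} (complexL2 h.memLp_weighted : 𝓢'(E d, ℂ)))) := by
    rw [h1, add_sub_cancel_left, smul_smul]
    norm_num
  rw [h2, norm_smul, Complex.norm_ofNat]
  linarith [norm_sub_le (besselRep (-1) (weightedGradient V S μ ρ i))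
    (besselRep (-1) (∂_{(basisVec i : E d)} (complexL2 h.memLp_weighted : 𝓢'(E d, ℂ))))]

/-! ### Low frequency averages -/

/-- The average `∫_Ω e^{2πi a·ξ} f(ξ) dξ`. -/
def freqFunctional (Ω : Set (E d)) (a : E d) (f : L2 d) : ℂ := ∫ ξ in Ω, modulated a f ξ

lemma freqIntegral_eq_freqFunctional {f : E d → ℝ} (hf : MemLp f 2) (Ω : Set (E d)) (a : E d) :
    freqIntegral Ω a f = freqFunctional Ω a (𝓕 (complexL2 hf)) :=
  freqIntegral_eq hf Ω a

lemma freqFunctional_sub_smul {Ω : Set (E d)} (hΩ : volume Ω ≠ ∞) (a : E d) (f g : L2 d) (s : ℂ) :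
    freqFunctional Ω a (f - s • g) = freqFunctional Ω a f - s * freqFunctional Ω a g := by
  have : IsFiniteMeasure (volume.restrict Ω) := ⟨by simpa using hΩ.lt_top⟩
  have hI : ∀ f : L2 d, IntegrableOn (modulated a f) Ω := fun f =>
    ((memLp_modulated a f).restrict Ω).integrable one_le_two
  rw [freqFunctional, freqFunctional, freqFunctional, ← integral_const_mul,
    ← integral_sub (hI f) ((hI g).const_mul s)]
  refine integral_congr_ae (ae_restrict_of_ae ?_)
  filter_upwards [Lp.coeFn_sub f (s • g), Lp.coeFn_smul s g] with ξ h1 h2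
  rw [modulated, h1, Pi.sub_apply, h2, Pi.smul_apply, modulated, modulated, smul_eq_mul]
  ring

lemma norm_toLp_modulated (a : E d) (f : L2 d) : ‖(memLp_modulated a f).toLp‖ = ‖f‖ := by
  refine (sq_eq_sq₀ (norm_nonneg _) (norm_nonneg _)).1 ?_
  rw [← integral_congr_norm_sq, norm_sq_eq_integral]
  simp_rw [modulated, norm_mul, norm_phase, one_mul]

/-- Cauchy-Schwarz against the indicator of Ω; `B` does not depend on `a` because the phase is
unimodular. -/
lemma exists_norm_freqFunctional_le {Ω : Set (E d)} (hm : MeasurableSet Ω) (hΩ : volume Ω ≠ ∞) :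
    ∃ B : ℝ, 0 ≤ B ∧ ∀ (a : E d) (f : L2 d), ‖freqFunctional Ω a f‖ ≤ B * ‖f‖ := by
  refine ⟨‖indicatorConstLp 2 hm hΩ (1 : ℂ)‖, norm_nonneg _, fun a f => ?_⟩
  have h := L2.inner_indicatorConstLp_one (𝕜 := ℂ) hm hΩ (memLp_modulated a f).toLp
  have h2 : freqFunctional Ω a f = ∫ ξ in Ω, ((memLp_modulated a f).toLp : L2 d) ξ := by
    refine integral_congr_ae (ae_restrict_of_ae ?_)
    exact (memLp_modulated a f).coeFn_toLp.symm
  rw [h2, ← h, ← norm_toLp_modulated a f]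
  exact norm_inner_le_norm _ _

/-- Replacing the best multiple of `g` by the one matching the low frequency averages costs a
constant. -/
lemma integral_sub_re_mul_sq_le {Ω : Set (E d)} (hΩ : volume Ω ≠ ∞) {a : E d}
    {B R : ℝ} (hB : ∀ f : L2 d, ‖freqFunctional Ω a f‖ ≤ B * ‖f‖)
    {f g : E d → ℝ} (hf : MemLp f 2) (hg : MemLp g 2)
    (hne : freqIntegral Ω a g ≠ 0) (hR : ‖complexL2 hg‖ ≤ R * ‖freqIntegral Ω a g‖) (s : ℂ) :
    ∫ x, |f x - (freqIntegral Ω a f / freqIntegral Ω a g).re * g x| ^ 2 ≤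
      (1 + B * R) ^ 2 * ‖𝓕 (complexL2 hf) - s • 𝓕 (complexL2 hg)‖ ^ 2 := by
  set F := complexL2 hf
  set Γ := complexL2 hg
  set T : ℂ := freqIntegral Ω a f / freqIntegral Ω a g with hT
  -- As `f` and `g` are real, dropping the imaginary part of `T` can only decrease the distance.
  have h1 : ∫ x, |f x - T.re * g x| ^ 2 ≤ ‖F - T • Γ‖ ^ 2 := by
    have hc : MemLp (fun x => (f x : ℂ) - T * (g x : ℂ)) 2 :=
      (MemLp.complex hf).sub ((MemLp.complex hg).const_mul T)
    have e : ‖F - T • Γ‖ ^ 2 = ∫ x, ‖(f x : ℂ) - T * (g x : ℂ)‖ ^ 2 := by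
      rw [norm_sq_eq_integral]
      refine integral_congr_ae ?_
      filter_upwards [Lp.coeFn_sub F (T • Γ), Lp.coeFn_smul T Γ, coeFn_complexL2 hf,
        coeFn_complexL2 hg] with x h1 h2 h3 h4
      rw [h1, Pi.sub_apply, h2, Pi.smul_apply, h3, h4, smul_eq_mul]
    rw [e]
    refine integral_mono_ae ?_ ((memLp_two_iff_integrable_sq_norm hc.1).1 hc)
      (ae_of_all _ fun x => ?_)
    · simp_rw [sq_abs]
      exact (hf.sub (hg.const_mul T.re)).integrable_sq
    · change |f x - T.re * g x| ^ 2 ≤ ‖(f x : ℂ) - T * (g x : ℂ)‖ ^ 2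
      rw [sq_abs, Complex.sq_norm, Complex.normSq_apply]
      simp
      nlinarith [sq_nonneg (T.im * g x)]
  have h2 : ‖F - T • Γ‖ = ‖𝓕 F - T • 𝓕 Γ‖ := by
    rw [← Lp.norm_fourier_eq (F - T • Γ), sub_eq_add_neg, sub_eq_add_neg, FourierTransform.fourier_add,
      ← neg_smul, ← neg_smul, FourierTransform.fourier_smul]
  -- The functional vanishes on 𝓕 F - T 𝓕 Γ by the choice of `T`, so it reads off the error T - s
  -- from 𝓕 F - s 𝓕 Γ.
  have h3 : (T - s) * freqIntegral Ω a g = freqFunctional Ω a (𝓕 F - s • 𝓕 Γ) := by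
    rw [freqFunctional_sub_smul hΩ, ← freqIntegral_eq_freqFunctional,
      ← freqIntegral_eq_freqFunctional, sub_mul, hT, div_mul_cancel₀ _ hne]
  have h4 : ‖T - s‖ * ‖Γ‖ ≤ B * R * ‖𝓕 F - s • 𝓕 Γ‖ := by
    have hpos : 0 < ‖freqIntegral Ω a g‖ := norm_pos_iff.2 hne
    have hR0 : 0 ≤ R := by
      by_contra! hneg
      have := norm_nonneg (complexL2 hg)
      nlinarith
    have h5 := hB (𝓕 F - s • 𝓕 Γ)
    rw [← h3, norm_mul] at h5
    calc ‖T - s‖ * ‖Γ‖ ≤ ‖T - s‖ * (R * ‖freqIntegral Ω a g‖) := by gcongr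
      _ = R * (‖T - s‖ * ‖freqIntegral Ω a g‖) := by ring
      _ ≤ R * (B * ‖𝓕 F - s • 𝓕 Γ‖) := by gcongr
      _ = _ := by ring
  have h6 : ‖𝓕 F - T • 𝓕 Γ‖ ≤ (1 + B * R) * ‖𝓕 F - s • 𝓕 Γ‖ := by
    have e : 𝓕 F - T • 𝓕 Γ = (𝓕 F - s • 𝓕 Γ) - (T - s) • 𝓕 Γ := by rw [sub_smul]; abel
    rw [e]
    refine (norm_sub_le _ _).trans ?_
    rw [norm_smul, Lp.norm_fourier_eq Γ]
    linarith
  calc _ ≤ ‖F - T • Γ‖ ^ 2 := h1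
    _ ≤ ((1 + B * R) * ‖𝓕 F - s • 𝓕 Γ‖) ^ 2 := by rw [h2]; gcongr
    _ = _ := by ring

/-! ### The spectral gap -/

/-- The spectral gap inequality. -/
lemma exists_norm_sub_smul_le {S : Matrix (Fin d) (Fin d) ℝ} (hS : S.PosDef) :
    ∃ C : ℝ, 0 < C ∧ ∀ (V : E d → ℝ) (μ : E d) (ρ : E d → ℝ) (h : IsRegular V S μ ρ),
      ∃ s : ℂ, ‖𝓕 (complexL2 h.memLp_weighted) - s • 𝓕 (complexL2 (memLp_halfGaussian hS μ))‖ ^ 2 ≤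
        C * ∑ i, ‖besselRep (-1) (weightedGradient V S μ ρ i)‖ ^ 2 := by
  obtain ⟨C, hC, H⟩ := exists_norm_sub_le hS
  refine ⟨C, hC, fun V μ ρ h => ?_⟩
  obtain ⟨t, ht⟩ := H μ _ _ (h.isGroundStateGradient hS) (h.memSobolev hS)
  obtain ⟨t₀, ht₀, he⟩ := exists_fourier_halfGaussian hS μ
  refine ⟨t / t₀, ?_⟩
  rwa [he, smul_smul, div_mul_cancel₀ _ ht₀]

lemma measurableSet_ellipsoid (S : Matrix (Fin d) (Fin d) ℝ) (ε : ℝ) :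
    MeasurableSet (ellipsoid S ε) :=
  (isOpen_lt (contDiff_quadForm (n := 0) S).continuous continuous_const).measurableSet

lemma volume_ellipsoid_ne_top {S : Matrix (Fin d) (Fin d) ℝ} (hS : S.PosDef) (ε : ℝ) :
    volume (ellipsoid S ε) ≠ ∞ := by
  obtain ⟨a, ha, h⟩ := exists_quadForm_ge hS
  refine ne_top_of_le_ne_top (b := volume (Metric.closedBall (0 : E d) √(ε ^ 2 / a)))
    measure_closedBall_lt_top.ne (measure_mono fun ξ hξ => ?_)
  rw [mem_closedBall_zero_iff]
  refine Real.le_sqrt_of_sq_le ?_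
  rw [le_div_iff₀ ha, mul_comm]
  exact (h ξ).trans (le_of_lt hξ)

lemma volume_ellipsoid_pos (S : Matrix (Fin d) (Fin d) ℝ) {ε : ℝ} (hε : 0 < ε) :
    0 < volume (ellipsoid S ε) := by
  refine (isOpen_lt (contDiff_quadForm (n := 0) S).continuous continuous_const).measure_pos _
    ⟨0, ?_⟩
  simp [quadForm, hε]

/-- In the coordinates normalizing `S` and `μ`, the low frequency average of the ground state is
bounded below uniformly in `μ`. -/
lemma exists_norm_halfGaussian_le {S : Matrix (Fin d) (Fin d) ℝ} (hS : S.PosDef) {ε : ℝ}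
    (hε : 0 < ε) :
    ∃ R : ℝ, 0 ≤ R ∧ ∀ μ : E d, freqIntegral (ellipsoid S ε) μ (halfGaussian S μ) ≠ 0 ∧
      ‖complexL2 (memLp_halfGaussian hS μ)‖ ≤
        R * ‖freqIntegral (ellipsoid S ε) μ (halfGaussian S μ)‖ := by
  set G := gaussian ((8 * Real.pi ^ 2) • S) with hG
  have hGL : MemLp G 2 := memLp_gaussian (posDef_smul_pi hS)
  set Ω := ellipsoid S ε
  have : IsFiniteMeasure (volume.restrict Ω) :=
    ⟨by simpa using (volume_ellipsoid_ne_top hS ε).lt_top⟩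
  have hJ : 0 < ∫ ξ in Ω, G ξ := by
    rw [integral_pos_iff_support_of_nonneg (fun ξ => (gaussian_pos _ ξ).le)
      ((hGL.restrict Ω).integrable one_le_two)]
    have : Function.support G = Set.univ := by
      ext ξ; simp [hG, (gaussian_pos _ ξ).ne']
    rw [this]
    simpa using volume_ellipsoid_pos S hε
  refine ⟨‖complexL2 hGL‖ / ∫ ξ in Ω, G ξ, by positivity, fun μ => ?_⟩
  obtain ⟨t₀, ht₀, he⟩ := exists_fourier_halfGaussian hS μ
  -- The phase of the average cancels that of the ground state, leaving the integral of a positive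
  -- Gaussian. The factor `t₀`, the only remaining trace of μ, cancels against the one in `h4`.
  have h1 : freqIntegral Ω μ (halfGaussian S μ) = t₀ * ((∫ ξ in Ω, G ξ : ℝ) : ℂ) := by
    rw [freqIntegral_eq_freqFunctional (memLp_halfGaussian hS μ), he, ← integral_complex_ofReal,
      ← integral_const_mul]
    refine integral_congr_ae (ae_restrict_of_ae ?_)
    filter_upwards [Lp.coeFn_smul t₀ (memLp_freqGaussian hS μ).toLp,
      (memLp_freqGaussian hS μ).coeFn_toLp] with ξ h2 h3
    rw [modulated, h2, Pi.smul_apply, h3, smul_eq_mul, mul_left_comm, phase_mul_freqGaussian]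
  have h4 : ‖complexL2 (memLp_halfGaussian hS μ)‖ = ‖t₀‖ * ‖complexL2 hGL‖ := by
    rw [← Lp.norm_fourier_eq, he, norm_smul]
    congr 1
    refine (sq_eq_sq₀ (norm_nonneg _) (norm_nonneg _)).1 ?_
    rw [← integral_congr_norm_sq, norm_sq_complexL2]
    simp_rw [freqGaussian, norm_mul, norm_phase, one_mul, Complex.norm_real, Real.norm_eq_abs,
      sq_abs]
    rfl
  rw [h1, h4, norm_mul, Complex.norm_real, Real.norm_eq_abs, abs_of_pos hJ]
  refine ⟨mul_ne_zero ht₀ (by exact_mod_cast hJ.ne'), le_of_eq ?_⟩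
  field_simp

/-- The lower bound with `τ` computed on the ellipsoid, uniformly in `μ`. -/
theorem exists_integral_sub_tau_ellipsoid_le {S : Matrix (Fin d) (Fin d) ℝ} (hS : S.PosDef)
    {ε : ℝ} (hε : 0 < ε) :
    ∃ C : ℝ, 0 < C ∧ ∀ (V : E d → ℝ) (μ : E d) (ρ : E d → ℝ), IsRegular V S μ ρ →
      ∫ x, |weighted V S μ ρ x - tau (ellipsoid S ε) μ V S μ ρ * halfGaussian S μ x| ^ 2 ≤
        C * ∑ i, ‖besselRep (-1) (weightedGradient V S μ ρ i)‖ ^ 2 := by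
  obtain ⟨C, hC, H⟩ := exists_norm_sub_smul_le hS
  obtain ⟨B, hB0, hB⟩ := exists_norm_freqFunctional_le (measurableSet_ellipsoid S ε)
    (volume_ellipsoid_ne_top hS ε)
  obtain ⟨R, hR0, hR⟩ := exists_norm_halfGaussian_le hS hε
  refine ⟨(1 + B * R) ^ 2 * C, by positivity, fun V μ ρ h => ?_⟩
  obtain ⟨s, hs⟩ := H V μ ρ h
  refine (integral_sub_re_mul_sq_le (volume_ellipsoid_ne_top hS ε) (hB μ) h.memLp_weighted
    (memLp_halfGaussian hS μ) (hR μ).1 (hR μ).2 s).trans ?_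
  rw [mul_assoc]
  gcongr

/-- The lower bound with `τ` computed on a set of finite measure. -/
theorem exists_integral_sub_tau_le {S : Matrix (Fin d) (Fin d) ℝ} (hS : S.PosDef) (μ : E d)
    {Ω : Set (E d)} (hm : MeasurableSet Ω) (hΩ : volume Ω ≠ ∞) (a : E d)
    (hne : freqIntegral Ω a (halfGaussian S μ) ≠ 0) :
    ∃ C : ℝ, 0 < C ∧ ∀ (V : E d → ℝ) (ρ : E d → ℝ), IsRegular V S μ ρ →
      ∫ x, |weighted V S μ ρ x - tau Ω a V S μ ρ * halfGaussian S μ x| ^ 2 ≤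
        C * ∑ i, ‖besselRep (-1) (weightedGradient V S μ ρ i)‖ ^ 2 := by
  obtain ⟨C, hC, H⟩ := exists_norm_sub_smul_le hS
  obtain ⟨B, hB0, hB⟩ := exists_norm_freqFunctional_le hm hΩ
  set R := ‖complexL2 (memLp_halfGaussian hS μ)‖ / ‖freqIntegral Ω a (halfGaussian S μ)‖
  have hR : ‖complexL2 (memLp_halfGaussian hS μ)‖ ≤ R * ‖freqIntegral Ω a (halfGaussian S μ)‖ :=
    (div_mul_cancel₀ _ (norm_ne_zero_iff.2 hne)).ge
  refine ⟨(1 + B * R) ^ 2 * C, by positivity, fun V ρ h => ?_⟩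
  obtain ⟨s, hs⟩ := H V μ ρ h
  refine (integral_sub_re_mul_sq_le hΩ (hB a) h.memLp_weighted
    (memLp_halfGaussian hS μ) hne hR s).trans ?_
  rw [mul_assoc]
  gcongr

/-! ### Convolution of a kernel with Schwartz functions -/

/-- Hölder's inequality in the first variable, uniform in the second by translation invariance,
followed by the integrability of `f`. It is used with exponents (1, ∞) and (2, 2) for the two
summands of the kernel. -/
lemma integrable_conv_integrand_of_memLp {p q : ℝ≥0∞} [hpq : ENNReal.HolderTriple p q 1]
    {k : E d → ℝ} (hk : MemLp k p) (φ f : 𝓢(E d, ℂ)) :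
    Integrable fun z : E d × E d => φ (z.1 + z.2) * (k z.1 : ℂ) * f z.2 := by
  have hm : AEStronglyMeasurable
      (fun z : E d × E d => φ (z.1 + z.2) * (k z.1 : ℂ) * f z.2) := by
    have h1 : AEStronglyMeasurable (fun z : E d × E d => (k z.1 : ℂ)) :=
      (Complex.continuous_ofReal.comp_aestronglyMeasurable hk.1).comp_fst
    have h2 : Continuous fun z : E d × E d => φ (z.1 + z.2) := φ.continuous.comp (by fun_prop)
    have h3 : Continuous fun z : E d × E d => f z.2 := f.continuous.comp (by fun_prop)
    exact (h2.aestronglyMeasurable.mul h1).mul h3.aestronglyMeasurable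
  refine ⟨hm, ?_⟩
  rw [hasFiniteIntegral_iff_enorm, Measure.volume_eq_prod, lintegral_prod_symm _ hm.enorm]
  have hφ : MemLp φ q := φ.memLp q
  have hb : ∀ y : E d, ∫⁻ x, ‖φ (x + y) * (k x : ℂ) * f y‖ₑ ≤
      eLpNorm k p volume * eLpNorm φ q volume * ‖f y‖ₑ := fun y => by
    simp_rw [enorm_mul]
    rw [lintegral_mul_const' _ _ enorm_ne_top]
    gcongr
    have h1 : AEStronglyMeasurable (fun x => φ (x + y)) :=
      (φ.continuous.comp (by fun_prop)).aestronglyMeasurable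
    have h2 := eLpNorm_smul_le_mul_eLpNorm (r := 1) (p := p) (q := q) h1 hk.1
    have h3 : eLpNorm (fun x => φ (x + y)) q volume = eLpNorm φ q volume :=
      eLpNorm_comp_measurePreserving φ.continuous.aestronglyMeasurable
        (measurePreserving_add_right volume y)
    rw [h3] at h2
    refine le_trans (le_of_eq ?_) h2
    rw [eLpNorm_one_eq_lintegral_enorm]
    refine lintegral_congr fun x => ?_
    rw [Pi.smul_apply', enorm_smul, mul_comm]
    congr 1
    rw [← ofReal_norm, ← ofReal_norm, Complex.norm_real]
  refine (lintegral_mono hb).trans_lt ?_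
  rw [lintegral_const_mul' _ _ (ENNReal.mul_ne_top hk.eLpNorm_ne_top hφ.eLpNorm_ne_top)]
  exact ENNReal.mul_lt_top (ENNReal.mul_lt_top hk.eLpNorm_lt_top hφ.eLpNorm_lt_top)
    f.integrable.2

lemma integrable_conv_integrand {k : E d → ℝ}
    (hk : ∃ k₁ k₂ : E d → ℝ, MemLp k₁ 1 volume ∧ MemLp k₂ 2 volume ∧ k = k₁ + k₂)
    (φ f : 𝓢(E d, ℂ)) :
    Integrable fun z : E d × E d => φ (z.1 + z.2) * (k z.1 : ℂ) * f z.2 := by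
  obtain ⟨k₁, k₂, h1, h2, rfl⟩ := hk
  refine ((integrable_conv_integrand_of_memLp (q := ∞) h1 φ f).add
    (integrable_conv_integrand_of_memLp (q := 2) h2 φ f)).congr (ae_of_all _ fun z => ?_)
  simp only [Pi.add_apply]
  push_cast
  ring

/-- The product of Schwartz functions. -/
lemma exists_schwartz_mul (φ f : 𝓢(E d, ℂ)) : ∃ ψ : 𝓢(E d, ℂ), ∀ x, ψ x = φ x * f x :=
  ⟨SchwartzMap.smulLeftCLM ℂ φ f, fun x => by
    rw [SchwartzMap.smulLeftCLM_apply_apply φ.hasTemperateGrowth, smul_eq_mul]⟩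

lemma fourier_modulate (χ : E d → ℂ) (z y : E d) :
    𝓕 (fun ξ => phase (-z) ξ * χ ξ) y = 𝓕 χ (z + y) := by
  rw [Real.fourier_eq', Real.fourier_eq']
  refine integral_congr_ae (ae_of_all _ fun ξ => ?_)
  simp only [smul_eq_mul]
  rw [← mul_assoc, phase, ← Complex.exp_add]
  congr 2
  rw [inner_add_right, inner_neg_left, real_inner_comm z]
  push_cast
  ring

/-- The translation by `z` is a phase on χ; then the Fourier transform is moved from χ to `f`. -/
lemma integral_shift_mul_eq (χ f ψ : 𝓢(E d, ℂ)) (hψ : ∀ x, ψ x = χ x * (𝓕 f : 𝓢(E d, ℂ)) x)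
    (z : E d) :
    ∫ y, (𝓕 χ : 𝓢(E d, ℂ)) (z + y) * f y = (𝓕 ψ : 𝓢(E d, ℂ)) z := by
  have hI : Integrable fun ξ => phase (-z) ξ * χ ξ :=
    χ.integrable.bdd_mul (c := 1) (contDiff_phase (n := 0) _).continuous.aestronglyMeasurable
      (ae_of_all _ fun ξ => (norm_phase _ ξ).le)
  have h := VectorFourier.integral_fourierIntegral_smul_eq_flip (L := innerₗ (E d))
    Real.continuous_fourierChar continuous_inner (μ := (volume : Measure (E d)))
    (ν := (volume : Measure (E d))) hI f.integrable
  have hflip : (innerₗ (E d)).flip = innerₗ (E d) := by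
    ext x y; simp
  rw [hflip] at h
  have h1 : ∀ y, VectorFourier.fourierIntegral Real.fourierChar volume (innerₗ (E d))
      (fun ξ => phase (-z) ξ * χ ξ) y = (𝓕 χ : 𝓢(E d, ℂ)) (z + y) := fun y => by
    rw [SchwartzMap.fourier_coe, ← fourier_modulate]
    rfl
  have h2 : ∀ ξ, VectorFourier.fourierIntegral Real.fourierChar volume (innerₗ (E d))
      f ξ = (𝓕 f : 𝓢(E d, ℂ)) ξ := fun ξ => by
    rw [SchwartzMap.fourier_coe]; rfl
  simp_rw [h1, h2, smul_eq_mul] at h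
  rw [h, SchwartzMap.fourier_coe ψ, Real.fourier_eq']
  refine integral_congr_ae (ae_of_all _ fun ξ => ?_)
  simp only [smul_eq_mul]
  rw [hψ, phase, mul_assoc]
  congr 2
  rw [inner_neg_left, real_inner_comm]
  push_cast
  ring

/-- The convolution with a Schwartz function is a multiplication in Fourier space. -/
lemma integral_mul_conv {k : E d → ℝ}
    (hk : ∃ k₁ k₂ : E d → ℝ, MemLp k₁ 1 volume ∧ MemLp k₂ 2 volume ∧ k = k₁ + k₂)
    (χ f ψ : 𝓢(E d, ℂ)) (hψ : ∀ x, ψ x = χ x * (𝓕 f : 𝓢(E d, ℂ)) x) :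
    Integrable (fun x => (𝓕 χ : 𝓢(E d, ℂ)) x * ∫ y, (k (x - y) : ℂ) * f y) ∧
      ∫ x, (𝓕 χ : 𝓢(E d, ℂ)) x * ∫ y, (k (x - y) : ℂ) * f y =
        ∫ z, (𝓕 ψ : 𝓢(E d, ℂ)) z * (k z : ℂ) := by
  set φ : 𝓢(E d, ℂ) := 𝓕 χ with hφ
  set Φ : E d × E d → ℂ := fun z => φ (z.1 + z.2) * (k z.1 : ℂ) * f z.2 with hΦ
  have hI : Integrable Φ := integrable_conv_integrand hk φ f
  -- The shear (x, y) ↦ (x - y, y) separates the kernel from the test function, and Fubini is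
  -- applied on both sides of it.
  have hmp : MeasurePreserving (fun z : E d × E d => (z.1 - z.2, z.2))
      (volume.prod volume) (volume.prod volume) := measurePreserving_sub_prod volume volume
  have hI' : Integrable (fun z : E d × E d => Φ (z.1 - z.2, z.2)) (volume.prod volume) :=
    hmp.integrable_comp_of_integrable hI
  have e1 : ∀ x, ∫ y, Φ (x - y, y) = φ x * ∫ y, (k (x - y) : ℂ) * f y := fun x => by
    rw [← integral_const_mul]
    refine integral_congr_ae (ae_of_all _ fun y => ?_)
    simp only [hΦ, sub_add_cancel, mul_assoc]
  have e2 : ∀ z, ∫ y, Φ (z, y) = (𝓕 ψ : 𝓢(E d, ℂ)) z * (k z : ℂ) := fun z => by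
    rw [← integral_shift_mul_eq χ f ψ hψ, ← integral_mul_const]
    refine integral_congr_ae (ae_of_all _ fun y => ?_)
    simp only [hΦ, hφ]
    ring
  have h1 : Integrable (fun x => ∫ y, Φ (x - y, y)) := hI'.integral_prod_left
  simp_rw [e1] at h1
  refine ⟨h1, ?_⟩
  calc _ = ∫ x, ∫ y, Φ (x - y, y) := by simp_rw [e1]
    _ = ∫ z : E d × E d, Φ (z.1 - z.2, z.2) ∂(volume.prod volume) := (integral_prod _ hI').symm
    _ = ∫ z : E d × E d, Φ z ∂(volume.prod volume) := by
      conv_rhs => rw [← hmp.map_eq]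
      rw [integral_map hmp.measurable.aemeasurable (by rw [hmp.map_eq]; exact hI.1)]
    _ = ∫ x, ∫ y, Φ (x, y) := integral_prod _ hI
    _ = _ := by simp_rw [e2]

lemma fourierRep_eq_of_forall {s : ℝ} {u : 𝓢'(E d, ℂ)} {F : E d → ℂ} (hF : MemLp F 2)
    (h : ∀ φ : 𝓢(E d, ℂ),
      𝓕 u φ = ∫ ξ, φ ξ * ((((1 + ‖ξ‖ ^ 2) ^ (-s / 2) : ℝ) : ℂ) * F ξ)) :
    MemSobolev s 2 u ∧ fourierRep s u = hF.toLp := by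
  obtain ⟨v, hv, hv'⟩ := exists_fourierRep_eq s hF.toLp
  have : u = v := eq_of_fourier_apply_eq fun φ => by
    rw [h, fourier_apply_eq_integral hv, hv']
    refine integral_congr_ae ?_
    filter_upwards [hF.coeFn_toLp] with ξ h1
    rw [h1]
  rw [this]
  exact ⟨hv, hv'⟩

lemma continuous_weight (s : ℝ) : Continuous fun ξ : E d => (1 + ‖ξ‖ ^ 2) ^ s :=
  Continuous.rpow_const (by fun_prop) fun ξ => Or.inl (by positivity)

lemma fourier_schwartz_apply (f φ : 𝓢(E d, ℂ)) :
    𝓕 (f : 𝓢'(E d, ℂ)) φ = ∫ ξ, φ ξ * (𝓕 f : 𝓢(E d, ℂ)) ξ := by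
  rw [TemperedDistribution.fourier_toTemperedDistributionCLM_eq]
  refine (SchwartzMap.toTemperedDistributionCLM_apply_apply volume _ _).trans ?_
  simp_rw [smul_eq_mul]

/-- A Schwartz function as an element of `H⁻¹`. -/
lemma fourierRep_schwartz (f : 𝓢(E d, ℂ)) :
    MemSobolev (-1) 2 (f : 𝓢'(E d, ℂ)) ∧ fourierRep (-1) (f : 𝓢'(E d, ℂ)) =ᵐ[volume]
      fun ξ => (((1 + ‖ξ‖ ^ 2) ^ (-1 / 2 : ℝ) : ℝ) : ℂ) * (𝓕 f : 𝓢(E d, ℂ)) ξ := by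
  have hF : MemLp (fun ξ => (((1 + ‖ξ‖ ^ 2) ^ (-1 / 2 : ℝ) : ℝ) : ℂ) *
      (𝓕 f : 𝓢(E d, ℂ)) ξ) 2 := by
    have hf : MemLp (𝓕 f : 𝓢(E d, ℂ)) 2 (volume : Measure (E d)) := (𝓕 f : 𝓢(E d, ℂ)).memLp 2
    refine hf.of_le (Continuous.aestronglyMeasurable ?_)
      (ae_of_all _ fun ξ => ?_)
    · exact (Complex.continuous_ofReal.comp (continuous_weight _)).mul (𝓕 f : 𝓢(E d, ℂ)).continuous
    · rw [norm_mul, Complex.norm_real, Real.norm_of_nonneg (by positivity)]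
      refine mul_le_of_le_one_left (norm_nonneg _) ?_
      exact Real.rpow_le_one_of_one_le_of_nonpos (by linarith [sq_nonneg ‖ξ‖]) (by norm_num)
  obtain ⟨h1, h2⟩ := fourierRep_eq_of_forall (s := -1) (u := (f : 𝓢'(E d, ℂ))) hF fun φ => by
    rw [fourier_schwartz_apply]
    refine integral_congr_ae (ae_of_all _ fun ξ => ?_)
    have : (((1 + ‖ξ‖ ^ 2) ^ (- -1 / 2 : ℝ) : ℝ) : ℂ) *
        (((1 + ‖ξ‖ ^ 2) ^ (-1 / 2 : ℝ) : ℝ) : ℂ) = 1 := by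
      rw [← Complex.ofReal_mul, ← Real.rpow_add (by positivity)]
      norm_num
    simp only [← mul_assoc (((1 + ‖ξ‖ ^ 2) ^ (- -1 / 2 : ℝ) : ℝ) : ℂ), this, one_mul]
  refine ⟨h1, ?_⟩
  rw [h2]
  exact hF.coeFn_toLp

/-! ### The convolution operator from `H⁻¹` to `H¹` -/

/-- The convolution with an admissible kernel acts as a positive bounded multiplication on the
Fourier representatives. -/
structure IsKernelMultiplier (k : E d → ℝ) (D : ℝ) (A : L2 d →L[ℂ] L2 d) (M : E d → ℝ) :
    Prop where
  apply_eq : ∀ F, A F =ᵐ[volume] fun ξ => (M ξ : ℂ) * F ξ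
  le : ∀ᵐ ξ, 1 / D ≤ M ξ
  exists_conv : ∀ f : 𝓢(E d, ℂ), ∃ w : 𝓢'(E d, ℂ),
    IsGivenBy w (fun x => ∫ y, (k (x - y) : ℂ) * f y) ∧ MemSobolev 1 2 w ∧
      fourierRep 1 w = A (fourierRep (-1) (f : 𝓢'(E d, ℂ)))

/-- The representatives in H⁻¹ and H¹ differ by the weight 1 + |ξ|², which compensates exactly the
decay of k̂: the multiplier k̂(ξ)(1 + |ξ|²) lies between 1/D and D. -/
lemma IsAdmissibleKernel.exists_multiplier {k : E d → ℝ} {D : ℝ} (hk : IsAdmissibleKernel k D)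
    (hD : 1 ≤ D) : ∃ A M, IsKernelMultiplier k D A M := by
  obtain ⟨T, m, hT, hm, hb, hmL, -⟩ := hk.fourier
  set M : E d → ℝ := fun ξ => m ξ * (1 + ‖ξ‖ ^ 2) with hM
  have hM1 : ∀ᵐ ξ, 1 / D ≤ M ξ ∧ M ξ ≤ D := by
    filter_upwards [hb] with ξ ⟨h1, h2⟩
    have hpos : (0 : ℝ) < 1 + ‖ξ‖ ^ 2 := by positivity
    constructor
    · have := mul_le_mul_of_nonneg_right h1 hpos.le
      rwa [mul_assoc, one_div_mul_cancel hpos.ne', mul_one] at this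
    · have := mul_le_mul_of_nonneg_right h2 hpos.le
      rwa [mul_assoc, one_div_mul_cancel hpos.ne', mul_one] at this
  have hMm : MemLp (fun ξ => (M ξ : ℂ)) ∞ := by
    refine memLp_top_of_bound (Complex.continuous_ofReal.comp_aestronglyMeasurable
      (hmL.1.mul (Continuous.aestronglyMeasurable (by fun_prop)))) D ?_
    filter_upwards [hM1] with ξ ⟨h1, h2⟩
    have : 0 ≤ M ξ := le_trans (by positivity) h1
    rwa [Complex.norm_real, Real.norm_of_nonneg this]
  refine ⟨(ContinuousLinearMap.mul ℂ ℂ).holderL volume ∞ 2 2 hMm.toLp, M, ⟨fun F => ?_,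
    hM1.mono fun _ h => h.1, fun f => ?_⟩⟩
  · filter_upwards [(ContinuousLinearMap.mul ℂ ℂ).coeFn_holder (r := 2) hMm.toLp F,
      hMm.coeFn_toLp] with ξ h1 h2
    rw [ContinuousLinearMap.holderL_apply_apply, h1, h2]
    rfl
  · set A := (ContinuousLinearMap.mul ℂ ℂ).holderL volume ∞ 2 2 hMm.toLp
    obtain ⟨w, hw, hw'⟩ := exists_fourierRep_eq 1 (A (fourierRep (-1) (f : 𝓢'(E d, ℂ))))
    refine ⟨w, fun φ => ?_, hw, hw'⟩
    set χ : 𝓢(E d, ℂ) := 𝓕⁻ φ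
    have hφ : φ = 𝓕 χ := (fourier_fourierInv_eq φ).symm
    obtain ⟨ψ, hψ⟩ := exists_schwartz_mul χ (𝓕 f : 𝓢(E d, ℂ))
    obtain ⟨h1, h2⟩ := integral_mul_conv hk.mem_L1_add_L2 χ f ψ hψ
    rw [hφ]
    refine ⟨h1, ?_⟩
    rw [h2, ← (hT _).2, ← TemperedDistribution.fourier_apply T, (hm ψ).2,
      ← TemperedDistribution.fourier_apply w, fourier_apply_eq_integral hw, hw']
    refine integral_congr_ae ?_
    filter_upwards [(ContinuousLinearMap.mul ℂ ℂ).coeFn_holder (r := 2) hMm.toLp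
      (fourierRep (-1) (f : 𝓢'(E d, ℂ))), hMm.coeFn_toLp, (fourierRep_schwartz f).2]
      with ξ h3 h4 h5
    rw [ContinuousLinearMap.holderL_apply_apply, h3, h4, h5, hψ, ContinuousLinearMap.mul_apply']
    have h6 : (((1 + ‖ξ‖ ^ 2) ^ (-1 / 2 : ℝ) : ℝ) : ℂ) * (((1 + ‖ξ‖ ^ 2) ^ (-1 / 2 : ℝ) : ℝ) : ℂ) *
        (M ξ : ℂ) = (m ξ : ℂ) := by
      rw [← Complex.ofReal_mul, ← Complex.ofReal_mul, ← Real.rpow_add (by positivity), hM]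
      norm_num [Real.rpow_neg_one]
      have : (1 + (‖ξ‖ : ℂ) ^ 2) ≠ 0 := by
        have : (1 + ‖ξ‖ ^ 2 : ℝ) ≠ 0 := by positivity
        exact_mod_cast this
      field_simp
    rw [← h6]
    ring

lemma enorm_fourierRep_sub {s : ℝ} {u v : 𝓢'(E d, ℂ)} (hu : MemSobolev s 2 u)
    (hv : MemSobolev s 2 v) : sobolevNorm s (u - v) = ‖fourierRep s u - fourierRep s v‖ₑ := by
  rw [sobolevNorm_of_mem (hu.sub hv), besselRep_sub hu hv, ← ofReal_norm, ← ofReal_norm,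
    fourierRep, fourierRep, ← Lp.norm_fourier_eq, sub_eq_add_neg, sub_eq_add_neg,
    FourierTransform.fourier_add, FourierTransform.fourier_neg]

lemma tendsto_sobolevNorm_sub {s : ℝ} {u : ℕ → 𝓢'(E d, ℂ)} {v : 𝓢'(E d, ℂ)}
    (hu : ∀ n, MemSobolev s 2 (u n)) (hv : MemSobolev s 2 v) :
    Filter.Tendsto (fun n => sobolevNorm s (u n - v)) Filter.atTop (𝓝 0) ↔
      Filter.Tendsto (fun n => fourierRep s (u n)) Filter.atTop (𝓝 (fourierRep s v)) := by
  simp_rw [enorm_fourierRep_sub (hu _) hv, ← edist_eq_enorm_sub]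
  exact (tendsto_iff_edist_tendsto_0).symm

lemma exists_schwartz_fourierRep (h : 𝓢(E d, ℂ)) :
    ∃ f : 𝓢(E d, ℂ), fourierRep (-1) (f : 𝓢'(E d, ℂ)) = h.toLp 2 := by
  have hw : (fun ξ : E d => (((1 + ‖ξ‖ ^ 2) ^ (1 / 2 : ℝ) : ℝ) : ℂ)).HasTemperateGrowth := by
    fun_prop
  set g : 𝓢(E d, ℂ) :=
    SchwartzMap.smulLeftCLM ℂ (fun ξ : E d => (((1 + ‖ξ‖ ^ 2) ^ (1 / 2 : ℝ) : ℝ) : ℂ)) h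
  refine ⟨𝓕⁻ g, Lp.ext ?_⟩
  filter_upwards [(fourierRep_schwartz (𝓕⁻ g)).2, h.coeFn_toLp 2] with ξ h1 h2
  rw [h1, h2, fourier_fourierInv_eq, SchwartzMap.smulLeftCLM_apply_apply hw, smul_eq_mul,
    ← mul_assoc, ← Complex.ofReal_mul, ← Real.rpow_add (by positivity)]
  norm_num

/-- Schwartz functions are dense in H⁻¹, since their weighted Fourier transforms are arbitrary
Schwartz functions in L², and `A` is continuous. -/
lemma IsKernelMultiplier.exists_isKernelConv {k : E d → ℝ} {D : ℝ} {A : L2 d →L[ℂ] L2 d}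
    {M : E d → ℝ} (H : IsKernelMultiplier k D A M) {u : 𝓢'(E d, ℂ)} (hu : MemSobolev (-1) 2 u) :
    ∃ v, IsKernelConv k u v := by
  obtain ⟨v, hv, hv'⟩ := exists_fourierRep_eq 1 (A (fourierRep (-1) u))
  have hdense : DenseRange (SchwartzMap.toLpCLM ℂ ℂ 2 (volume : Measure (E d))) :=
    SchwartzMap.denseRange_toLpCLM ENNReal.ofNat_ne_top
  obtain ⟨h, hmem, hlim⟩ := mem_closure_iff_seq_limit.1 (hdense (fourierRep (-1) u))
  choose h' hh' using hmem
  choose f hf using fun n => exists_schwartz_fourierRep (h' n)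
  choose w hw using fun n => H.exists_conv (f n)
  have hlim' : Filter.Tendsto (fun n => fourierRep (-1) (f n : 𝓢'(E d, ℂ))) Filter.atTop
      (𝓝 (fourierRep (-1) u)) := by
    refine hlim.congr fun n => ?_
    rw [hf, ← hh']
    rfl
  refine ⟨v, f, w, fun n => (hw n).1,
    (tendsto_sobolevNorm_sub (fun n => (fourierRep_schwartz (f n)).1) hu).2 hlim',
    (tendsto_sobolevNorm_sub (fun n => (hw n).2.1) hv).2 ?_⟩
  simp_rw [(hw _).2.2, hv']
  exact (A.continuous.tendsto _).comp hlim'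

/-- Every admissible limit is given by the multiplier, so the convolution does not depend on the
approximating sequence. -/
lemma IsKernelMultiplier.fourierRep_eq {k : E d → ℝ} {D : ℝ} {A : L2 d →L[ℂ] L2 d}
    {M : E d → ℝ} (H : IsKernelMultiplier k D A M) {u v : 𝓢'(E d, ℂ)} (hu : MemSobolev (-1) 2 u)
    (huv : IsKernelConv k u v) : MemSobolev 1 2 v ∧ fourierRep 1 v = A (fourierRep (-1) u) := by
  obtain ⟨f, w, hw, hfu, hwv⟩ := huv
  have hw' : ∀ n, MemSobolev 1 2 (w n) ∧
      fourierRep 1 (w n) = A (fourierRep (-1) (f n : 𝓢'(E d, ℂ))) := fun n => by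
    obtain ⟨w₁, h1, h2⟩ := H.exists_conv (f n)
    rwa [(hw n).unique h1]
  have hv : MemSobolev 1 2 v := by
    -- The norm is ∞ off H¹, so one finite value already forces membership.
    obtain ⟨n, hn⟩ := (hwv.eventually (gt_mem_nhds ENNReal.zero_lt_top)).exists
    have hmem : MemSobolev 1 2 (w n - v) := by
      by_contra hcon
      rw [sobolevNorm, if_neg hcon] at hn
      exact lt_irrefl _ hn
    have := (hw' n).1.sub hmem
    rwa [sub_sub_cancel] at this
  refine ⟨hv, ?_⟩
  have h1 := (tendsto_sobolevNorm_sub (fun n => (hw' n).1) hv).1 hwv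
  have h2 := (tendsto_sobolevNorm_sub (fun n => (fourierRep_schwartz (f n)).1) hu).1 hfu
  simp_rw [(hw' _).2] at h1
  exact tendsto_nhds_unique h1 ((A.continuous.tendsto _).comp h2)

/-- The convolution of an element of `H⁻¹` with an admissible kernel. -/
lemma IsAdmissibleKernel.isKernelConv {k : E d → ℝ} {D : ℝ} (hk : IsAdmissibleKernel k D)
    (hD : 1 ≤ D) {u : 𝓢'(E d, ℂ)} (hu : MemSobolev (-1) 2 u) :
    IsKernelConv k u (kernelConv k u) ∧ MemSobolev 1 2 (kernelConv k u) := by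
  obtain ⟨A, M, H⟩ := hk.exists_multiplier hD
  have hex := H.exists_isKernelConv hu
  have h1 : IsKernelConv k u (kernelConv k u) := by
    rw [kernelConv, dif_pos hex]
    exact hex.choose_spec
  exact ⟨h1, (H.fourierRep_eq hu h1).1⟩

/-- Coercivity of the duality pairing with the convolution. -/
lemma IsAdmissibleKernel.le_re_dualityPairing {k : E d → ℝ} {D : ℝ} (hk : IsAdmissibleKernel k D)
    (hD : 1 ≤ D) {u : 𝓢'(E d, ℂ)} (hu : MemSobolev (-1) 2 u) :
    1 / D * ‖besselRep (-1) u‖ ^ 2 ≤ (dualityPairing 1 u (kernelConv k u)).re := by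
  obtain ⟨A, M, H⟩ := hk.exists_multiplier hD
  have h1 := (H.fourierRep_eq hu (hk.isKernelConv hD hu).1).2
  -- By Plancherel the pairing becomes the integral of M times the squared modulus of the
  -- representative.
  have h2 : dualityPairing 1 u (kernelConv k u) =
      inner ℂ (A (fourierRep (-1) u)) (fourierRep (-1) u) := by
    rw [← h1, fourierRep, fourierRep, Lp.inner_fourier_eq]
    rfl
  have h3 : ∀ᵐ ξ, RCLike.re (inner ℂ (A (fourierRep (-1) u) ξ) (fourierRep (-1) u ξ)) =
      M ξ * ‖fourierRep (-1) u ξ‖ ^ 2 := by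
    filter_upwards [H.apply_eq (fourierRep (-1) u)] with ξ hξ
    rw [hξ, Complex.sq_norm, Complex.normSq_apply]
    simp
    ring
  have hI : Integrable fun ξ => M ξ * ‖fourierRep (-1) u ξ‖ ^ 2 :=
    (L2.integrable_inner (𝕜 := ℂ) (A (fourierRep (-1) u)) (fourierRep (-1) u)).re.congr h3
  rw [h2, L2.inner_def]
  have h4 := integral_re (L2.integrable_inner (𝕜 := ℂ) (A (fourierRep (-1) u))
    (fourierRep (-1) u))
  rw [integral_congr_ae h3] at h4
  refine le_trans ?_ h4.le
  rw [← norm_fourierRep, norm_sq_eq_integral, ← integral_const_mul]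
  refine integral_mono_ae (((memLp_two_iff_integrable_sq_norm (Lp.aestronglyMeasurable _)).1
    (Lp.memLp _)).const_mul _) hI ?_
  filter_upwards [H.le] with ξ hξ
  gcongr

/-- The dissipation controls the `H⁻¹` norm of the weighted gradient. -/
lemma sum_norm_sq_le_dissipation {k : E d → ℝ} {D : ℝ} (hk : IsAdmissibleKernel k D)
    (hD : 1 ≤ D) {V : E d → ℝ} {S : Matrix (Fin d) (Fin d) ℝ} {μ : E d} {ρ : E d → ℝ}
    (hS : S.PosDef) (h : IsRegular V S μ ρ) :
    ∑ i, ‖besselRep (-1) (weightedGradient V S μ ρ i)‖ ^ 2 ≤ D * dissipation k V S μ ρ := by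
  rw [dissipation, Complex.re_sum, Finset.mul_sum]
  refine Finset.sum_le_sum fun i _ => ?_
  have := hk.le_re_dualityPairing hD (h.memSobolev hS i)
  rwa [one_div, inv_mul_le_iff₀ (by positivity)] at this

/-! ### The Kullback-Leibler divergence -/

lemma LocallyBounded.aestronglyMeasurable {V : E d → ℝ} (hV : LocallyBounded V) :
    AEStronglyMeasurable V volume := by
  have h : AEStronglyMeasurable V
      (volume.restrict (⋃ n : ℕ, Metric.closedBall (0 : E d) n)) :=
    aestronglyMeasurable_iUnion_iff.2 fun n => (hV _ (isCompact_closedBall _ _)).1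
  rwa [Metric.iUnion_closedBall_nat, Measure.restrict_univ] at h

lemma LocallyBounded.exists_ae_le {V : E d → ℝ} (hV : LocallyBounded V) {K : Set (E d)}
    (hK : IsCompact K) : ∃ M : ℝ, ∀ᵐ x ∂(volume.restrict K), V x ≤ M := by
  have h := hV K hK
  refine ⟨(eLpNorm V ∞ (volume.restrict K)).toReal, ?_⟩
  filter_upwards [ae_le_eLpNormEssSup (f := V) (μ := volume.restrict K)] with x hx
  rw [← eLpNorm_exponent_top, ← ofReal_norm,
    ENNReal.ofReal_le_iff_le_toReal h.eLpNorm_ne_top] at hx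
  exact (le_abs_self _).trans hx

lemma V₀_nonneg {S : Matrix (Fin d) (Fin d) ℝ} (hS : S.PosDef) (μ x : E d) : 0 ≤ V₀ S μ x := by
  obtain ⟨a, ha, h⟩ := exists_quadForm_ge hS.inv
  rw [V₀_eq]
  have := (mul_nonneg ha.le (sq_nonneg ‖x - μ‖)).trans (h (x - μ))
  linarith

lemma integrable_exp_neg_of_le {V : E d → ℝ} {S : Matrix (Fin d) (Fin d) ℝ} {μ : E d} {c : ℝ}
    (hV : AEStronglyMeasurable V volume) (hS : S.PosDef)
    (hc : ∀ᵐ x : E d, c + V₀ S μ x ≤ V x) : Integrable fun x => Real.exp (-V x) := by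
  have h1 : Integrable fun x : E d => Real.exp (-c) * Real.exp (-(1 / 2) * quadForm S⁻¹ (x - μ)) :=
    ((integrable_exp_neg_quadForm hS.inv (c := 1 / 2) (by norm_num)).comp_sub_right μ).const_mul _
  refine h1.mono' (Real.continuous_exp.comp_aestronglyMeasurable hV.neg) ?_
  filter_upwards [hc] with x hx
  rw [Real.norm_eq_abs, Real.abs_exp, ← Real.exp_add]
  rw [V₀_eq] at hx
  exact Real.exp_le_exp.2 (by linarith)

/-- From log x ≤ x - 1. Integrated, this is the bound of the relative entropy by the χ² divergence.
-/
lemma klFun_le_sq {x : ℝ} (hx : 0 ≤ x) : InformationTheory.klFun x ≤ (x - 1) ^ 2 := by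
  rw [InformationTheory.klFun_apply]
  rcases hx.eq_or_lt with rfl | hx
  · simp
  · nlinarith [Real.log_le_sub_one_of_pos hx]

/-- The relative entropy is bounded by the weighted `L²` distance to the multiples of the
target. -/
lemma klDiv_le {V : E d → ℝ} {S : Matrix (Fin d) (Fin d) ℝ} {μ : E d} {c : ℝ}
    (hV : AEStronglyMeasurable V volume) (hS : S.PosDef)
    (hc : ∀ᵐ x : E d, c + V₀ S μ x ≤ V x) {ρ : E d → ℝ} (hρ : IsRegular V S μ ρ)
    (h0 : ∀ᵐ x : E d, 0 ≤ ρ x) (h1 : ∫ x, ρ x = 1) (t : ℝ) :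
    InformationTheory.klDiv (volume.withDensity fun x => ENNReal.ofReal (ρ x)) (target V) ≤
      ENNReal.ofReal ((∫ x, Real.exp (-V x)) * Real.exp (-c) *
        ∫ x, |weighted V S μ ρ x - t * halfGaussian S μ x| ^ 2) := by
  set Z := ∫ x, Real.exp (-V x) with hZ
  have hI := integrable_exp_neg_of_le hV hS hc
  have hZ0 : 0 < Z := integral_exp_pos hI
  set p : E d → ℝ := fun x => Real.exp (-V x) / Z with hp
  -- `r` is the density of ρ with respect to the target.
  set r : E d → ℝ := fun x => Z * (ρ x * Real.exp (V x)) with hr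
  have hp0 : ∀ x, 0 < p x := fun x => by positivity
  have hpI : Integrable p := hI.div_const Z
  have hp1 : ∫ x, p x = 1 := by rw [hp, integral_div, div_self hZ0.ne']
  have hpr : ∀ x, p x * r x = ρ x := fun x => by
    simp only [hp, hr]
    rw [Real.exp_neg]
    field_simp
  have hrm : AEStronglyMeasurable r volume :=
    (hρ.integrable.1.mul (Real.continuous_exp.comp_aestronglyMeasurable hV)).const_mul Z
  have htarget : target V = volume.withDensity fun x => ENNReal.ofReal (p x) := rfl
  have hpm : AEMeasurable (fun x => ENNReal.ofReal (p x)) := hpI.1.aemeasurable.ennreal_ofReal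
  have hac : target V ≪ volume := withDensity_absolutelyContinuous _ _
  have hfin : IsFiniteMeasure (target V) := isFiniteMeasure_withDensity_ofReal hpI.2
  have hdens : (volume.withDensity fun x => ENNReal.ofReal (ρ x)) =
      (target V).withDensity fun x => ENNReal.ofReal (r x) := by
    rw [htarget, ← withDensity_mul₀ hpm hrm.aemeasurable.ennreal_ofReal]
    congr 1
    funext x
    rw [Pi.mul_apply, ← ENNReal.ofReal_mul (hp0 x).le, hpr]
  have hrn : ((target V).withDensity fun x => ENNReal.ofReal (r x)).rnDeriv (target V)
      =ᵐ[target V] fun x => ENNReal.ofReal (r x) :=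
    Measure.rnDeriv_withDensity₀ _ (hrm.aemeasurable.ennreal_ofReal.mono_ac hac)
  have hr0 : ∀ᵐ x ∂(target V), 0 ≤ r x := by
    refine hac.ae_le ?_
    filter_upwards [h0] with x hx
    simp only [hr]
    positivity
  set f : E d → ℝ := fun x => |weighted V S μ ρ x - t * halfGaussian S μ x| ^ 2 with hf
  have hfI : Integrable f := by
    simp_rw [hf, sq_abs]
    exact (hρ.memLp_weighted.sub ((memLp_halfGaussian hS μ).const_mul t)).integrable_sq
  -- The two weights differ by the factor e^{V₀ - V}, at most e^{-c}.
  have hle : ∀ᵐ x, p x * (r x - Z * t) ^ 2 ≤ Z * Real.exp (-c) * f x := by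
    filter_upwards [hc] with x hx
    have e1 : p x * (r x - Z * t) ^ 2 = Z * (Real.exp (V₀ S μ x - V x) * f x) := by
      have e2 : weighted V S μ ρ x - t * halfGaussian S μ x =
          (ρ x * Real.exp (V x) - t) * halfGaussian S μ x := by
        rw [weighted, halfGaussian, sub_mul, mul_assoc (ρ x), ← Real.exp_add]
        congr 4
        ring
      have e3 : Real.exp (V₀ S μ x - V x) * halfGaussian S μ x ^ 2 = Real.exp (-V x) := by
        rw [halfGaussian, ← Real.exp_nat_mul, ← Real.exp_add]
        congr 1
        push_cast
        ring
      simp only [hf, hp, hr]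
      rw [sq_abs, e2, ← e3]
      field_simp
    rw [e1, mul_assoc]
    have : Real.exp (V₀ S μ x - V x) ≤ Real.exp (-c) := Real.exp_le_exp.2 (by linarith)
    have hf0 : 0 ≤ f x := by positivity
    gcongr
  have hgI : Integrable fun x => p x * (r x - Z * t) ^ 2 := by
    refine (hfI.const_mul (Z * Real.exp (-c))).mono' ?_ ?_
    · exact hpI.1.mul ((hrm.sub aestronglyMeasurable_const).pow 2)
    · filter_upwards [hle] with x hx
      rwa [Real.norm_of_nonneg (mul_nonneg (hp0 x).le (sq_nonneg _))]
  have hexp : ∀ x, p x * (r x - 1) ^ 2 =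
      p x * (r x - Z * t) ^ 2 + (2 * (Z * t - 1) * ρ x + (1 - (Z * t) ^ 2) * p x) := fun x => by
    rw [← hpr x]; ring
  have hI2 : Integrable fun x => 2 * (Z * t - 1) * ρ x + (1 - (Z * t) ^ 2) * p x :=
    (hρ.integrable.const_mul _).add (hpI.const_mul _)
  have hI3 : Integrable fun x => p x * (r x - 1) ^ 2 := by
    simp_rw [hexp]
    exact hgI.add hI2
  have hbound : ∫ x, p x * (r x - 1) ^ 2 ≤ Z * Real.exp (-c) * ∫ x, f x := by
    -- Under the target `r` has mean 1, the constant that minimizes the quadratic deviation; any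
    -- other constant Z t may therefore be used instead.
    have e : ∫ x, p x * (r x - 1) ^ 2 = (∫ x, p x * (r x - Z * t) ^ 2) - (Z * t - 1) ^ 2 := by
      simp_rw [hexp]
      rw [integral_add hgI hI2, integral_add (hρ.integrable.const_mul _) (hpI.const_mul _),
        integral_const_mul, integral_const_mul, h1, hp1]
      ring
    rw [e]
    have := integral_mono_ae hgI (hfI.const_mul (Z * Real.exp (-c))) hle
    rw [integral_const_mul] at this
    linarith [sq_nonneg (Z * t - 1)]
  have hfin' : IsFiniteMeasure (volume.withDensity fun x => ENNReal.ofReal (ρ x)) :=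
    isFiniteMeasure_withDensity_ofReal hρ.integrable.2
  rw [hdens] at hfin' ⊢
  rw [InformationTheory.klDiv_eq_lintegral_klFun_of_ac (withDensity_absolutelyContinuous _ _)]
  calc _ ≤ ∫⁻ x, ENNReal.ofReal ((r x - 1) ^ 2) ∂(target V) := by
        refine lintegral_mono_ae ?_
        filter_upwards [hrn, hr0] with x hx hx0
        rw [hx, ENNReal.toReal_ofReal hx0]
        exact ENNReal.ofReal_le_ofReal (klFun_le_sq hx0)
    _ = ∫⁻ x, ENNReal.ofReal (p x * (r x - 1) ^ 2) := by
        rw [htarget, lintegral_withDensity_eq_lintegral_mul₀ hpm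
          ((hrm.aemeasurable.sub_const 1).pow_const 2).ennreal_ofReal]
        refine lintegral_congr fun x => ?_
        rw [Pi.mul_apply, ENNReal.ofReal_mul (hp0 x).le]
    _ = ENNReal.ofReal (∫ x, p x * (r x - 1) ^ 2) :=
        (ofReal_integral_eq_lintegral_ofReal hI3
          (ae_of_all _ fun x => mul_nonneg (hp0 x).le (sq_nonneg _))).symm
    _ ≤ _ := ENNReal.ofReal_le_ofReal hbound

/-! ### The bound in `L²` and `H⁻¹` -/

/-- Cauchy-Schwarz on a set: at `a = 0` the phase is 1, and the frequency functional serves here as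
an ordinary integral in physical space. -/
lemma setIntegral_abs_le {K : Set (E d)} {B : ℝ}
    (hB : ∀ f : L2 d, ‖freqFunctional K 0 f‖ ≤ B * ‖f‖) {f : E d → ℝ} (hf : MemLp f 2) :
    ∫ x in K, |f x| ≤ B * √(∫ x, f x ^ 2) := by
  have hf' : MemLp (fun x => |f x|) 2 := hf.abs
  have h1 : freqFunctional K 0 (complexL2 hf') = ((∫ x in K, |f x| : ℝ) : ℂ) := by
    rw [← integral_complex_ofReal]
    refine integral_congr_ae (ae_restrict_of_ae ?_)
    filter_upwards [coeFn_complexL2 hf'] with x hx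
    rw [modulated, hx, phase]
    simp
  have h2 : ‖complexL2 hf'‖ = √(∫ x, f x ^ 2) := by
    rw [eq_comm, Real.sqrt_eq_iff_eq_sq (integral_nonneg fun x => sq_nonneg _) (norm_nonneg _),
      norm_sq_complexL2]
    simp_rw [sq_abs]
  have h3 := hB (complexL2 hf')
  rw [h1, h2, Complex.norm_real] at h3
  exact (le_abs_self _).trans h3

/-- The multiple of the ground state is controlled by the mass and the `L²` distance. -/
lemma exists_abs_le {V : E d → ℝ} {S : Matrix (Fin d) (Fin d) ℝ} (hV : LocallyBounded V)
    (hS : S.PosDef) (μ : E d) :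
    ∃ K : ℝ, 0 ≤ K ∧ ∀ ρ : E d → ℝ, IsRegular V S μ ρ → ∀ t : ℝ,
      |t| ≤ K * ((∫ x, |ρ x|) +
        √(∫ x, (weighted V S μ ρ x - t * halfGaussian S μ x) ^ 2)) := by
  set U : Set (E d) := Metric.closedBall 0 1
  have hU : IsCompact U := isCompact_closedBall _ _
  have hUfin : volume U ≠ ∞ := hU.measure_lt_top.ne
  have : IsFiniteMeasure (volume.restrict U) := ⟨by simpa using hU.measure_lt_top⟩
  obtain ⟨M, hM⟩ := hV.exists_ae_le hU
  obtain ⟨B, hB0, hB⟩ := exists_norm_freqFunctional_le hU.measurableSet hUfin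
  have hg := memLp_halfGaussian hS μ
  have hgI : IntegrableOn (halfGaussian S μ) U := (hg.restrict U).integrable one_le_two
  set γ := ∫ x in U, halfGaussian S μ x with hγ
  have hγ0 : 0 < γ := by
    rw [hγ, integral_pos_iff_support_of_nonneg (fun x => (halfGaussian_pos S μ x).le) hgI]
    have : Function.support (halfGaussian S μ) = Set.univ := by
      ext x; simp [(halfGaussian_pos S μ x).ne']
    rw [this]
    simpa using Metric.measure_closedBall_pos volume (0 : E d) one_pos
  refine ⟨(Real.exp M + B) / γ, by positivity, fun ρ hρ t => ?_⟩
  have hf : MemLp (fun x => weighted V S μ ρ x - t * halfGaussian S μ x) 2 :=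
    hρ.memLp_weighted.sub (hg.const_mul t)
  have hfI : IntegrableOn (fun x => |weighted V S μ ρ x - t * halfGaussian S μ x|) U :=
    ((hf.restrict U).integrable one_le_two).abs
  -- On the ball V ≤ M and V₀ ≥ 0 give |w| ≤ e^M |ρ|. Integrating |t| e^{-V₀/2} ≤ |w| + |w - t
  -- e^{-V₀/2}| there bounds `t` by the mass and the L² distance.
  have h1 : |t| * γ ≤ Real.exp M * (∫ x, |ρ x|) +
      B * √(∫ x, (weighted V S μ ρ x - t * halfGaussian S μ x) ^ 2) := by
    rw [hγ, ← integral_const_mul]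
    have hρI : IntegrableOn (fun x => Real.exp M * |ρ x|) U :=
      (hρ.integrable.abs.const_mul _).integrableOn
    calc ∫ x in U, |t| * halfGaussian S μ x ≤ ∫ x in U, (Real.exp M * |ρ x| +
          |weighted V S μ ρ x - t * halfGaussian S μ x|) := by
          refine integral_mono_ae (hgI.const_mul _) (hρI.add hfI) ?_
          filter_upwards [hM] with x hx
          have h2 : |weighted V S μ ρ x| ≤ Real.exp M * |ρ x| := by
            rw [weighted, abs_mul, Real.abs_exp, mul_comm]
            gcongr
            linarith [V₀_nonneg hS μ x]
          have h3 : |t * halfGaussian S μ x| = |t| * halfGaussian S μ x := by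
            rw [abs_mul, abs_of_pos (halfGaussian_pos S μ x)]
          have h4 := abs_sub_abs_le_abs_sub (t * halfGaussian S μ x) (weighted V S μ ρ x)
          rw [abs_sub_comm (t * halfGaussian S μ x)] at h4
          linarith
      _ = Real.exp M * (∫ x in U, |ρ x|) +
          ∫ x in U, |weighted V S μ ρ x - t * halfGaussian S μ x| := by
          rw [integral_add hρI hfI, integral_const_mul]
      _ ≤ _ := by
          refine add_le_add (mul_le_mul_of_nonneg_left ?_ (Real.exp_pos M).le)
            (setIntegral_abs_le (hB 0) hf)
          exact setIntegral_le_integral hρ.integrable.abs (ae_of_all _ fun x => abs_nonneg _)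
  rw [div_mul_eq_mul_div, le_div_iff₀ hγ0]
  refine h1.trans ?_
  have h5 : 0 ≤ ∫ x, |ρ x| := integral_nonneg fun x => abs_nonneg _
  have h6 := Real.sqrt_nonneg (∫ x, (weighted V S μ ρ x - t * halfGaussian S μ x) ^ 2)
  nlinarith [mul_nonneg hB0 h5, mul_nonneg (Real.exp_pos M).le h6]

lemma eLpNorm_sq_eq {f : E d → ℝ} (hf : MemLp f 2) :
    eLpNorm f 2 volume ^ 2 = ENNReal.ofReal (∫ x, f x ^ 2) := by
  rw [← norm_sq_complexL2 hf, complexL2, Lp.norm_toLp, ENNReal.ofReal_pow ENNReal.toReal_nonneg,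
    ENNReal.ofReal_toReal (MemLp.complex hf).eLpNorm_ne_top]
  congr 1
  refine eLpNorm_congr_norm_ae (ae_of_all _ fun x => ?_)
  rw [Complex.norm_real]

lemma integral_sq_le {f g : E d → ℝ} (hf : MemLp f 2) (hg : MemLp g 2) (t : ℝ) :
    ∫ x, f x ^ 2 ≤ 2 * (∫ x, (f x - t * g x) ^ 2) + 2 * t ^ 2 * ∫ x, g x ^ 2 := by
  have h1 : Integrable fun x => 2 * (f x - t * g x) ^ 2 :=
    (hf.sub (hg.const_mul t)).integrable_sq.const_mul 2
  have h2 : Integrable fun x => 2 * t ^ 2 * g x ^ 2 := hg.integrable_sq.const_mul _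
  rw [← integral_const_mul, ← integral_const_mul, ← integral_add h1 h2]
  refine integral_mono hf.integrable_sq (h1.add h2) fun x => ?_
  change f x ^ 2 ≤ 2 * (f x - t * g x) ^ 2 + 2 * t ^ 2 * g x ^ 2
  nlinarith [sq_nonneg (f x - 2 * (t * g x))]

/-- The bound of the `L²` and `H⁻¹` norms by the mass and the dissipation. -/
theorem exists_regularity_bound {V : E d → ℝ} {S : Matrix (Fin d) (Fin d) ℝ}
    (hV : LocallyBounded V) (hS : S.PosDef) (μ : E d) {k : E d → ℝ} {D : ℝ}
    (hk : IsAdmissibleKernel k D) (hD : 1 ≤ D) :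
    ∃ C : ℝ, 0 < C ∧ ∀ ρ : E d → ℝ, IsRegular V S μ ρ →
      eLpNorm (weighted V S μ ρ) 2 volume ^ 2 +
          ∑ i : Fin d, sobolevNorm (-1) (toTempered (weightedDrift V S μ ρ i)) ^ 2
        ≤ ENNReal.ofReal (C * ((∫ x, |ρ x|) ^ 2 + dissipation k V S μ ρ)) := by
  obtain ⟨C, hC, hgap⟩ := exists_integral_sub_tau_ellipsoid_le hS one_pos
  obtain ⟨K, hK0, hK⟩ := exists_abs_le hV hS μ
  have hg := memLp_halfGaussian hS μ
  set γ := ∫ x, halfGaussian S μ x ^ 2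
  have hγ : 0 ≤ γ := integral_nonneg fun x => sq_nonneg _
  -- Collects ‖w‖² ≤ 2J + 2t²γ, t² ≤ 2K²(N² + J) and J ≤ C D Δ.
  set C₁ := 4 * K ^ 2 * γ + (2 + 4 * K ^ 2 * γ) * (C * D) with hC₁
  refine ⟨C₁ + 8 * D + 32 * Real.pi ^ 2 * d * C₁ + 1, by positivity, fun ρ hρ => ?_⟩
  set t := tau (ellipsoid S 1) μ V S μ ρ
  set J := ∫ x, (weighted V S μ ρ x - t * halfGaussian S μ x) ^ 2 with hJ
  set Q := ∑ i, ‖besselRep (-1) (weightedGradient V S μ ρ i)‖ ^ 2 with hQ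
  set N := ∫ x, |ρ x|
  set Δ := dissipation k V S μ ρ
  have hQΔ : Q ≤ D * Δ := sum_norm_sq_le_dissipation hk hD hS hρ
  have hQ0 : 0 ≤ Q := Finset.sum_nonneg fun _ _ => sq_nonneg _
  have hJ0 : 0 ≤ J := integral_nonneg fun x => sq_nonneg _
  have hΔ : 0 ≤ Δ := nonneg_of_mul_nonneg_right (hQ0.trans hQΔ) (by linarith)
  have hJΔ : J ≤ C * D * Δ := by
    have h := hgap V μ ρ hρ
    simp_rw [sq_abs] at h
    calc J ≤ C * Q := h
      _ ≤ C * (D * Δ) := by gcongr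
      _ = _ := by ring
  have ht : t ^ 2 ≤ 2 * K ^ 2 * (N ^ 2 + J) := by
    have h := hK ρ hρ t
    have h' := pow_le_pow_left₀ (abs_nonneg t) h 2
    rw [sq_abs, mul_pow] at h'
    have hs : √J ^ 2 = J := Real.sq_sqrt hJ0
    have : (N + √J) ^ 2 ≤ 2 * (N ^ 2 + J) := by nlinarith [sq_nonneg (N - √J)]
    calc t ^ 2 ≤ K ^ 2 * (N + √J) ^ 2 := h'
      _ ≤ K ^ 2 * (2 * (N ^ 2 + J)) := by gcongr
      _ = _ := by ring
  have hw : ∫ x, weighted V S μ ρ x ^ 2 ≤ C₁ * (N ^ 2 + Δ) := by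
    have h := integral_sq_le hρ.memLp_weighted hg t
    have h2 : 2 * t ^ 2 * γ ≤ 2 * (2 * K ^ 2 * (N ^ 2 + J)) * γ := by gcongr
    have h3 : (2 + 4 * K ^ 2 * γ) * J ≤ (2 + 4 * K ^ 2 * γ) * (C * D * Δ) := by gcongr
    have h4 : 0 ≤ 4 * K ^ 2 * γ * Δ := by positivity
    have h5 : 0 ≤ (2 + 4 * K ^ 2 * γ) * (C * D) * N ^ 2 := by positivity
    rw [hC₁]
    linarith
  -- The drift is 2(u - ∇w), and (2x + 4πy)² ≤ 8x² + 32π²y².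
  have hdrift : ∑ i, ‖besselRep (-1) (toTempered (weightedDrift V S μ ρ i))‖ ^ 2 ≤
      8 * Q + 32 * Real.pi ^ 2 * d * ∫ x, weighted V S μ ρ x ^ 2 := by
    have h1 : ∀ i ∈ Finset.univ, ‖besselRep (-1) (toTempered (weightedDrift V S μ ρ i))‖ ^ 2 ≤
        8 * ‖besselRep (-1) (weightedGradient V S μ ρ i)‖ ^ 2 +
          32 * Real.pi ^ 2 * ∫ x, weighted V S μ ρ x ^ 2 := fun i _ => by
      have h := pow_le_pow_left₀ (norm_nonneg _) (hρ.norm_drift_le hS i) 2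
      rw [← norm_sq_complexL2 hρ.memLp_weighted]
      nlinarith [sq_nonneg (2 * ‖besselRep (-1) (weightedGradient V S μ ρ i)‖ -
        4 * Real.pi * ‖complexL2 hρ.memLp_weighted‖)]
    refine (Finset.sum_le_sum h1).trans (le_of_eq ?_)
    rw [Finset.sum_add_distrib, ← Finset.mul_sum, Finset.sum_const, Finset.card_univ,
      Fintype.card_fin, nsmul_eq_mul]
    ring
  have hsob : ∑ i : Fin d, sobolevNorm (-1) (toTempered (weightedDrift V S μ ρ i)) ^ 2 =
      ENNReal.ofReal (∑ i, ‖besselRep (-1) (toTempered (weightedDrift V S μ ρ i))‖ ^ 2) := by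
    rw [ENNReal.ofReal_sum_of_nonneg fun _ _ => sq_nonneg _]
    refine Finset.sum_congr rfl fun i _ => ?_
    rw [sobolevNorm_of_mem (hρ.toTempered_drift i).2, ENNReal.ofReal_pow (norm_nonneg _),
      ofReal_norm]
  rw [eLpNorm_sq_eq hρ.memLp_weighted, hsob, ← ENNReal.ofReal_add
    (integral_nonneg fun x => sq_nonneg _) (Finset.sum_nonneg fun _ _ => sq_nonneg _)]
  refine ENNReal.ofReal_le_ofReal ?_
  have h6 : 32 * Real.pi ^ 2 * d * (∫ x, weighted V S μ ρ x ^ 2) ≤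
      32 * Real.pi ^ 2 * d * (C₁ * (N ^ 2 + Δ)) := by gcongr
  have h7 : 0 ≤ D * N ^ 2 := by positivity
  have h8 : 0 ≤ N ^ 2 + Δ := by positivity
  linarith

end SteinLogSobolev

end

open SteinLogSobolev in
theorem theorem1p1 (d : ℕ) (hd : 1 ≤ d) :
    ∃ ε : ℝ, 0 < ε ∧
    ∀ (V : E d → ℝ) (S : Matrix (Fin d) (Fin d) ℝ) (c D : ℝ),
      LocallyBounded V → (∀ᵐ x : E d, 0 ≤ V x) → S.PosDef → 1 ≤ D →
      -- the constant `λ` depends on `V`, `Σ`, `𝒞` and `𝒟_k` only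
      (∃ lam : ℝ, 0 < lam ∧
        ∀ (μ : E d), (∀ᵐ x : E d, c + V₀ S μ x ≤ V x) →
        ∀ (k : E d → ℝ), IsAdmissibleKernel k D →
        ∀ (ρ : E d → ℝ), IsRegular V S μ ρ →
          -- the dissipation is a duality pairing of `H⁻¹` and `H¹`
          (∀ i : Fin d,
            IsWeightedGradient V S μ ρ i (weightedGradient V S μ ρ i) ∧
            MemSobolev (-1) 2 (weightedGradient V S μ ρ i) ∧
            IsKernelConv k (weightedGradient V S μ ρ i)
              (kernelConv k (weightedGradient V S μ ρ i)) ∧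
            MemSobolev 1 2 (kernelConv k (weightedGradient V S μ ρ i))) ∧
          -- the `L²` lower bound, `τ` being computed in the coordinates that normalize `Σ` and `μ`
          freqIntegral (ellipsoid S ε) μ (halfGaussian S μ) ≠ 0 ∧
          L2LowerBound lam k V S μ ρ (tau (ellipsoid S ε) μ V S μ ρ) ∧
          -- the Stein-log-Sobolev inequality
          ((∀ᵐ x : E d, 0 ≤ ρ x) → (∫ x, ρ x) = 1 →
            ENNReal.ofReal lam * InformationTheory.klDiv
                (volume.withDensity (fun x => ENNReal.ofReal (ρ x))) (target V)
              ≤ ENNReal.ofReal (dissipation k V S μ ρ))) ∧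
      -- the `L²` lower bound, `τ` being computed on a ball in the original coordinates
      (∀ (μ : E d), (∀ᵐ x : E d, c + V₀ S μ x ≤ V x) →
        ∀ δ : ℝ, 0 < δ → freqIntegral (Metric.ball 0 δ) 0 (halfGaussian S μ) ≠ 0 →
        ∃ lam : ℝ, 0 < lam ∧
          ∀ (k : E d → ℝ), IsAdmissibleKernel k D →
          ∀ (ρ : E d → ℝ), IsRegular V S μ ρ →
            L2LowerBound lam k V S μ ρ (tau (Metric.ball 0 δ) 0 V S μ ρ)) ∧
      -- the bound in `L²` and `H⁻¹`
      (∀ (μ : E d), (∀ᵐ x : E d, c + V₀ S μ x ≤ V x) →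
        ∀ (k : E d → ℝ), IsAdmissibleKernel k D →
        ∃ C : ℝ, 0 < C ∧
          ∀ (ρ : E d → ℝ), IsRegular V S μ ρ →
            eLpNorm (weighted V S μ ρ) 2 volume ^ 2 +
                ∑ i : Fin d, sobolevNorm (-1) (toTempered (weightedDrift V S μ ρ i)) ^ 2
              ≤ ENNReal.ofReal (C * ((∫ x, |ρ x|) ^ 2 + dissipation k V S μ ρ))) := by
  -- The value 1 is arbitrary: the estimates on the ellipsoid hold for every positive ε.
  refine ⟨1, one_pos, fun V S c D hV _ hS hD => ⟨?_, fun μ _ δ _ hne => ?_,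
    fun μ _ k hk => exists_regularity_bound hV hS μ hk hD⟩⟩
  · obtain ⟨C, hC, hgap⟩ := exists_integral_sub_tau_ellipsoid_le hS one_pos
    set Z := ∫ x, Real.exp (-V x) with hZ
    have hZ0 : 0 ≤ Z := integral_nonneg fun x => (Real.exp_pos _).le
    have hD0 : 0 < D := by linarith
    -- One constant serves both inequalities: the summand 1 is for the L² bound, Z e^{-c} for the
    -- entropy. Only Z ≥ 0 is used, since e^{-V} is known to be integrable only once some μ
    -- satisfies the lower bound on V.
    set lam := 1 / (C * D * (1 + Z * Real.exp (-c))) with hlam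
    have hlam0 : 0 < lam := by positivity
    refine ⟨lam, hlam0, fun μ hc k hk ρ hρ => ?_⟩
    have hdiss := sum_norm_sq_le_dissipation hk hD hS hρ
    set J := ∫ x, |weighted V S μ ρ x - tau (ellipsoid S 1) μ V S μ ρ * halfGaussian S μ x| ^ 2
      with hJ
    have hJ0 : 0 ≤ J := integral_nonneg fun x => by positivity
    have hbound : J ≤ C * D * dissipation k V S μ ρ := by
      refine (hgap V μ ρ hρ).trans ?_
      rw [mul_assoc]
      gcongr
    have hkey : lam * ((1 + Z * Real.exp (-c)) * J) ≤ dissipation k V S μ ρ := by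
      have e : lam * ((1 + Z * Real.exp (-c)) * J) = J / (C * D) := by
        rw [hlam]
        field_simp
      rw [e, div_le_iff₀ (by positivity), mul_comm]
      exact hbound
    have hpos : 0 ≤ Z * Real.exp (-c) * J := by positivity
    refine ⟨fun i => ?_, ?_, ?_, fun h0 h1 => ?_⟩
    · have hu := hρ.memSobolev hS i
      refine ⟨?_, hu, hk.isKernelConv hD hu⟩
      rw [hρ.weightedGradient_eq hS]
      exact hρ.isWeightedGradient hS i
    · obtain ⟨R, -, hR⟩ := exists_norm_halfGaussian_le hS one_pos
      exact (hR μ).1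
    · refine le_trans ?_ hkey
      refine mul_le_mul_of_nonneg_left ?_ hlam0.le
      linarith
    · refine (mul_le_mul_right (klDiv_le hV.aestronglyMeasurable hS hc hρ h0 h1
        (tau (ellipsoid S 1) μ V S μ ρ)) _).trans ?_
      rw [← ENNReal.ofReal_mul hlam0.le]
      refine ENNReal.ofReal_le_ofReal (le_trans ?_ hkey)
      refine mul_le_mul_of_nonneg_left ?_ hlam0.le
      linarith
  · obtain ⟨C, hC, hgap⟩ := exists_integral_sub_tau_le hS μ measurableSet_ball
      (measure_ball_lt_top (x := (0 : E d)) (r := δ)).ne 0 hne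
    refine ⟨1 / (C * D), by positivity, fun k hk ρ hρ => ?_⟩
    have hdiss := sum_norm_sq_le_dissipation hk hD hS hρ
    rw [L2LowerBound, one_div_mul_eq_div, div_le_iff₀ (by positivity), mul_comm _ (C * D)]
    refine (hgap V ρ hρ).trans ?_
    rw [mul_assoc]
    gcongr
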